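/- Let $\lambda>0$ and consider a Poisson point process of constant intensity $\lambda^2$ in the unit square $[0,1]^2$. An up/right path joins points of the process by straight segments going strictly upwards and to the right (positive slope); it is extended by an extra segment at both ends so as to begin at $(0,0)$ and finish at $(1,1)$, and its length is the number of points of the process that it passes through as vertices. Let $l^{*}$ be the maximal length of such a path, and for $N\ge 0$ let $l^{*}_N$ be this maximal length in a realization with exactly $N$ points, i.e. $\Pr(l^{*}_N\le l)$ is the conditional probability of $l^{*}\le l$ given that the process has exactly $N$ points. For $l\ge 0$ let $\langle F(\theta_1,\dots,\theta_l)\rangle_{U(l)}$ denote the average of $F$ over the eigenvalue density of $U(l)$, $$\frac{1}{(2\pi)^l\, l!}\prod_{1\le j<k\le l}|e^{i\theta_k}-e^{i\theta_j}|^2,\qquad -\pi<\theta_j<\pi,$$ and let $\langle\,\cdot\,\rangle_{U\in U(l)}$ denote the average with respect to the Haar probability measure on the unitary group $U(l)$. Then, for all integers $l\ge 0$: (1) for every integer $N\ge 0$, $$\Pr(l^{*}_N\le l)=\frac1{N!}\,\frac{1}{(2\pi)^l\,l!}\int_{-\pi}^{\pi}d\theta_1\cdots\int_{-\pi}^{\pi}d\theta_l\,\Big|\sum_{j=1}^l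 e^{i\theta_j}\Big|^{2N}\prod_{1\le j<k\le l}|e^{i\theta_k}-e^{i\theta_j}|^2=\frac{N!}{(2N)!}\Big\langle\Big(\sum_{j=1}^l 2\cos\theta_j\Big)^{2N}\Big\rangle_{U(l)};$$ (2) $$\Pr(l^{*}\le l)=e^{-\lambda^2}\Big\langle e^{\lambda\,\mathrm{Tr}(U+U^\dagger)}\Big\rangle_{U\in U(l)}=e^{-\lambda^2}\Big\langle e^{\lambda\sum_{j=1}^l 2\cos\theta_j}\Big\rangle_{U(l)}.$$ -/

import Mathlib

open MeasureTheory ProbabilityTheory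
open scoped ENNReal Nat

noncomputable section

namespace Hammersley

/-! ### Poisson point processes -/

/-- The random point configuration `Pts` (a random subset of `E`) is a Poisson point process with
(diffuse) intensity measure `ρ`: the number of points in a measurable set `B` of finite intensity
is Poisson distributed with mean `ρ B`, and the numbers of points in pairwise disjoint measurable
sets are independent. -/
structure IsPoissonProcess {Ω E : Type*} [MeasurableSpace Ω] [MeasurableSpace E]
    (Pts : Ω → Set E) (ρ : Measure E) (P : Measure Ω) : Prop where
  measurable_count : ∀ B : Set E, MeasurableSet B → Measurable fun ω => (Pts ω ∩ B).encard
  law_count : ∀ B : Set E, MeasurableSet B → ρ B ≠ ∞ → ∀ k : ℕ,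
    P {ω | (Pts ω ∩ B).encard = k} = poissonMeasure (ρ B).toNNReal {k}
  indep_count : ∀ (n : ℕ) (B : Fin n → Set E), (∀ i, MeasurableSet (B i)) →
    Pairwise (fun i j => Disjoint (B i) (B j)) →
    iIndepFun (fun i ω => (Pts ω ∩ B i).encard) P

/-- The unit square in the plane. -/
def unitSquare : Set (ℝ × ℝ) := Set.Icc 0 1 ×ˢ Set.Icc 0 1

/-- Constant intensity `lam ^ 2` on the unit square (and no points outside it). -/
def intensity (lam : ℝ) : Measure (ℝ × ℝ) :=
  ENNReal.ofReal (lam ^ 2) • (volume : Measure (ℝ × ℝ)).restrict unitSquare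

/-! ### Up/right paths -/

/-- The straight segment from `p` to `q` is oriented up and to the right (it has positive slope and
is traversed from left to right). -/
def UpRight (p q : ℝ × ℝ) : Prop := p.1 < q.1 ∧ p.2 < q.2

/-- `L` lists the points, in order, of an up/right path through points of the configuration `S`,
where the path is extended by an extra segment at both ends so as to begin at `(0, 0)` and to
finish at `(1, 1)`. -/
def IsUpRightPath (S : Set (ℝ × ℝ)) (L : List (ℝ × ℝ)) : Prop :=
  (∀ p ∈ L, p ∈ S) ∧ List.IsChain UpRight (((0, 0) : ℝ × ℝ) :: (L ++ [(1, 1)]))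

/-- The maximal number of points of `S` on an extended up/right path. -/
def maxPathLength (S : Set (ℝ × ℝ)) : ℕ∞ :=
  ⨆ (L : List (ℝ × ℝ)) (_ : IsUpRightPath S L), (L.length : ℕ∞)

/-! ### Averages over the unitary group -/

/-- The eigenvalue density `(1 / ((2π)^l l!)) ∏_{j < k} |e^{iθ_k} - e^{iθ_j}|^2` of `U(l)`. -/
def eigenvalueDensity (l : ℕ) (θ : Fin l → ℝ) : ℝ :=
  1 / ((2 * Real.pi) ^ l * (l ! : ℝ)) *
    ∏ j : Fin l, ∏ k ∈ Finset.Ioi j,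
      ‖Complex.exp (Complex.I * θ k) - Complex.exp (Complex.I * θ j)‖ ^ 2

/-- The average of a function of the eigenvalue angles `θ_j ∈ (-π, π)` over the eigenvalue density
of `U(l)`. -/
def eigenvalueAverage (l : ℕ) (F : (Fin l → ℝ) → ℝ) : ℝ :=
  ∫ θ in Set.univ.pi fun _ : Fin l => Set.Ioo (-Real.pi) Real.pi, F θ * eigenvalueDensity l θ

instance compactSpace_unitaryGroup (l : ℕ) : CompactSpace (Matrix.unitaryGroup (Fin l) ℂ) := by
  refine isCompact_iff_compactSpace.mp ?_
  have hK : IsCompact (Set.univ.pi fun _ : Fin l => Set.univ.pi fun _ : Fin l =>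
      Metric.closedBall (0 : ℂ) 1) :=
    isCompact_univ_pi fun _ => isCompact_univ_pi fun _ => isCompact_closedBall 0 1
  refine IsCompact.of_isClosed_subset (hK : IsCompact (X := Matrix (Fin l) (Fin l) ℂ) _)
    isClosed_unitary ?_
  intro U hU i _ j _
  simpa using entry_norm_bound_of_unitary hU i j

instance measurableSpace_unitaryGroup (l : ℕ) :
    MeasurableSpace (Matrix.unitaryGroup (Fin l) ℂ) := borel _

instance borelSpace_unitaryGroup (l : ℕ) : BorelSpace (Matrix.unitaryGroup (Fin l) ℂ) := ⟨rfl⟩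

/-- The Haar probability measure on the unitary group `U(l)`. -/
def haarU (l : ℕ) : Measure (Matrix.unitaryGroup (Fin l) ℂ) := Measure.haarMeasure ⊤

instance isHaarMeasure_haarU (l : ℕ) : (haarU l).IsHaarMeasure := by
  unfold haarU; infer_instance

instance isProbabilityMeasure_haarU (l : ℕ) : IsProbabilityMeasure (haarU l) :=
  ⟨by
    have h := Measure.haarMeasure_self
      (K₀ := (⊤ : TopologicalSpace.PositiveCompacts (Matrix.unitaryGroup (Fin l) ℂ)))
    simpa [haarU] using h⟩

/-- The average over `U ∈ U(l)` of a function of a unitary matrix. -/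
def unitaryAverage (l : ℕ) (F : Matrix (Fin l) (Fin l) ℂ → ℂ) : ℂ :=
  ∫ U : Matrix.unitaryGroup (Fin l) ℂ, F U.1 ∂haarU l

end Hammersley

end

/-!
The longest up/right path of a Poisson process, and averages over the unitary group.

Cut the unit square into `n ^ 2` cells. The events "one point in each of `N` cells in distinct rows
and columns, and no other points" are disjoint, and on such an event the configuration looks like a
permutation `σ` of `N` letters whose increasing subsequences are the up/right paths
(`Placement.Occupied.maxPathLength_le_iff`). All these events have the same probability, and as
`n → ∞` they exhaust the event that there are `N` points. So `σ` is uniformly distributed, and the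
left hand sides are governed by the number of permutations without increasing subsequences longer
than `l` (`cond_maxPathLength_le`, `hasSum_measureReal_maxPathLength_le`). The event that the path
length is at most `l` is squeezed between measurable events, so its measurability is not needed.

By the Robinson–Schensted correspondence, that number is the number of pairs of lattice words of
length `N` in `l` letters with the same content (`card_lisLE`). The correspondence is set up with
growth diagrams: the local rule and its inverse show that a permutation matrix and the two chains of
shapes on the upper and right boundary of its diagram determine each other, and the first row of the
shape at a point is the length of the longest increasing subsequence to its lower left.

On the torus, multiplication by `p₁ = ∑ j, z_j` adds a box to the shape of an alternant, so
`p₁ ^ N Δ`, with `Δ` the Vandermonde product, is the sum over lattice words of length `N` of the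
alternants of their contents. Since alternants are orthogonal, the `2N`-th absolute moment of `p₁`
with respect to the eigenvalue density counts the same pairs (`eigenvalueAverage_norm_pow`), and the
moments of `p₁ + p₋₁` follow by the binomial theorem (`eigenvalueAverage_cos_pow`).

It remains to see that Haar averages of polynomials in the power sums are averages over the
eigenvalue density (a case of Weyl's integration formula). Both functionals satisfy the loop
equations `Φ ((∑_{a=1}^{k} p_a p_{k-a}) f + δ_k f) = 0`, where `δ_k p_m = m p_{m+k}`: on the torus this
is integration by parts (`Laurent.weightedTerm_field`); for Haar measure it is the vanishing of the
average of derivatives along one-parameter subgroups, contracted over the matrix units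
(`PowerSums.isLoop_haarAverage`). The loop equations have only one normalized solution
(`PowerSums.IsLoop.eq_weightedTerm`): combining them with the gradient shows that a solution vanishes on the
image of the Laplacian of the eigenvalue density. This Laplacian preserves the finite dimensional
spaces of polynomials of bounded degree, and its Dirichlet form is definite modulo constants, so
every polynomial is a constant plus a Laplacian as a function on the torus.

Summing the exponential series term by term gives the formulas for the Poissonized problem.
-/

noncomputable section

namespace Hammersley

/-! ### Local growth rules -/

/-- `μ` and `lam`, given by their row lengths, interlace: `lam / μ` is a horizontal strip. -/
def Interlace (μ lam : ℕ → ℕ) : Prop := ∀ k, μ k ≤ lam k ∧ lam (k + 1) ≤ μ k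

/-- The local rule of the Robinson–Schensted–Knuth correspondence in its piecewise linear form: the
shape at the upper right corner of a cell with entry `x`, computed from the shape `ρ` at the lower
left corner and the shapes `μ`, `ν` at the two other corners. -/
def growthStep (x : ℕ) (ρ μ ν : ℕ → ℕ) : ℕ → ℕ
  | 0 => max (μ 0) (ν 0) + x
  | k + 1 => max (μ (k + 1)) (ν (k + 1)) + min (μ k) (ν k) - ρ k

/-- The inverse local rule: the shape at the lower left corner, computed from the three others. -/
def growthBack (μ ν lam : ℕ → ℕ) (k : ℕ) : ℕ :=
  max (μ (k + 1)) (ν (k + 1)) + min (μ k) (ν k) - lam (k + 1)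

lemma interlace_growthStep_left {x : ℕ} {ρ μ ν : ℕ → ℕ} (h1 : Interlace ρ μ)
    (h2 : Interlace ρ ν) : Interlace μ (growthStep x ρ μ ν) := by
  intro k
  have a1 := h1 k; have a2 := h2 k
  rcases k with _ | k
  · simp only [growthStep]; omega
  · have b1 := h1 (k + 1); have b2 := h2 (k + 1)
    have c1 := h1 k; have c2 := h2 k
    simp only [growthStep]; omega

lemma growthStep_comm (x : ℕ) (ρ μ ν : ℕ → ℕ) : growthStep x ρ μ ν = growthStep x ρ ν μ := by
  ext k; rcases k with _ | k <;> simp only [growthStep, max_comm, min_comm]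

lemma growthBack_comm (μ ν lam : ℕ → ℕ) : growthBack μ ν lam = growthBack ν μ lam := by
  ext k; simp only [growthBack, max_comm, min_comm]

lemma interlace_growthStep_right {x : ℕ} {ρ μ ν : ℕ → ℕ} (h1 : Interlace ρ μ)
    (h2 : Interlace ρ ν) : Interlace ν (growthStep x ρ μ ν) := by
  rw [growthStep_comm]; exact interlace_growthStep_left h2 h1

lemma growthBack_growthStep {x : ℕ} {ρ μ ν : ℕ → ℕ} (h1 : Interlace ρ μ)
    (h2 : Interlace ρ ν) : growthBack μ ν (growthStep x ρ μ ν) = ρ := by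
  ext k
  have a1 := h1 k; have a2 := h2 k
  simp only [growthBack, growthStep]; omega

lemma interlace_growthBack_left {μ ν lam : ℕ → ℕ} (h1 : Interlace μ lam)
    (h2 : Interlace ν lam) : Interlace (growthBack μ ν lam) μ := by
  intro k
  have a1 := h1 k; have a2 := h2 k
  have b1 := h1 (k + 1); have b2 := h2 (k + 1)
  simp only [growthBack]; omega

lemma interlace_growthBack_right {μ ν lam : ℕ → ℕ} (h1 : Interlace μ lam)
    (h2 : Interlace ν lam) : Interlace (growthBack μ ν lam) ν := by
  rw [growthBack_comm]; exact interlace_growthBack_left h2 h1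

lemma growthStep_growthBack {μ ν lam : ℕ → ℕ} (h1 : Interlace μ lam) (h2 : Interlace ν lam) :
    growthStep (lam 0 - max (μ 0) (ν 0)) (growthBack μ ν lam) μ ν = lam := by
  ext k
  rcases k with _ | k
  · have a1 := h1 0; have a2 := h2 0
    simp only [growthStep]; omega
  · have a1 := h1 k; have a2 := h2 k
    have b1 := h1 (k + 1); have b2 := h2 (k + 1)
    simp only [growthBack, growthStep]; omega

/-- The local rule conserves size: `|lam| + |ρ| = |μ| + |ν| + x`. -/
lemma sum_growthStep {x : ℕ} {ρ μ ν : ℕ → ℕ} (h1 : Interlace ρ μ) (h2 : Interlace ρ ν) (K : ℕ)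
    (hμ : μ K = 0) (hν : ν K = 0) :
    ∑ k ∈ Finset.range (K + 1), growthStep x ρ μ ν k + ∑ k ∈ Finset.range K, ρ k
      = ∑ k ∈ Finset.range K, μ k + ∑ k ∈ Finset.range K, ν k + x := by
  rw [Finset.sum_range_succ']
  have e : ∀ k, growthStep x ρ μ ν (k + 1) + ρ k
      = max (μ (k + 1)) (ν (k + 1)) + min (μ k) (ν k) := by
    intro k
    have a1 := h1 k; have a2 := h2 k
    simp only [growthStep]; omega
  have s1 : ∑ k ∈ Finset.range K, (growthStep x ρ μ ν (k + 1) + ρ k)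
      = ∑ k ∈ Finset.range K, max (μ (k + 1)) (ν (k + 1))
        + ∑ k ∈ Finset.range K, min (μ k) (ν k) := by
    rw [← Finset.sum_add_distrib]; exact Finset.sum_congr rfl fun k _ => e k
  have s2 : ∑ k ∈ Finset.range K, max (μ (k + 1)) (ν (k + 1)) + max (μ 0) (ν 0)
      = ∑ k ∈ Finset.range K, max (μ k) (ν k) := by
    rw [← Finset.sum_range_succ' (fun k => max (μ k) (ν k)), Finset.sum_range_succ, hμ, hν]; simp
  have s3 : ∑ k ∈ Finset.range K, max (μ k) (ν k) + ∑ k ∈ Finset.range K, min (μ k) (ν k)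
      = ∑ k ∈ Finset.range K, μ k + ∑ k ∈ Finset.range K, ν k := by
    rw [← Finset.sum_add_distrib, ← Finset.sum_add_distrib]
    exact Finset.sum_congr rfl fun k _ => max_add_min _ _
  rw [Finset.sum_add_distrib] at s1
  have e0 : growthStep x ρ μ ν 0 = max (μ 0) (ν 0) + x := rfl
  omega

/-! ### Growth diagrams -/

/-- The growth diagram of a matrix of natural numbers: the shape at the point `(i, j)` of the grid,
with empty shapes on the two axes. -/
def growth (X : ℕ → ℕ → ℕ) : ℕ → ℕ → ℕ → ℕ
  | 0, _ => 0
  | _ + 1, 0 => 0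
  | i + 1, j + 1 => growthStep (X i j) (growth X i j) (growth X i (j + 1)) (growth X (i + 1) j)
termination_by i j => (i, j)

/-- The growth diagram computed backwards from its upper and its right boundary `t` and `r`; the
coordinates are the distances from the upper right corner. -/
def growthFromCorner (t r : ℕ → ℕ → ℕ) : ℕ → ℕ → ℕ → ℕ
  | 0, j => t j
  | i + 1, 0 => r (i + 1)
  | i + 1, j + 1 => growthBack (growthFromCorner t r i (j + 1)) (growthFromCorner t r (i + 1) j)
      (growthFromCorner t r i j)
termination_by i j => (i, j)

lemma interlace_zero : Interlace 0 0 := fun _ => ⟨le_rfl, le_rfl⟩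

lemma growth_zero_left (X : ℕ → ℕ → ℕ) (j : ℕ) : growth X 0 j = 0 := by
  rw [growth]

lemma growth_zero_right (X : ℕ → ℕ → ℕ) (i : ℕ) : growth X i 0 = 0 := by
  rcases i with _ | i <;> rw [growth]

lemma growth_succ (X : ℕ → ℕ → ℕ) (i j : ℕ) : growth X (i + 1) (j + 1) =
    growthStep (X i j) (growth X i j) (growth X i (j + 1)) (growth X (i + 1) j) := by
  rw [growth]

lemma interlace_growth (X : ℕ → ℕ → ℕ) (i j : ℕ) :
    Interlace (growth X i j) (growth X (i + 1) j) ∧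
      Interlace (growth X i j) (growth X i (j + 1)) := by
  induction i generalizing j with
  | zero =>
    refine ⟨?_, ?_⟩
    · induction j with
      | zero => simpa [growth_zero_left, growth_zero_right] using interlace_zero
      | succ j ih =>
        rw [growth_succ]
        refine interlace_growthStep_left ?_ ih
        simpa [growth_zero_left] using interlace_zero
    · simpa [growth_zero_left] using interlace_zero
  | succ i ih =>
    have key : ∀ j, Interlace (growth X (i + 1) j) (growth X (i + 1) (j + 1)) := by
      intro j
      rw [growth_succ]
      exact interlace_growthStep_right (ih j).2 (ih j).1
    refine ⟨?_, key j⟩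
    induction j with
    | zero => simpa [growth_zero_right] using interlace_zero
    | succ j ihj =>
      rw [growth_succ X (i + 1)]
      exact interlace_growthStep_left (key j) ihj

lemma growth_eq_zero (X : ℕ → ℕ → ℕ) (i j k : ℕ) (h : i ≤ k) : growth X i j k = 0 := by
  induction i generalizing k with
  | zero => rw [growth_zero_left]; rfl
  | succ i ih =>
    obtain ⟨k, rfl⟩ : ∃ k', k = k' + 1 := ⟨k - 1, by omega⟩
    have := ((interlace_growth X i j).1 k).2
    have := ih k (by omega)
    omega

lemma growth_mono_right (X : ℕ → ℕ → ℕ) {i j j' : ℕ} (h : j ≤ j') (k : ℕ) :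
    growth X i j k ≤ growth X i j' k := by
  induction h with
  | refl => exact le_rfl
  | step _ ih => exact ih.trans ((interlace_growth X i _).2 k).1

/-- The size of the shape at a grid point is the sum of the entries to its lower left. -/
lemma sum_growth (X : ℕ → ℕ → ℕ) (K i j : ℕ) (hi : i ≤ K) :
    ∑ k ∈ Finset.range K, growth X i j k
      = ∑ a ∈ Finset.range i, ∑ b ∈ Finset.range j, X a b := by
  induction i generalizing j with
  | zero => simp [growth_zero_left]
  | succ i ih =>
    induction j with
    | zero => simp [growth_zero_right]
    | succ j ihj =>
      have h := sum_growthStep (x := X i j) (interlace_growth X i j).2 (interlace_growth X i j).1 K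
        (growth_eq_zero X i (j + 1) K (by omega)) (growth_eq_zero X (i + 1) j K hi)
      rw [← growth_succ, Finset.sum_range_succ, growth_eq_zero X (i + 1) (j + 1) K hi,
        ih j (by omega), ih (j + 1) (by omega), ihj] at h
      simp only [Finset.sum_range_succ _ i, Finset.sum_range_succ _ j] at h ⊢
      omega

section FromCorner

variable {t r : ℕ → ℕ → ℕ}

lemma growthFromCorner_zero_left (j : ℕ) : growthFromCorner t r 0 j = t j := by
  rw [growthFromCorner]

lemma growthFromCorner_zero_right (h0 : t 0 = r 0) (i : ℕ) : growthFromCorner t r i 0 = r i := by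
  rcases i with _ | i <;> rw [growthFromCorner]; exact h0

lemma growthFromCorner_succ (i j : ℕ) : growthFromCorner t r (i + 1) (j + 1) =
    growthBack (growthFromCorner t r i (j + 1)) (growthFromCorner t r (i + 1) j)
      (growthFromCorner t r i j) := by
  rw [growthFromCorner]

lemma interlace_growthFromCorner (h0 : t 0 = r 0) (ht : ∀ j, Interlace (t (j + 1)) (t j))
    (hr : ∀ j, Interlace (r (j + 1)) (r j)) (i j : ℕ) :
    Interlace (growthFromCorner t r (i + 1) j) (growthFromCorner t r i j) ∧
      Interlace (growthFromCorner t r i (j + 1)) (growthFromCorner t r i j) := by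
  induction i generalizing j with
  | zero =>
    refine ⟨?_, ?_⟩
    · induction j with
      | zero => simpa [growthFromCorner_zero_right h0] using hr 0
      | succ j ih =>
        rw [growthFromCorner_succ]
        refine interlace_growthBack_left ?_ ih
        simpa [growthFromCorner_zero_left] using ht j
    · simpa [growthFromCorner_zero_left] using ht j
  | succ i ih =>
    have key : ∀ j, Interlace (growthFromCorner t r (i + 1) (j + 1))
        (growthFromCorner t r (i + 1) j) := by
      intro j
      rw [growthFromCorner_succ]
      exact interlace_growthBack_right (ih j).2 (ih j).1
    refine ⟨?_, key j⟩
    induction j with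
    | zero => simpa [growthFromCorner_zero_right h0] using hr (i + 1)
    | succ j ihj =>
      rw [growthFromCorner_succ (i + 1)]
      exact interlace_growthBack_left (key j) ihj

/-- The entries that a growth diagram computed backwards belongs to. -/
def entriesFromCorner (t r : ℕ → ℕ → ℕ) (N i j : ℕ) : ℕ :=
  growthFromCorner t r (N - (i + 1)) (N - (j + 1)) 0
    - max (growthFromCorner t r (N - i) (N - (j + 1)) 0)
        (growthFromCorner t r (N - (i + 1)) (N - j) 0)

/-- A growth diagram computed backwards agrees with the one computed forwards. -/
lemma growth_entriesFromCorner (h0 : t 0 = r 0) (ht : ∀ j, Interlace (t (j + 1)) (t j))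
    (hr : ∀ j, Interlace (r (j + 1)) (r j)) (N : ℕ) (htN : t N = 0) (hrN : r N = 0)
    (i j : ℕ) (hi : i ≤ N) (hj : j ≤ N) :
    growth (entriesFromCorner t r N) i j = growthFromCorner t r (N - i) (N - j) := by
  have zero_of : ∀ {μ lam : ℕ → ℕ}, Interlace μ lam → lam = 0 → μ = 0 := by
    intro μ lam h hl; ext k; have := (h k).1; rw [hl] at this; simpa using this
  have hright : ∀ i, growthFromCorner t r i N = 0 := by
    intro i
    induction i with
    | zero => rw [growthFromCorner_zero_left, htN]
    | succ i ih => exact zero_of (interlace_growthFromCorner h0 ht hr i N).1 ih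
  have hleft : ∀ j, growthFromCorner t r N j = 0 := by
    intro j
    induction j with
    | zero => rw [growthFromCorner_zero_right h0, hrN]
    | succ j ih => exact zero_of (interlace_growthFromCorner h0 ht hr N j).2 ih
  induction i generalizing j with
  | zero => rw [growth_zero_left, Nat.sub_zero, hleft]
  | succ i ih =>
    induction j with
    | zero => rw [growth_zero_right, Nat.sub_zero, hright]
    | succ j ihj =>
      rw [growth_succ, ih j (by omega) (by omega), ih (j + 1) (by omega) hj, ihj (by omega)]
      obtain ⟨a, ha⟩ : ∃ a, N - i = a + 1 := ⟨N - i - 1, by omega⟩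
      obtain ⟨b, hb⟩ : ∃ b, N - j = b + 1 := ⟨N - j - 1, by omega⟩
      have ha' : N - (i + 1) = a := by omega
      have hb' : N - (j + 1) = b := by omega
      have hI := interlace_growthFromCorner h0 ht hr a b
      simp only [entriesFromCorner, ha, hb, ha', hb']
      rw [growthFromCorner_succ]
      nth_rewrite 1 [growthBack_comm]
      rw [growthBack_comm]
      rw [growthBack_comm (growthFromCorner t r a (b + 1))]
      exact growthStep_growthBack hI.1 hI.2

end FromCorner

/-- A growth diagram is determined by its upper and right boundaries. -/
lemma growth_eq_of_boundary_eq {X Y : ℕ → ℕ → ℕ} {N : ℕ}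
    (h1 : ∀ i ≤ N, growth X i N = growth Y i N) (h2 : ∀ j ≤ N, growth X N j = growth Y N j)
    (i j : ℕ) (hi : i ≤ N) (hj : j ≤ N) : growth X i j = growth Y i j := by
  obtain ⟨a, rfl⟩ : ∃ a, i = N - a := ⟨N - i, by omega⟩
  obtain ⟨b, rfl⟩ : ∃ b, j = N - b := ⟨N - j, by omega⟩
  clear hi hj
  induction a generalizing b with
  | zero => exact h2 _ (by omega)
  | succ a ih =>
    induction b with
    | zero => exact h1 _ (by omega)
    | succ b ihb =>
      by_cases ha : N ≤ a
      · have : N - (a + 1) = N - a := by omega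
        rw [this]; exact ih (b + 1)
      by_cases hb : N ≤ b
      · have : N - (b + 1) = N - b := by omega
        rw [this]; exact ihb
      have ea : N - a = N - (a + 1) + 1 := by omega
      have eb : N - b = N - (b + 1) + 1 := by omega
      have A := ih b
      have B := ih (b + 1)
      rw [ea, eb] at A
      rw [ea] at B
      rw [eb] at ihb
      generalize N - (a + 1) = i at *
      generalize N - (b + 1) = j at *
      have IX := interlace_growth X i j
      have IY := interlace_growth Y i j
      rw [← growthBack_growthStep (x := X i j) IX.2 IX.1,
        ← growthBack_growthStep (x := Y i j) IY.2 IY.1, ← growth_succ, ← growth_succ, A, B, ihb]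

lemma entry_eq_growth (X : ℕ → ℕ → ℕ) (i j : ℕ) :
    X i j = growth X (i + 1) (j + 1) 0 - max (growth X i (j + 1) 0) (growth X (i + 1) j 0) := by
  rw [growth_succ]; simp [growthStep]

/-! ### Lattice words and conjugate shapes -/

/-- The content of a word: the number of occurrences of each letter. -/
def content {l : ℕ} (w : List (Fin l)) (j : Fin l) : ℕ := w.count j

/-- The lattice words (Yamanouchi words) of length `n` in `l` letters: every suffix contains each
letter at least as often as the next one. They encode the standard Young tableaux of size `n` with
at most `l` rows. -/
def latticeWords (l : ℕ) : ℕ → Finset (List (Fin l))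
  | 0 => {[]}
  | n + 1 => ((Finset.univ ×ˢ latticeWords l n).image fun p => p.1 :: p.2).filter
      fun w => Antitone (content w)

lemma content_cons {l : ℕ} (i : Fin l) (w : List (Fin l)) :
    content (i :: w) = content w + Pi.single i 1 := by
  ext j
  simp only [content, List.count_cons, Pi.add_apply, Pi.single_apply, beq_iff_eq, eq_comm (a := j)]

lemma sum_content {l : ℕ} (w : List (Fin l)) : ∑ j, content w j = w.length := by
  induction w with
  | nil => simp [content]
  | cons i w ih => simp [content_cons, Finset.sum_add_distrib, ih]

lemma mem_latticeWords {l n : ℕ} {w : List (Fin l)} :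
    w ∈ latticeWords l n ↔ w.length = n ∧ ∀ m, Antitone (content (w.drop m)) := by
  induction n generalizing w with
  | zero =>
    simp only [latticeWords, Finset.mem_singleton]
    constructor
    · rintro rfl; exact ⟨rfl, fun m => by intro i j _; simp [content]⟩
    · intro h; exact List.length_eq_zero_iff.mp h.1
  | succ n ih =>
    simp only [latticeWords, Finset.mem_filter, Finset.mem_image, Finset.mem_product,
      Finset.mem_univ, true_and, Prod.exists, ih]
    constructor
    · rintro ⟨⟨i, v, ⟨hv, h⟩, rfl⟩, ha⟩
      refine ⟨by simp [hv], fun m => ?_⟩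
      rcases m with _ | m
      · exact ha
      · exact h m
    · rintro ⟨hw, h⟩
      rcases w with _ | ⟨i, v⟩
      · simp at hw
      · exact ⟨⟨i, v, ⟨by simpa using hw, fun m => h (m + 1)⟩, rfl⟩, h 0⟩

/-- The conjugate of a shape with at most `l` rows. -/
def conjShape {l : ℕ} (μ : Fin l → ℕ) (k : ℕ) : ℕ :=
  (Finset.univ.filter fun j => k < μ j).card

lemma conjShape_add_single {l : ℕ} (μ : Fin l → ℕ) (i : Fin l) :
    conjShape (μ + Pi.single i 1) = conjShape μ + Pi.single (μ i) 1 := by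
  ext k
  simp only [conjShape, Finset.card_filter, Pi.add_apply]
  have : ∀ j : Fin l, (if k < μ j + (Pi.single i 1 : Fin l → ℕ) j then 1 else 0)
      = (if k < μ j then 1 else 0) + if j = i then (if k = μ i then 1 else 0) else 0 := by
    intro j
    by_cases hj : j = i
    · subst hj
      simp only [Pi.single_eq_same, if_true]
      split_ifs <;> omega
    · simp [hj]
  rw [Finset.sum_congr rfl fun j _ => this j, Finset.sum_add_distrib]
  simp [Pi.single_apply]

lemma conjShape_zero_le {l : ℕ} (μ : Fin l → ℕ) : conjShape μ 0 ≤ l :=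
  (Finset.card_filter_le _ _).trans (by simp)

lemma lt_conjShape_iff {l : ℕ} {μ : Fin l → ℕ} (hμ : Antitone μ) (j : Fin l) (k : ℕ) :
    (j : ℕ) < conjShape μ k ↔ k < μ j := by
  constructor
  · intro h
    by_contra hk
    have : (Finset.univ.filter fun j => k < μ j) ⊆ Finset.Iio j := by
      intro i hi
      simp only [Finset.mem_filter, Finset.mem_univ, true_and] at hi
      simp only [Finset.mem_Iio]
      by_contra hij
      exact hk (hi.trans_le (hμ (not_lt.mp hij)))
    have := Finset.card_le_card this
    rw [Fin.card_Iio] at this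
    exact absurd h (by unfold conjShape; omega)
  · intro h
    have : Finset.Iic j ⊆ (Finset.univ.filter fun j => k < μ j) := by
      intro i hi
      simp only [Finset.mem_filter, Finset.mem_univ, true_and]
      exact h.trans_le (hμ (by simpa using hi))
    have := Finset.card_le_card this
    rw [Fin.card_Iic] at this
    unfold conjShape; omega

lemma conjShape_injOn {l : ℕ} {μ ν : Fin l → ℕ} (hμ : Antitone μ) (hν : Antitone ν)
    (h : conjShape μ = conjShape ν) : μ = ν := by
  ext j
  have : ∀ k, k < μ j ↔ k < ν j := fun k => by
    rw [← lt_conjShape_iff hμ, ← lt_conjShape_iff hν, h]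
  have h1 := this (μ j); have h2 := this (ν j)
  omega

lemma sum_conjShape {l : ℕ} (μ : Fin l → ℕ) (K : ℕ) (hK : ∀ j, μ j ≤ K) :
    ∑ k ∈ Finset.range K, conjShape μ k = ∑ j, μ j := by
  simp only [conjShape, Finset.card_filter]
  rw [Finset.sum_comm]
  refine Finset.sum_congr rfl fun j _ => ?_
  rw [← Finset.card_filter]
  have : (Finset.range K).filter (fun k => k < μ j) = Finset.range (μ j) := by
    ext k; have := hK j; simp only [Finset.mem_filter, Finset.mem_range]; omega
  rw [this, Finset.card_range]

lemma interlace_conjShape_content {l : ℕ} (w : List (Fin l)) (i : Fin l) :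
    Interlace (conjShape (content w)) (conjShape (content (i :: w))) := by
  intro k
  rw [content_cons, conjShape_add_single]
  refine ⟨by simp, ?_⟩
  set μ := content w
  have mono : conjShape μ (k + 1) ≤ conjShape μ k :=
    Finset.card_le_card fun j => by
      simp only [Finset.mem_filter, Finset.mem_univ, true_and]; omega
  simp only [Pi.add_apply, Pi.single_apply]
  split_ifs with h
  · refine Finset.card_lt_card ⟨fun j => by
      simp only [Finset.mem_filter, Finset.mem_univ, true_and]; omega, fun hs => ?_⟩
    have := hs (Finset.mem_filter.mpr ⟨Finset.mem_univ i, by omega⟩)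
    simp only [Finset.mem_filter, Finset.mem_univ, true_and] at this
    omega
  · simpa using mono

lemma conjShape_content_nil {l : ℕ} : conjShape (content ([] : List (Fin l))) = 0 := by
  ext k; simp [conjShape, content]

lemma interlace_conjShape_drop {l : ℕ} (w : List (Fin l)) (m : ℕ) :
    Interlace (conjShape (content (w.drop (m + 1)))) (conjShape (content (w.drop m))) := by
  by_cases hm : m < w.length
  · rw [List.drop_eq_getElem_cons hm]; exact interlace_conjShape_content _ _
  · rw [List.drop_eq_nil_of_le (by omega), List.drop_eq_nil_of_le (by omega),
      conjShape_content_nil]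
    exact interlace_zero

/-- Every chain of shapes with first row at most `l` that starts from the empty shape and gains one
box at a time is the chain of conjugate contents of a lattice word in `l` letters. -/
lemma exists_latticeWord {l : ℕ} (n : ℕ) (c : ℕ → ℕ → ℕ) (h0 : c 0 = 0)
    (hI : ∀ i < n, Interlace (c i) (c (i + 1)))
    (hs : ∀ i < n, ∃ r, c (i + 1) = c i + Pi.single r 1) (hl : c n 0 ≤ l) :
    ∃ w ∈ latticeWords l n, ∀ i ≤ n, conjShape (content (w.drop (n - i))) = c i := by
  induction n with
  | zero =>
    refine ⟨[], by simp [latticeWords], fun i hi => ?_⟩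
    obtain rfl : i = 0 := by omega
    simpa [h0] using conjShape_content_nil
  | succ n ih =>
    have hIn := hI n (by omega)
    obtain ⟨w, hw, hc⟩ := ih (fun i hi => hI i (by omega)) (fun i hi => hs i (by omega))
      ((hIn 0).1.trans hl)
    obtain ⟨r, hr⟩ := hs n (by omega)
    have hcn : conjShape (content w) = c n := by simpa using hc n le_rfl
    have hw' := mem_latticeWords.mp hw
    have hanti : Antitone (content w) := hw'.2 0
    -- the new letter is the column of the new box
    have hjl : c n r < l := by
      have h1 : c (n + 1) r = c n r + 1 := by rw [hr]; simp
      have h2 : c (n + 1) r ≤ c (n + 1) 0 := by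
        have : ∀ k, c (n + 1) k ≤ c (n + 1) 0 := by
          intro k
          induction k with
          | zero => exact le_rfl
          | succ k ihk => exact ((hIn k).2.trans (hIn k).1).trans ihk
        exact this r
      omega
    set j : Fin l := ⟨c n r, hjl⟩ with hj
    have hjr : content w j = r := by
      apply le_antisymm
      · by_contra h
        have := (lt_conjShape_iff hanti j r).mpr (not_le.mp h)
        rw [hcn] at this; simp [hj] at this
      · by_contra h
        push Not at h
        obtain ⟨k, rfl⟩ : ∃ k, r = k + 1 := ⟨r - 1, by omega⟩
        have h1 := (hIn k).2
        rw [hr] at h1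
        simp only [Pi.add_apply, Pi.single_eq_same] at h1
        have := (lt_conjShape_iff hanti j k).mp (by rw [hcn]; simp only [hj]; omega)
        omega
    have hcontent : conjShape (content (j :: w)) = c (n + 1) := by
      rw [content_cons, conjShape_add_single, hcn, hjr, hr]
    refine ⟨j :: w, mem_latticeWords.mpr ⟨by simp [hw'.1], fun m => ?_⟩, fun i hi => ?_⟩
    · rcases m with _ | m
      · simp only [List.drop_zero]
        intro a b hab
        rw [content_cons]
        simp only [Pi.add_apply, Pi.single_apply]
        have hab' := hanti hab
        by_cases hb : b = j
        · by_cases ha : a = j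
          · simp [ha, hb]
          · have hlt : a < j := lt_of_le_of_ne (hb ▸ hab) ha
            have := (lt_conjShape_iff hanti a r).mp (by rw [hcn]; exact hlt)
            simp only [hb, ha, if_true, if_false, hjr]; omega
        · simp only [hb, if_false]; omega
      · exact hw'.2 m
    · rcases hi.lt_or_eq with hi | rfl
      · rw [show n + 1 - i = (n - i) + 1 by omega, List.drop_succ_cons]
        exact hc i (by omega)
      · simpa using hcontent

lemma eq_of_content_drop_eq {l : ℕ} {v w : List (Fin l)} (hlen : v.length = w.length)
    (h : ∀ m, content (v.drop m) = content (w.drop m)) : v = w := by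
  induction v generalizing w with
  | nil => exact (List.length_eq_zero_iff.mp hlen.symm).symm
  | cons a v ih =>
    rcases w with _ | ⟨b, w⟩
    · simp at hlen
    · obtain rfl : v = w := ih (by simpa using hlen) fun m => h (m + 1)
      have := h 0
      simp only [List.drop_zero, content_cons, add_right_inj] at this
      have := congrFun this a
      simp only [Pi.single_eq_same, Pi.single_apply] at this
      split_ifs at this with hab
      rw [hab]

/-! ### The Robinson–Schensted correspondence -/

/-- No increasing subsequence of the permutation `σ` is longer than `l`. -/
def LisLE {N : ℕ} (σ : Equiv.Perm (Fin N)) (l : ℕ) : Prop :=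
  ∀ s : Finset (Fin N), StrictMonoOn σ s → s.card ≤ l

/-- The permutation matrix of `σ`, extended by zero. -/
def permEntries {N : ℕ} (σ : Equiv.Perm (Fin N)) (i j : ℕ) : ℕ :=
  if ∃ a : Fin N, (a : ℕ) = i ∧ (σ a : ℕ) = j then 1 else 0

lemma sum_permEntries_row {N : ℕ} (σ : Equiv.Perm (Fin N)) {i : ℕ} (hi : i < N) :
    ∑ j ∈ Finset.range N, permEntries σ i j = 1 := by
  rw [Finset.sum_eq_single (σ ⟨i, hi⟩ : ℕ)]
  · exact if_pos ⟨⟨i, hi⟩, rfl, rfl⟩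
  · intro j _ hj
    refine if_neg ?_
    rintro ⟨a, rfl, rfl⟩
    exact hj rfl
  · intro h; exact absurd (Finset.mem_range.mpr (σ ⟨i, hi⟩).2) h

lemma permEntries_symm {N : ℕ} (σ : Equiv.Perm (Fin N)) (i j : ℕ) :
    permEntries σ.symm i j = permEntries σ j i := by
  unfold permEntries
  refine if_congr ⟨?_, ?_⟩ rfl rfl
  · rintro ⟨a, rfl, rfl⟩; exact ⟨σ.symm a, rfl, by simp⟩
  · rintro ⟨a, rfl, rfl⟩; exact ⟨σ a, rfl, by simp⟩

lemma sum_permEntries_col {N : ℕ} (σ : Equiv.Perm (Fin N)) {j : ℕ} (hj : j < N) :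
    ∑ i ∈ Finset.range N, permEntries σ i j = 1 := by
  simp only [← permEntries_symm σ j]
  exact sum_permEntries_row σ.symm hj

/-- Schensted's theorem, local form: the first row of the shape at `(i, j)` is the maximal length
of an increasing subsequence among the first `i` positions with values below `j`. -/
lemma growth_zero_isGreatest {N : ℕ} (σ : Equiv.Perm (Fin N)) (i j : ℕ) :
    (∀ s : Finset (Fin N), StrictMonoOn σ s → (∀ a ∈ s, (a : ℕ) < i ∧ (σ a : ℕ) < j) →
      s.card ≤ growth (permEntries σ) i j 0) ∧
    ∃ s : Finset (Fin N), StrictMonoOn σ s ∧ (∀ a ∈ s, (a : ℕ) < i ∧ (σ a : ℕ) < j) ∧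
      s.card = growth (permEntries σ) i j 0 := by
  induction i generalizing j with
  | zero =>
    refine ⟨fun s _ h => ?_, ∅, by simp [StrictMonoOn], by simp, by simp [growth_zero_left]⟩
    have : s = ∅ := Finset.eq_empty_of_forall_notMem fun a ha => by have := h a ha; omega
    simp [this]
  | succ i ih =>
    induction j with
    | zero =>
      refine ⟨fun s _ h => ?_, ∅, by simp [StrictMonoOn], by simp, by simp [growth_zero_right]⟩
      have : s = ∅ := Finset.eq_empty_of_forall_notMem fun a ha => by have := h a ha; omega
      simp [this]
    | succ j ihj =>
      have hstep : growth (permEntries σ) (i + 1) (j + 1) 0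
          = max (growth (permEntries σ) i (j + 1) 0) (growth (permEntries σ) (i + 1) j 0)
            + permEntries σ i j := by
        rw [growth_succ]; rfl
      constructor
      · intro s hs h
        by_cases hi : ∃ a ∈ s, (a : ℕ) = i
        · obtain ⟨a, has, rfl⟩ := hi
          have hlt : ∀ b ∈ s, b ≠ a → (b : ℕ) < a ∧ (σ b : ℕ) < σ a := by
            intro b hb hba
            have hb1 := (h b hb).1
            have : b < a := lt_of_le_of_ne (by rw [Fin.le_def]; omega) hba
            exact ⟨this, hs hb has this⟩
          by_cases hj : (σ a : ℕ) = j
          · -- the corner entry is used: remove it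
            have h1 := (ih j).1 (s.erase a) (hs.mono (by simp)) fun b hb => by
              obtain ⟨hb1, hb2⟩ := Finset.mem_erase.mp hb
              have := hlt b hb2 hb1
              exact ⟨this.1, hj ▸ this.2⟩
            rw [Finset.card_erase_of_mem has] at h1
            have h2 := growth_mono_right (permEntries σ) (i := a) (Nat.le_succ j) 0
            have h3 : permEntries σ a j = 1 := if_pos ⟨a, rfl, hj⟩
            rw [hstep, h3]; simp only [Nat.succ_eq_add_one] at h2; omega
          · have h1 := ihj.1 s hs fun b hb => by
              refine ⟨(h b hb).1, ?_⟩
              have ha2 := (h a has).2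
              rcases eq_or_ne b a with rfl | hba
              · omega
              · have := (hlt b hb hba).2; omega
            rw [hstep]; omega
        · have h1 := (ih (j + 1)).1 s hs fun b hb => by
            refine ⟨?_, (h b hb).2⟩
            have := (h b hb).1
            have : (b : ℕ) ≠ i := fun e => hi ⟨b, hb, e⟩
            omega
          rw [hstep]; omega
      · by_cases hx : ∃ a : Fin N, (a : ℕ) = i ∧ (σ a : ℕ) = j
        · have h3 : permEntries σ i j = 1 := if_pos hx
          obtain ⟨a, rfl, rfl⟩ := hx
          obtain ⟨s, hs, h, hc⟩ := (ih (σ a : ℕ)).2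
          have has : a ∉ s := fun ha => by have := (h a ha).1; omega
          refine ⟨insert a s, ?_, ?_, ?_⟩
          · intro x hx y hy hxy
            simp only [Finset.coe_insert, Set.mem_insert_iff, Finset.mem_coe] at hx hy
            rcases hx with rfl | hx <;> rcases hy with rfl | hy
            · exact absurd hxy (lt_irrefl _)
            · have := (h y hy).1; rw [Fin.lt_def] at hxy; omega
            · exact (h x hx).2
            · exact hs hx hy hxy
          · intro b hb
            rcases Finset.mem_insert.mp hb with rfl | hb
            · omega
            · have := h b hb; omega
          · rw [Finset.card_insert_of_notMem has, hc, hstep, h3]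
            -- both other corners carry the first row of the lower left one
            congr 1
            apply le_antisymm
            · exact le_max_of_le_left (growth_mono_right _ (Nat.le_succ _) 0)
            · refine max_le ?_ ?_
              · obtain ⟨s', hs', h', hc'⟩ := (ih (σ a + 1)).2
                rw [← hc']
                refine (ih (σ a)).1 s' hs' fun b hb => ⟨(h' b hb).1, ?_⟩
                have h1 := (h' b hb)
                have : (σ b : ℕ) ≠ σ a := fun e => by
                  have := σ.injective (Fin.ext e); rw [this] at h1; omega
                omega
              · obtain ⟨s', hs', h', hc'⟩ := ihj.2
                rw [← hc']
                refine (ih (σ a)).1 s' hs' fun b hb => ⟨?_, (h' b hb).2⟩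
                have h1 := (h' b hb)
                have : (b : ℕ) ≠ a := fun e => by
                  have := Fin.ext e; rw [this] at h1; omega
                omega
        · have h3 : permEntries σ i j = 0 := if_neg hx
          rw [hstep, h3, add_zero]
          rcases le_total (growth (permEntries σ) i (j + 1) 0)
            (growth (permEntries σ) (i + 1) j 0) with hle | hle
          · obtain ⟨s, hs, h, hc⟩ := ihj.2
            exact ⟨s, hs, fun a ha => by have := h a ha; omega, by rw [hc, max_eq_right hle]⟩
          · obtain ⟨s, hs, h, hc⟩ := (ih (j + 1)).2
            exact ⟨s, hs, fun a ha => by have := h a ha; omega, by rw [hc, max_eq_left hle]⟩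

/-- Schensted's theorem. -/
lemma lisLE_iff_growth {N : ℕ} (σ : Equiv.Perm (Fin N)) (l : ℕ) :
    LisLE σ l ↔ growth (permEntries σ) N N 0 ≤ l := by
  obtain ⟨h1, s, hs, -, hc⟩ := growth_zero_isGreatest σ N N
  refine ⟨fun h => hc ▸ h s hs, fun h t ht => (h1 t ht fun a _ => ⟨a.2, (σ a).2⟩).trans h⟩

lemma exists_of_sum_eq_one {ι : Type*} {s : Finset ι} {f : ι → ℕ} (h : ∑ k ∈ s, f k = 1) :
    ∃ r ∈ s, f r = 1 ∧ ∀ k ∈ s, k ≠ r → f k = 0 := by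
  classical
  obtain ⟨r, hr, hr0⟩ := Finset.exists_ne_zero_of_sum_ne_zero (by rw [h]; exact one_ne_zero)
  have h2 := Finset.add_sum_erase s f hr
  refine ⟨r, hr, by omega, fun k hk hkr => ?_⟩
  exact Finset.sum_eq_zero_iff.mp (by omega : ∑ k ∈ s.erase r, f k = 0) k
    (Finset.mem_erase.mpr ⟨hkr, hk⟩)

lemma exists_eq_add_single {N : ℕ} {μ lam : ℕ → ℕ} (h : Interlace μ lam)
    (hz : ∀ k, N ≤ k → lam k = 0)
    (hs : ∑ k ∈ Finset.range N, lam k = ∑ k ∈ Finset.range N, μ k + 1) :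
    ∃ r, lam = μ + Pi.single r 1 := by
  have h1 : ∑ k ∈ Finset.range N, (lam k - μ k) = 1 := by
    have : ∑ k ∈ Finset.range N, (lam k - μ k) + ∑ k ∈ Finset.range N, μ k
        = ∑ k ∈ Finset.range N, lam k := by
      rw [← Finset.sum_add_distrib]
      exact Finset.sum_congr rfl fun k _ => Nat.sub_add_cancel (h k).1
    omega
  obtain ⟨r, hr, hr1, hr2⟩ := exists_of_sum_eq_one h1
  refine ⟨r, ?_⟩
  ext k
  have hk := (h k).1
  by_cases hkr : k = r
  · subst hkr; simp only [Pi.add_apply, Pi.single_eq_same]; omega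
  · simp only [Pi.add_apply, Pi.single_apply, hkr, if_false]
    by_cases hkN : k < N
    · have := hr2 k (Finset.mem_range.mpr hkN) hkr; omega
    · have := hz k (by omega); omega

lemma sum_growth_permEntries_row {N : ℕ} (σ : Equiv.Perm (Fin N)) {i : ℕ} (hi : i ≤ N) :
    ∑ k ∈ Finset.range N, growth (permEntries σ) i N k = i := by
  rw [sum_growth _ _ _ _ hi, Finset.sum_congr rfl fun a ha =>
    sum_permEntries_row σ ((Finset.mem_range.mp ha).trans_le hi)]
  simp

lemma sum_growth_permEntries_col {N : ℕ} (σ : Equiv.Perm (Fin N)) {j : ℕ} (hj : j ≤ N) :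
    ∑ k ∈ Finset.range N, growth (permEntries σ) N j k = j := by
  rw [sum_growth _ _ _ _ le_rfl, Finset.sum_comm, Finset.sum_congr rfl fun a ha =>
    sum_permEntries_col σ ((Finset.mem_range.mp ha).trans_le hj)]
  simp

lemma permEntries_injective {N : ℕ} {σ τ : Equiv.Perm (Fin N)}
    (h : ∀ i < N, ∀ j < N, permEntries σ i j = permEntries τ i j) : σ = τ := by
  ext a
  have h1 := h a a.2 (σ a) (σ a).2
  rw [show permEntries σ a (σ a) = 1 from if_pos ⟨a, rfl, rfl⟩] at h1
  unfold permEntries at h1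
  split_ifs at h1 with h2
  obtain ⟨b, hb, hb'⟩ := h2
  rw [← hb', Fin.ext hb]

/-- A matrix of natural numbers with row and column sums `1` is a permutation matrix. -/
lemma exists_permEntries_eq {N : ℕ} {X : ℕ → ℕ → ℕ}
    (hrow : ∀ i < N, ∑ j ∈ Finset.range N, X i j = 1)
    (hcol : ∀ j < N, ∑ i ∈ Finset.range N, X i j = 1) :
    ∃ σ : Equiv.Perm (Fin N), ∀ i < N, ∀ j < N, permEntries σ i j = X i j := by
  have h1 : ∀ i : Fin N, ∃ j : Fin N, X i j = 1 ∧ ∀ k < N, k ≠ j → X i k = 0 := by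
    intro i
    obtain ⟨r, hr, h1, h2⟩ := exists_of_sum_eq_one (hrow i i.2)
    exact ⟨⟨r, Finset.mem_range.mp hr⟩, h1, fun k hk => h2 k (Finset.mem_range.mpr hk)⟩
  choose f hf1 hf0 using h1
  have hinj : Function.Injective f := by
    intro a b hab
    obtain ⟨r, hr, h1, h2⟩ := exists_of_sum_eq_one (hcol (f a) (f a).2)
    have key : ∀ c : Fin N, f c = f a → (c : ℕ) = r := by
      intro c hc
      by_contra hcr
      have := h2 c (Finset.mem_range.mpr c.2) hcr
      rw [← hc, hf1] at this
      exact one_ne_zero this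
    exact Fin.ext ((key a rfl).trans (key b hab.symm).symm)
  refine ⟨Equiv.ofBijective f (Finite.injective_iff_bijective.mp hinj), fun i hi j hj => ?_⟩
  unfold permEntries
  by_cases hj' : j = f ⟨i, hi⟩
  · rw [if_pos ⟨⟨i, hi⟩, rfl, by simp [hj']⟩, hj']
    exact (hf1 ⟨i, hi⟩).symm
  · rw [if_neg, hf0 ⟨i, hi⟩ j hj hj']
    rintro ⟨a, rfl, rfl⟩
    exact hj' rfl

/-- `σ` corresponds to the pair of lattice words `p`: the upper and the right boundary of the growth
diagram of `σ` are the chains of shapes conjugate to the contents of the suffixes of the words. -/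
def RSCorrespond {N l : ℕ} (σ : Equiv.Perm (Fin N)) (p : List (Fin l) × List (Fin l)) : Prop :=
  (∀ j ≤ N, conjShape (content (p.1.drop (N - j))) = growth (permEntries σ) N j) ∧
    ∀ i ≤ N, conjShape (content (p.2.drop (N - i))) = growth (permEntries σ) i N

/-- Pairs of lattice words of length `n` in `l` letters with the same content. -/
def latticeWordPairs (l n : ℕ) : Finset (List (Fin l) × List (Fin l)) :=
  (latticeWords l n ×ˢ latticeWords l n).filter fun p => content p.1 = content p.2

lemma exists_rsCorrespond {N l : ℕ} (σ : Equiv.Perm (Fin N)) (hσ : LisLE σ l) :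
    ∃ p ∈ latticeWordPairs l N, RSCorrespond σ p := by
  rw [lisLE_iff_growth] at hσ
  obtain ⟨u, hu, hu'⟩ := exists_latticeWord (l := l) N (fun j => growth (permEntries σ) N j)
    (growth_zero_right _ _) (fun j _ => (interlace_growth _ N j).2)
    (fun j hj => exists_eq_add_single (N := N) (interlace_growth _ N j).2
      (fun k hk => growth_eq_zero _ _ _ _ hk)
      (by rw [sum_growth_permEntries_col σ hj, sum_growth_permEntries_col σ hj.le])) hσ
  obtain ⟨v, hv, hv'⟩ := exists_latticeWord (l := l) N (fun i => growth (permEntries σ) i N)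
    (growth_zero_left _ _) (fun i _ => (interlace_growth _ i N).1)
    (fun i hi => exists_eq_add_single (N := N) (interlace_growth _ i N).1
      (fun k hk => growth_eq_zero _ _ _ _ (hi.trans_le hk))
      (by rw [sum_growth_permEntries_row σ hi, sum_growth_permEntries_row σ hi.le])) hσ
  refine ⟨(u, v), Finset.mem_filter.mpr ⟨Finset.mem_product.mpr ⟨hu, hv⟩, ?_⟩, hu', hv'⟩
  refine conjShape_injOn ((mem_latticeWords.mp hu).2 0) ((mem_latticeWords.mp hv).2 0) ?_
  have h1 := hu' N le_rfl
  have h2 := hv' N le_rfl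
  simp only [Nat.sub_self, List.drop_zero] at h1 h2
  rw [h1, h2]

lemma RSCorrespond.right_unique {N l : ℕ} {σ : Equiv.Perm (Fin N)}
    {p q : List (Fin l) × List (Fin l)} (hp : p ∈ latticeWordPairs l N)
    (hq : q ∈ latticeWordPairs l N) (h : RSCorrespond σ p) (h' : RSCorrespond σ q) : p = q := by
  simp only [latticeWordPairs, Finset.mem_filter, Finset.mem_product] at hp hq
  have key : ∀ {v w : List (Fin l)}, v ∈ latticeWords l N → w ∈ latticeWords l N →
      (∀ j ≤ N, conjShape (content (v.drop (N - j))) = conjShape (content (w.drop (N - j)))) →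
      v = w := by
    intro v w hv hw hvw
    rw [mem_latticeWords] at hv hw
    refine eq_of_content_drop_eq (hv.1.trans hw.1.symm) fun m => ?_
    rcases le_total m N with hm | hm
    · have := hvw (N - m) (by omega)
      rw [Nat.sub_sub_self hm] at this
      exact conjShape_injOn (hv.2 m) (hw.2 m) this
    · rw [List.drop_eq_nil_of_le (by omega), List.drop_eq_nil_of_le (by omega)]
  exact Prod.ext (key hp.1.1 hq.1.1 fun j hj => (h.1 j hj).trans (h'.1 j hj).symm)
    (key hp.1.2 hq.1.2 fun j hj => (h.2 j hj).trans (h'.2 j hj).symm)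

lemma RSCorrespond.left_unique {N l : ℕ} {σ τ : Equiv.Perm (Fin N)}
    {p : List (Fin l) × List (Fin l)} (h : RSCorrespond σ p) (h' : RSCorrespond τ p) : σ = τ := by
  have key := growth_eq_of_boundary_eq (fun i hi => (h.2 i hi).symm.trans (h'.2 i hi))
    (fun j hj => (h.1 j hj).symm.trans (h'.1 j hj))
  refine permEntries_injective fun i hi j hj => ?_
  rw [entry_eq_growth (permEntries σ), entry_eq_growth (permEntries τ), key _ _ hi hj,
    key _ _ hi.le hj, key _ _ hi hj.le]

lemma exists_perm_rsCorrespond {N l : ℕ} {p : List (Fin l) × List (Fin l)}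
    (hp : p ∈ latticeWordPairs l N) :
    ∃ σ : Equiv.Perm (Fin N), LisLE σ l ∧ RSCorrespond σ p := by
  obtain ⟨u, v⟩ := p
  simp only [latticeWordPairs, Finset.mem_filter, Finset.mem_product] at hp
  obtain ⟨⟨hu, hv⟩, huv⟩ := hp
  rw [mem_latticeWords] at hu hv
  set t : ℕ → ℕ → ℕ := fun j => conjShape (content (u.drop j)) with ht
  set r : ℕ → ℕ → ℕ := fun i => conjShape (content (v.drop i)) with hr
  have h0 : t 0 = r 0 := by simp [ht, hr, huv]
  have hIt : ∀ j, Interlace (t (j + 1)) (t j) := interlace_conjShape_drop u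
  have hIr : ∀ j, Interlace (r (j + 1)) (r j) := interlace_conjShape_drop v
  have htN : t N = 0 := by
    simp only [ht]; rw [List.drop_eq_nil_of_le hu.1.le, conjShape_content_nil]
  have hrN : r N = 0 := by
    simp only [hr]; rw [List.drop_eq_nil_of_le hv.1.le, conjShape_content_nil]
  have hg := growth_entriesFromCorner h0 hIt hIr N htN hrN
  set X := entriesFromCorner t r N with hX
  have hsize : ∀ (w : List (Fin l)), w.length = N → ∀ i ≤ N,
      ∑ k ∈ Finset.range N, conjShape (content (w.drop (N - i))) k = i := by
    intro w hw i hi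
    rw [sum_conjShape, sum_content, List.length_drop]
    · omega
    · intro j
      refine (List.count_le_length).trans ?_
      rw [List.length_drop]; omega
  have hsr : ∀ i ≤ N, ∑ a ∈ Finset.range i, ∑ b ∈ Finset.range N, X a b = i := by
    intro i hi
    rw [← sum_growth X N i N hi, hg i N hi le_rfl, Nat.sub_self, growthFromCorner_zero_right h0]
    exact hsize v hv.1 i hi
  have hsc : ∀ j ≤ N, ∑ b ∈ Finset.range j, ∑ a ∈ Finset.range N, X a b = j := by
    intro j hj
    rw [Finset.sum_comm, ← sum_growth X N N j le_rfl, hg N j le_rfl hj, Nat.sub_self,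
      growthFromCorner_zero_left]
    exact hsize u hu.1 j hj
  obtain ⟨σ, hσ⟩ := exists_permEntries_eq (N := N) (X := X)
    (fun i hi => by
      have h1 := hsr (i + 1) hi
      rw [Finset.sum_range_succ, hsr i hi.le] at h1; omega)
    (fun j hj => by
      have h1 := hsc (j + 1) hj
      rw [Finset.sum_range_succ, hsc j hj.le] at h1; omega)
  have hgσ : ∀ i ≤ N, ∀ j ≤ N, growth (permEntries σ) i j = growth X i j := by
    intro i hi
    induction i with
    | zero => intro j _; rw [growth_zero_left, growth_zero_left]
    | succ i ih =>
      intro j hj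
      induction j with
      | zero => rw [growth_zero_right, growth_zero_right]
      | succ j ihj =>
        rw [growth_succ, growth_succ, hσ i hi j hj, ih (by omega) j (by omega),
          ih (by omega) (j + 1) hj, ihj (by omega)]
  refine ⟨σ, ?_, fun j hj => ?_, fun i hi => ?_⟩
  · rw [lisLE_iff_growth, hgσ N le_rfl N le_rfl, hg N N le_rfl le_rfl, Nat.sub_self,
      growthFromCorner_zero_left]
    exact conjShape_zero_le _
  · rw [hgσ N le_rfl j hj, hg N j le_rfl hj, Nat.sub_self, growthFromCorner_zero_left]
  · rw [hgσ i hi N le_rfl, hg i N hi le_rfl, Nat.sub_self, growthFromCorner_zero_right h0]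

open Classical in
/-- The Robinson–Schensted correspondence: permutations of `N` letters without increasing
subsequences longer than `l` are equinumerous with pairs of standard Young tableaux of the same
shape with at most `l` rows. -/
theorem card_lisLE (l N : ℕ) :
    (Finset.univ.filter fun σ : Equiv.Perm (Fin N) => LisLE σ l).card
      = (latticeWordPairs l N).card := by
  have hex : ∀ σ ∈ Finset.univ.filter fun σ : Equiv.Perm (Fin N) => LisLE σ l,
      ∃ p ∈ latticeWordPairs l N, RSCorrespond σ p :=
    fun σ hσ => exists_rsCorrespond σ (Finset.mem_filter.mp hσ).2
  choose! F hF hF' using hex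
  refine Finset.card_bij (fun σ _ => F σ) hF (fun σ hσ τ hτ h => ?_) fun p hp => ?_
  · exact (hF' σ hσ).left_unique (h ▸ hF' τ hτ)
  · obtain ⟨σ, hσ, hσp⟩ := exists_perm_rsCorrespond hp
    have hm : σ ∈ Finset.univ.filter fun σ : Equiv.Perm (Fin N) => LisLE σ l :=
      Finset.mem_filter.mpr ⟨Finset.mem_univ σ, hσ⟩
    exact ⟨σ, hm, (hF' σ hm).right_unique (hF σ hm) hp hσp⟩

/-! ### Laurent polynomials -/

/-- Laurent polynomials in the `l` variables `z_j = exp (i θ_j)`, with real coefficients. -/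
abbrev Laurent (l : ℕ) : Type := AddMonoidAlgebra ℝ (Fin l → ℤ)

namespace Laurent

variable {l : ℕ}

/-- The Laurent monomial with exponents `κ`. -/
def mono (κ : Fin l → ℤ) : Laurent l := AddMonoidAlgebra.single κ 1

lemma mono_add (κ κ' : Fin l → ℤ) : mono (κ + κ') = mono κ * mono κ' := by
  simp [mono, AddMonoidAlgebra.single_mul_single]

lemma mono_zero : mono (0 : Fin l → ℤ) = 1 := rfl

lemma coeff_mono (κ κ' : Fin l → ℤ) : (mono κ).coeff κ' = if κ = κ' then 1 else 0 := by
  classical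
  rw [mono, AddMonoidAlgebra.coeff_single, Finsupp.single_apply]

lemma induction {p : Laurent l → Prop} (x : Laurent l) (hm : ∀ κ, p (mono κ))
    (ha : ∀ x y, p x → p y → p (x + y)) (hs : ∀ (r : ℝ) x, p x → p (r • x)) : p x :=
  AddMonoidAlgebra.induction_on x hm ha hs

/-- The linear map with prescribed values on the monomials. -/
def linearMapOf {E : Type*} [AddCommGroup E] [Module ℝ E] (f : (Fin l → ℤ) → E) :
    Laurent l →ₗ[ℝ] E :=
  (Finsupp.lsum ℝ fun κ => LinearMap.toSpanSingleton ℝ E (f κ)).comp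
    (AddMonoidAlgebra.coeffLinearEquiv (S := ℝ) ℝ).toLinearMap

lemma linearMapOf_mono {E : Type*} [AddCommGroup E] [Module ℝ E] (f : (Fin l → ℤ) → E)
    (κ : Fin l → ℤ) : linearMapOf f (mono κ) = f κ := by
  simp [linearMapOf, mono]

/-- The constant term of a Laurent polynomial. -/
def constTerm : Laurent l →ₗ[ℝ] ℝ := linearMapOf fun κ => if κ = 0 then 1 else 0

lemma constTerm_mono (κ : Fin l → ℤ) : constTerm (mono κ) = if κ = 0 then 1 else 0 :=
  linearMapOf_mono _ _

/-- The automorphism that inverts the variables; on the torus it is complex conjugation. -/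
def inv : Laurent l →ₐ[ℝ] Laurent l :=
  AddMonoidAlgebra.mapDomainAlgHom ℝ ℝ (-AddMonoidHom.id (Fin l → ℤ))

lemma inv_mono (κ : Fin l → ℤ) : inv (mono κ) = mono (-κ) := by
  simp [inv, mono, AddMonoidAlgebra.mapDomain_single]

lemma inv_inv (x : Laurent l) : inv (inv x) = x := by
  induction x using induction with
  | hm κ => simp [inv_mono]
  | ha x y hx hy => simp [hx, hy]
  | hs r x hx => simp [hx]

lemma constTerm_inv (x : Laurent l) : constTerm (inv x) = constTerm x := by
  induction x using induction with
  | hm κ => simp [inv_mono, constTerm_mono]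
  | ha x y hx hy => simp [hx, hy]
  | hs r x hx => simp [hx]

lemma constTerm_inv_mul_mono (x : Laurent l) (κ : Fin l → ℤ) :
    constTerm (inv x * mono κ) = x.coeff κ := by
  induction x using induction with
  | hm κ' =>
    rw [inv_mono, ← mono_add, constTerm_mono, coeff_mono]
    refine if_congr ?_ rfl rfl
    rw [neg_add_eq_zero]
  | ha x y hx hy => simp [hx, hy, add_mul]
  | hs r x hx => simp [hx]

/-- The power sum `∑ j, z_j ^ k`. -/
def psum (k : ℤ) : Laurent l := ∑ j, mono (Pi.single j k)

lemma inv_psum (k : ℤ) : inv (psum k : Laurent l) = psum (-k) := by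
  simp [psum, inv_mono, Pi.single_neg]

/-- The alternant: the antisymmetrization of a monomial. -/
def alt (κ : Fin l → ℤ) : Laurent l :=
  ∑ w : Equiv.Perm (Fin l), ((Equiv.Perm.sign w : ℤ) : ℝ) • mono (κ ∘ w)

lemma psum_one_mul_alt (κ : Fin l → ℤ) :
    psum 1 * alt κ = ∑ i, alt (κ + Pi.single i 1) := by
  simp only [psum, alt, Finset.sum_mul_sum, mul_smul_comm, ← mono_add]
  rw [Finset.sum_comm, Finset.sum_comm (s := (Finset.univ : Finset (Fin l)))]
  refine Finset.sum_congr rfl fun w _ => ?_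
  refine Fintype.sum_equiv w _ _ fun i => ?_
  congr 2
  ext j
  simp only [Pi.add_apply, Function.comp_apply, Pi.single_apply, w.injective.eq_iff]
  ring

lemma alt_comp_perm (κ : Fin l → ℤ) (τ : Equiv.Perm (Fin l)) :
    alt (κ ∘ τ) = ((Equiv.Perm.sign τ : ℤ) : ℝ) • alt κ := by
  simp only [alt, Finset.smul_sum, smul_smul]
  rw [← Equiv.sum_comp (Equiv.mulLeft τ⁻¹)]
  refine Finset.sum_congr rfl fun w _ => ?_
  have : (κ ∘ τ) ∘ (τ⁻¹ * w : Equiv.Perm (Fin l)) = κ ∘ w := by ext j; simp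
  simp only [Equiv.coe_mulLeft, this, Equiv.Perm.sign_mul, Equiv.Perm.sign_inv]
  push_cast
  rfl

lemma alt_eq_zero {κ : Fin l → ℤ} {i j : Fin l} (hij : i ≠ j) (h : κ i = κ j) : alt κ = 0 := by
  have h1 : κ ∘ Equiv.swap i j = κ := by
    ext a
    simp only [Function.comp_apply, Equiv.swap_apply_def]
    split_ifs with h1 h2
    · rw [h1, h]
    · rw [h2, h]
    · rfl
  have h2 := alt_comp_perm κ (Equiv.swap i j)
  rw [h1, Equiv.Perm.sign_swap hij] at h2
  have h3 : (2 : ℝ) • alt κ = 0 := by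
    rw [two_smul]; nth_rewrite 1 [h2]; simp
  exact (smul_eq_zero.mp h3).resolve_left two_ne_zero

lemma eq_of_comp_perm_eq {κ κ' : Fin l → ℤ} (h : StrictAnti κ) (h' : StrictAnti κ')
    {w w' : Equiv.Perm (Fin l)} (he : κ ∘ w = κ' ∘ w') : κ = κ' ∧ w = w' := by
  have h1 : κ ∘ (w * w'⁻¹ : Equiv.Perm (Fin l)) = κ' := by
    ext j
    have := congrFun he (w'⁻¹ j)
    simpa using this
  have h2 : StrictMono (w * w'⁻¹ : Equiv.Perm (Fin l)) := by
    intro a b hab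
    have : κ' b < κ' a := h' hab
    rw [← h1] at this
    exact h.lt_iff_gt.mp this
  have h3 : (w * w'⁻¹ : Equiv.Perm (Fin l)) = 1 := by
    ext1 j
    exact congrFun ((h2.range_inj strictMono_id).mp (by simp [Set.range_id])) j
  refine ⟨?_, mul_inv_eq_one.mp h3⟩
  rw [← h1, h3]; rfl

/-- Orthogonality of the alternants. -/
lemma constTerm_alt_mul_inv_alt {κ κ' : Fin l → ℤ} (h : StrictAnti κ) (h' : StrictAnti κ') :
    constTerm (alt κ * inv (alt κ')) = if κ = κ' then (l ! : ℝ) else 0 := by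
  have e : alt κ * inv (alt κ') = ∑ w : Equiv.Perm (Fin l), ∑ w' : Equiv.Perm (Fin l),
      (((Equiv.Perm.sign w : ℤ) : ℝ) * ((Equiv.Perm.sign w' : ℤ) : ℝ)) •
        mono (κ ∘ w - κ' ∘ w') := by
    simp only [alt, map_sum, map_smul, inv_mono, Finset.sum_mul_sum, smul_mul_smul_comm,
      ← mono_add, sub_eq_add_neg]
  rw [e]
  simp only [map_sum, map_smul, constTerm_mono, sub_eq_zero, smul_eq_mul]
  by_cases hκ : κ = κ'
  · subst hκ
    rw [if_pos rfl]
    have : ∀ w : Equiv.Perm (Fin l), ∑ w' : Equiv.Perm (Fin l),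
        ((Equiv.Perm.sign w : ℤ) : ℝ) * ((Equiv.Perm.sign w' : ℤ) : ℝ) *
          (if κ ∘ w = κ ∘ w' then (1 : ℝ) else 0) = 1 := by
      intro w
      rw [Finset.sum_eq_single w]
      · rw [if_pos rfl, mul_one, ← Int.cast_mul, ← Units.val_mul, Int.units_mul_self]; simp
      · intro w' _ hw
        rw [if_neg fun he => hw (eq_of_comp_perm_eq h h' he).2.symm, mul_zero]
      · intro hw; exact absurd (Finset.mem_univ w) hw
    rw [Finset.sum_congr rfl fun w _ => this w]
    simp [Fintype.card_perm]
  · rw [if_neg hκ]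
    refine Finset.sum_eq_zero fun w _ => Finset.sum_eq_zero fun w' _ => ?_
    rw [if_neg fun he => hκ (eq_of_comp_perm_eq h h' he).1, mul_zero]

/-- The Vandermonde product `∏_{i < j} (z_j - z_i)`. -/
def vand : Laurent l :=
  ∏ i : Fin l, ∏ j ∈ Finset.Ioi i, (mono (Pi.single j 1) - mono (Pi.single i 1))

lemma mono_single_pow (i : Fin l) (n : ℕ) :
    mono (Pi.single i 1) ^ n = mono (Pi.single i (n : ℤ)) := by
  induction n with
  | zero => simp [mono_zero]
  | succ n ih => rw [pow_succ, ih, ← mono_add, ← Pi.single_add]; simp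

lemma prod_mono {ι : Type*} (s : Finset ι) (f : ι → Fin l → ℤ) :
    ∏ i ∈ s, mono (f i) = mono (∑ i ∈ s, f i) := by
  classical
  induction s using Finset.induction_on with
  | empty => simp [mono_zero]
  | insert a s ha ih => rw [Finset.prod_insert ha, Finset.sum_insert ha, mono_add, ih]

lemma vand_eq_alt : (vand : Laurent l) = alt fun j => (j : ℤ) := by
  rw [vand, ← Matrix.det_vandermonde fun i : Fin l => mono (Pi.single i 1), ← Matrix.det_transpose,
    Matrix.det_apply']
  refine Finset.sum_congr rfl fun w _ => ?_
  have : ∏ i, (Matrix.vandermonde fun i : Fin l => mono (Pi.single i 1)).transpose (w i) i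
      = mono ((fun j : Fin l => (j : ℤ)) ∘ w) := by
    simp only [Matrix.transpose_apply, Matrix.vandermonde_apply, mono_single_pow, prod_mono]
    congr 1
    ext j
    simp [Finset.sum_apply, Pi.single_apply]
  rw [this, Algebra.smul_def]
  simp

lemma inv_alt (κ : Fin l → ℤ) : inv (alt κ) = alt (-κ) := by
  simp only [alt, map_sum, map_smul, inv_mono]
  rfl

/-- The strictly decreasing exponents `μ_j - j` attached to a shape with rows `μ_j`. -/
def shift (μ : Fin l → ℕ) (j : Fin l) : ℤ := (μ j : ℤ) - j

lemma shift_strictAnti {μ : Fin l → ℕ} (h : Antitone μ) : StrictAnti (shift μ) := by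
  intro a b hab
  have h1 := h hab.le
  have h2 : (a : ℕ) < b := hab
  simp only [shift]; omega

lemma shift_injective : Function.Injective (shift : (Fin l → ℕ) → Fin l → ℤ) := by
  intro μ ν h
  ext j
  have := congrFun h j
  simp only [shift] at this; omega

/-- Adding a box that does not yield a shape kills the alternant. -/
lemma alt_shift_cons {w : List (Fin l)} {i : Fin l} (hw : Antitone (content w))
    (hiw : ¬ Antitone (content (i :: w))) : alt (shift (content (i :: w))) = 0 := by
  simp only [Antitone, not_forall] at hiw
  obtain ⟨a, b, hab, h⟩ := hiw
  rw [content_cons] at h ⊢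
  simp only [Pi.add_apply, Pi.single_apply] at h
  have h0 := hw hab
  have hbi : b = i := by
    by_contra hb
    rw [if_neg hb] at h; omega
  subst hbi
  have hab' : a ≠ b := by rintro rfl; exact h le_rfl
  have hlt : (a : ℕ) < b := lt_of_le_of_ne hab fun e => hab' (Fin.ext e)
  rw [if_pos rfl, if_neg hab'] at h
  -- the rows `b - 1` and `b` have the same length, so the exponents collide
  let c : Fin l := ⟨b - 1, by omega⟩
  have h1 : content w c ≤ content w a := hw (by rw [Fin.le_def]; simp only [c]; omega)
  have h2 : content w b ≤ content w c := hw (by rw [Fin.le_def]; simp only [c]; omega)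
  have hcb : c ≠ b := fun e => by have := congrArg Fin.val e; simp only [c] at this; omega
  refine alt_eq_zero hcb ?_
  simp only [shift, Pi.add_apply, Pi.single_apply, if_neg hcb, if_true]
  have : ((c : ℕ) : ℤ) = (b : ℤ) - 1 := by simp only [c]; omega
  rw [this]; push_cast; omega

/-- Multiplying the alternant of the empty shape by `p₁ ^ n` yields the alternants of the contents
of the lattice words of length `n`. -/
lemma psum_one_pow_mul_alt (n : ℕ) :
    psum 1 ^ n * alt (shift (0 : Fin l → ℕ))
      = ∑ w ∈ latticeWords l n, alt (shift (content w)) := by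
  induction n with
  | zero =>
    simp only [pow_zero, one_mul, latticeWords, Finset.sum_singleton]
    congr 2
  | succ n ih =>
    rw [pow_succ', mul_assoc, ih, Finset.mul_sum, latticeWords, Finset.sum_filter,
      Finset.sum_image, Finset.sum_product, Finset.sum_comm]
    · refine Finset.sum_congr rfl fun w hw => ?_
      rw [psum_one_mul_alt]
      refine Finset.sum_congr rfl fun i _ => ?_
      have e : shift (content w) + Pi.single i 1 = shift (content (i :: w)) := by
        ext j
        simp only [shift, content_cons, Pi.add_apply, Pi.single_apply]
        split_ifs <;> push_cast <;> ring
      rw [e]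
      split_ifs with h
      · rfl
      · exact alt_shift_cons ((mem_latticeWords.mp hw).2 0) h
    · intro p _ q _ h
      simp only [List.cons.injEq] at h
      exact Prod.ext h.1 h.2

/-- The functional of the (unnormalized) eigenvalue density, `x ↦ constTerm (x |Δ|²)`. -/
def weightedTerm : Laurent l →ₗ[ℝ] ℝ :=
  constTerm.comp (LinearMap.mulRight ℝ (vand * inv vand))

lemma weightedTerm_apply (x : Laurent l) :
    weightedTerm x = constTerm (x * (vand * inv vand)) := rfl

/-- The mixed moments of the first power sum: expand `p₁ ^ a Δ` and `p₁ ^ b Δ` into alternants,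
which are orthogonal. -/
lemma weightedTerm_psum_pow (a b : ℕ) :
    weightedTerm (psum 1 ^ a * psum (-1) ^ b : Laurent l)
      = (l ! : ℝ) * ((latticeWords l a ×ˢ latticeWords l b).filter
          fun p => content p.1 = content p.2).card := by
  have h0 : inv (vand : Laurent l) = alt (shift (0 : Fin l → ℕ)) := by
    rw [vand_eq_alt, inv_alt]; congr 1; ext j; simp [shift]
  have e : psum 1 ^ a * psum (-1) ^ b * (vand * inv vand)
      = (psum 1 ^ a * alt (shift (0 : Fin l → ℕ)))
        * inv (psum 1 ^ b * alt (shift (0 : Fin l → ℕ)) : Laurent l) := by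
    rw [map_mul, map_pow, inv_psum, ← h0, inv_inv]; ring
  rw [weightedTerm_apply, e, psum_one_pow_mul_alt, psum_one_pow_mul_alt, map_sum,
    Finset.sum_mul_sum, map_sum, Finset.card_filter, Finset.sum_product]
  push_cast
  rw [Finset.mul_sum]
  refine Finset.sum_congr rfl fun u hu => ?_
  rw [map_sum, Finset.mul_sum]
  refine Finset.sum_congr rfl fun v hv => ?_
  have hu' : Antitone (content u) := (mem_latticeWords.mp hu).2 0
  have hv' : Antitone (content v) := (mem_latticeWords.mp hv).2 0
  rw [constTerm_alt_mul_inv_alt (shift_strictAnti hu') (shift_strictAnti hv')]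
  simp only [shift_injective.eq_iff]
  split_ifs <;> simp

end Laurent

namespace Laurent

variable {l : ℕ}

/-! ### Vector fields on the torus -/

/-- The derivation `z_j ∂/∂z_j`. -/
def pd (j : Fin l) : Derivation ℝ (Laurent l) (Laurent l) :=
  Derivation.mk' (linearMapOf fun κ => (κ j : ℝ) • mono κ) fun x y => by
    induction x using induction with
    | hm κ =>
      induction y using induction with
      | hm κ' =>
        rw [← mono_add]
        simp only [linearMapOf_mono, Pi.add_apply, smul_eq_mul, mul_smul_comm, ← mono_add,
          add_comm κ' κ, ← add_smul]
        push_cast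
        rw [add_comm]
      | ha x y hx hy => rw [mul_add, map_add, map_add, hx, hy]; simp only [smul_eq_mul]; ring
      | hs r x hx =>
        rw [mul_smul_comm, map_smul, map_smul, hx]
        simp only [smul_eq_mul, mul_smul_comm, smul_mul_assoc, smul_add]
    | ha x x' hx hx' => rw [add_mul, map_add, map_add, hx, hx']; simp only [smul_eq_mul]; ring
    | hs r x hx =>
      rw [smul_mul_assoc, map_smul, map_smul, hx]
      simp only [smul_eq_mul, mul_smul_comm, smul_mul_assoc, smul_add]

lemma pd_mono (j : Fin l) (κ : Fin l → ℤ) : pd j (mono κ) = (κ j : ℝ) • mono κ :=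
  linearMapOf_mono _ _

lemma coeff_pd (j : Fin l) (x : Laurent l) (κ : Fin l → ℤ) :
    (pd j x).coeff κ = κ j * x.coeff κ := by
  induction x using induction with
  | hm κ' =>
    rw [pd_mono, AddMonoidAlgebra.coeff_smul_apply, coeff_mono]
    split_ifs with h
    · simp [h]
    · simp
  | ha x y hx hy => simp [hx, hy, mul_add]
  | hs r x hx => simp [hx]; ring

lemma pd_inv (j : Fin l) (x : Laurent l) : pd j (inv x) = -inv (pd j x) := by
  induction x using induction with
  | hm κ => simp [inv_mono, pd_mono]
  | ha x y hx hy => simp only [map_add, hx, hy]; ring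
  | hs r x hx => rw [map_smul, Derivation.map_smul, Derivation.map_smul, hx, map_smul, smul_neg]

/-- The vector field `∑ j, z_j ^ k (z_j ∂/∂z_j)`. -/
def field (k : ℤ) : Derivation ℝ (Laurent l) (Laurent l) :=
  ∑ j, mono (Pi.single j k) • pd j

lemma field_apply (k : ℤ) (x : Laurent l) :
    field k x = ∑ j, mono (Pi.single j k) * pd j x := by
  have h := congrFun (map_sum (Derivation.coeFnAddMonoidHom (R := ℝ) (A := Laurent l)
    (M := Laurent l)) (fun j => mono (Pi.single j k) • pd j) Finset.univ) x
  rw [Finset.sum_apply] at h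
  exact h

lemma field_mono_single (k m : ℤ) (i : Fin l) :
    field k (mono (Pi.single i m)) = (m : ℝ) • mono (Pi.single i (m + k)) := by
  rw [field_apply, Finset.sum_eq_single i]
  · rw [pd_mono, Pi.single_eq_same, mul_smul_comm, ← mono_add, ← Pi.single_add, add_comm]
  · intro j _ hj
    rw [pd_mono, Pi.single_eq_of_ne hj]; simp
  · intro h; exact absurd (Finset.mem_univ i) h

/-- Integration by parts on the torus. -/
lemma constTerm_field (k : ℤ) (x : Laurent l) :
    constTerm (field k x + (k : ℝ) • (psum k * x)) = 0 := by
  induction x using induction with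
  | hm κ =>
    simp only [field_apply, pd_mono, psum, Finset.sum_mul, Finset.smul_sum, mul_smul_comm,
      ← mono_add, ← Finset.sum_add_distrib, ← add_smul, map_sum, map_smul, constTerm_mono]
    refine Finset.sum_eq_zero fun j _ => ?_
    split_ifs with h
    · have := congrFun h j
      simp only [Pi.add_apply, Pi.single_eq_same, Pi.zero_apply] at this
      have h2 : (κ j : ℝ) + k = 0 := by exact_mod_cast (by omega : κ j + k = 0)
      simp [h2]
    · simp
  | ha x y hx hy =>
    have e : field k (x + y) + (k : ℝ) • (psum k * (x + y))
        = (field k x + (k : ℝ) • (psum k * x)) + (field k y + (k : ℝ) • (psum k * y)) := by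
      rw [map_add, mul_add, smul_add]; abel
    rw [e, map_add, hx, hy, add_zero]
  | hs r x hx =>
    rw [Derivation.map_smul, mul_smul_comm, smul_comm (k : ℝ) r, ← smul_add, map_smul, hx,
      smul_zero]

/-- A product rule in terms of logarithmic derivatives. -/
lemma derivation_prod_of_log {A ι : Type*} [CommRing A] [Algebra ℝ A] (D : Derivation ℝ A A)
    (s : Finset ι) (q h : ι → A) (hq : ∀ i ∈ s, D (q i) = q i * h i) :
    D (∏ i ∈ s, q i) = (∏ i ∈ s, q i) * ∑ i ∈ s, h i := by
  classical
  induction s using Finset.induction_on with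
  | empty => simp
  | insert a s ha ih =>
    rw [Finset.prod_insert ha, Finset.sum_insert ha, Derivation.leibniz,
      ih fun i hi => hq i (Finset.mem_insert_of_mem hi), hq a (Finset.mem_insert_self a s)]
    simp only [smul_eq_mul]; ring

/-- The polynomial `(x ^ n - y ^ n) / (x - y)`. -/
def geom (x y : Laurent l) (n : ℕ) : Laurent l :=
  ∑ a ∈ Finset.range n, x ^ a * y ^ (n - 1 - a)

lemma geom_rec (x y : Laurent l) (n : ℕ) :
    geom x y (n + 2) + x * y * geom x y n = (x + y) * geom x y (n + 1) := by
  have h : ∀ m, geom x y (m + 1) = x ^ m + y * geom x y m := fun m => by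
    simpa [geom] using geom_sum₂_succ_eq x y (n := m)
  rw [h (n + 1), h n]; ring

lemma geom_mul (x y : Laurent l) (n : ℕ) : geom x y n * (x - y) = x ^ n - y ^ n :=
  geom_sum₂_mul x y n

lemma geom_comm (x y : Laurent l) (n : ℕ) : geom x y n = geom y x n :=
  geom_sum₂_comm x y n

lemma field_vand (n : ℕ) : field (n : ℤ) (vand : Laurent l) = vand *
    ∑ i : Fin l, ∑ j ∈ Finset.Ioi i,
      geom (mono (Pi.single j 1)) (mono (Pi.single i 1)) (n + 1) := by
  refine derivation_prod_of_log _ _ _ _ fun i _ => derivation_prod_of_log _ _ _ _ fun j _ => ?_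
  rw [mul_comm, geom_mul, map_sub, field_mono_single, field_mono_single, mono_single_pow,
    mono_single_pow]
  simp [add_comm]

lemma field_inv_vand (n : ℕ) : field ((n + 1 : ℕ) : ℤ) (inv vand : Laurent l) = inv vand *
    ∑ i : Fin l, ∑ j ∈ Finset.Ioi i, mono (Pi.single j 1) * mono (Pi.single i 1) *
      geom (mono (Pi.single j 1)) (mono (Pi.single i 1)) n := by
  simp only [vand, map_prod]
  refine derivation_prod_of_log _ _ _ _ fun i _ => derivation_prod_of_log _ _ _ _ fun j _ => ?_
  have hz : ∀ i : Fin l, mono (Pi.single i (-1)) * mono (Pi.single i 1) = 1 := fun i => by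
    rw [← mono_add, ← Pi.single_add]; simp [mono_zero]
  have e : (mono (Pi.single j (-1)) - mono (Pi.single i (-1)))
      * (mono (Pi.single j 1) * mono (Pi.single i 1))
      = -(mono (Pi.single j 1) - mono (Pi.single i 1)) := by
    have hi := hz i; have hj := hz j
    linear_combination mono (Pi.single i 1) * hj - mono (Pi.single j 1) * hi
  simp only [map_sub, inv_mono, ← Pi.single_neg]
  rw [← mul_assoc, e, neg_mul, mul_comm, geom_mul, field_mono_single, field_mono_single,
    mono_single_pow, mono_single_pow]
  simp only [Nat.cast_add, Nat.cast_one, neg_add_cancel_comm_assoc, Int.cast_neg, Int.cast_one,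
    neg_smul, one_smul]
  ring

lemma sum_psum_mul_psum (n : ℕ) :
    (∑ a ∈ Finset.range n, psum (a + 1) * psum ((n : ℤ) - (a + 1)) : Laurent l)
      = (n : ℝ) • psum n + ∑ i : Fin l, ∑ j ∈ Finset.Ioi i,
          (mono (Pi.single j 1) + mono (Pi.single i 1)) *
            geom (mono (Pi.single j 1)) (mono (Pi.single i 1)) n := by
  have e : (∑ a ∈ Finset.range n, psum (a + 1) * psum ((n : ℤ) - (a + 1)) : Laurent l)
      = ∑ i : Fin l, ∑ j : Fin l, mono (Pi.single j 1) *
          geom (mono (Pi.single j 1)) (mono (Pi.single i 1)) n := by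
    simp only [geom, Finset.mul_sum]
    rw [Finset.sum_congr rfl fun i _ => Finset.sum_comm, Finset.sum_comm]
    refine Finset.sum_congr rfl fun a ha => ?_
    rw [psum, psum, mul_comm, Finset.sum_mul_sum]
    refine Finset.sum_congr rfl fun i _ => Finset.sum_congr rfl fun j _ => ?_
    rw [mul_comm (mono (Pi.single i _))]
    have ha := Finset.mem_range.mp ha
    have hna : ((n - 1 - a : ℕ) : ℤ) = n - (a + 1) := by omega
    rw [mono_single_pow, mono_single_pow, hna, ← mul_assoc, ← mono_add (Pi.single j 1),
      ← Pi.single_add, add_comm (1 : ℤ)]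
  have d : ∀ i : Fin l, mono (Pi.single i 1) *
      geom (mono (Pi.single i 1)) (mono (Pi.single i 1)) n
        = (n : ℝ) • mono (Pi.single i (n : ℤ)) := by
    intro i
    rw [geom, Finset.mul_sum, Finset.sum_congr rfl (g := fun _ => mono (Pi.single i (n : ℤ)))]
    · simp [← Nat.cast_smul_eq_nsmul ℝ]
    · intro a ha
      have ha := Finset.mem_range.mp ha
      rw [← pow_add, ← pow_succ', mono_single_pow]
      congr 2; omega
  rw [e, psum, Finset.smul_sum]
  have h := Finset.sum_sum_Ioi_add_eq_sum_sum_off_diag fun j i : Fin l => mono (Pi.single j 1) *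
          geom (mono (Pi.single j 1)) (mono (Pi.single i 1)) n
  have h2 : ∀ i : Fin l, ∑ j : Fin l, mono (Pi.single j 1) *
          geom (mono (Pi.single j 1)) (mono (Pi.single i 1)) n
      = (n : ℝ) • mono (Pi.single i (n : ℤ)) + ∑ j ∈ {i}ᶜ, mono (Pi.single j 1) *
          geom (mono (Pi.single j 1)) (mono (Pi.single i 1)) n := by
    intro i
    rw [← d i, Fintype.sum_eq_add_sum_compl i]
  rw [Finset.sum_congr rfl fun i _ => h2 i, Finset.sum_add_distrib, ← h]
  congr 1
  refine Finset.sum_congr rfl fun i _ => Finset.sum_congr rfl fun j _ => ?_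
  rw [geom_comm (mono (Pi.single i 1)), add_mul]

/-- The loop equation on the torus: the divergence of the field `∑ j, z_j ^ n (z_j ∂/∂z_j)` with
respect to the eigenvalue density is `∑_{a=1}^{n} p_a p_{n-a}`. -/
lemma weightedTerm_field (n : ℕ) (x : Laurent l) :
    weightedTerm
      ((∑ a ∈ Finset.range (n + 1), psum (a + 1) * psum (((n + 1 : ℕ) : ℤ) - (a + 1))) * x
        + field ((n + 1 : ℕ) : ℤ) x) = 0 := by
  have h := constTerm_field ((n + 1 : ℕ) : ℤ) (x * (vand * inv vand))
  rw [Derivation.leibniz, Derivation.leibniz, field_vand, field_inv_vand] at h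
  rw [weightedTerm_apply, sum_psum_mul_psum, ← h]
  congr 1
  have hsum : (∑ i : Fin l, ∑ j ∈ Finset.Ioi i,
      (mono (Pi.single j 1) + mono (Pi.single i 1)) *
        geom (mono (Pi.single j 1)) (mono (Pi.single i 1)) (n + 1))
      = (∑ i : Fin l, ∑ j ∈ Finset.Ioi i,
        geom (mono (Pi.single j 1)) (mono (Pi.single i 1)) (n + 1 + 1))
      + ∑ i : Fin l, ∑ j ∈ Finset.Ioi i, mono (Pi.single j 1) * mono (Pi.single i 1) *
          geom (mono (Pi.single j 1)) (mono (Pi.single i 1)) n := by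
    simp only [← Finset.sum_add_distrib]
    refine Finset.sum_congr rfl fun i _ => Finset.sum_congr rfl fun j _ => ?_
    rw [← geom_rec]
  rw [hsum]
  simp only [smul_eq_mul, Int.cast_natCast, Algebra.smul_def]
  ring

lemma weightedTerm_inv (x : Laurent l) : weightedTerm (inv x) = weightedTerm x := by
  rw [weightedTerm_apply, weightedTerm_apply, ← constTerm_inv (x * _), map_mul inv, map_mul inv,
    inv_inv, mul_comm vand]

/-! ### Positivity -/

lemma eq_sum_coeff (x : Laurent l) : x = ∑ κ ∈ x.coeff.support, x.coeff κ • mono κ := by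
  conv_lhs => rw [← AddMonoidAlgebra.sum_coeff_single x]
  refine Finset.sum_congr rfl fun κ _ => ?_
  simp [mono]

lemma constTerm_inv_mul_self (x : Laurent l) :
    constTerm (inv x * x) = ∑ κ ∈ x.coeff.support, x.coeff κ ^ 2 := by
  nth_rewrite 2 [eq_sum_coeff x]
  rw [Finset.mul_sum, map_sum]
  refine Finset.sum_congr rfl fun κ _ => ?_
  rw [mul_smul_comm, map_smul, constTerm_inv_mul_mono, smul_eq_mul, sq]

lemma vand_ne_zero : (vand : Laurent l) ≠ 0 := by
  refine Finset.prod_ne_zero_iff.mpr fun i _ => Finset.prod_ne_zero_iff.mpr fun j hj => ?_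
  intro h
  have hij : i < j := Finset.mem_Ioi.mp hj
  have h2 := congrArg (fun x : Laurent l => x.coeff (Pi.single j 1)) h
  simp only [AddMonoidAlgebra.coeff_sub, AddMonoidAlgebra.coeff_zero, Finsupp.coe_sub,
    Pi.sub_apply, coeff_mono, Finsupp.coe_zero, Pi.zero_apply, if_true] at h2
  rw [if_neg] at h2
  · norm_num at h2
  · intro e
    have := congrFun e j
    rw [Pi.single_eq_same, Pi.single_eq_of_ne hij.ne'] at this
    exact one_ne_zero this.symm

/-- The eigenvalue density defines a sum of squares, so its inner product is definite. -/
lemma weightedTerm_inv_mul_self (x : Laurent l) :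
    weightedTerm (inv x * x) = ∑ κ ∈ (x * vand).coeff.support, (x * vand).coeff κ ^ 2 := by
  rw [weightedTerm_apply, ← constTerm_inv_mul_self, map_mul inv]
  congr 1; ring

lemma weightedTerm_inv_mul_self_nonneg (x : Laurent l) : 0 ≤ weightedTerm (inv x * x) := by
  rw [weightedTerm_inv_mul_self]
  exact Finset.sum_nonneg fun κ _ => sq_nonneg _

lemma eq_zero_of_weightedTerm_inv_mul_self {x : Laurent l}
    (h : weightedTerm (inv x * x) = 0) : x = 0 := by
  rw [weightedTerm_inv_mul_self, Finset.sum_eq_zero_iff_of_nonneg fun κ _ => sq_nonneg _] at h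
  have h2 : x * vand = 0 := by
    ext κ
    by_cases hκ : κ ∈ (x * vand).coeff.support
    · simpa using h κ hκ
    · simpa using hκ
  exact (mul_eq_zero.mp h2).resolve_right vand_ne_zero

lemma eq_smul_one_of_pd_eq_zero {x : Laurent l} (h : ∀ j, pd j x = 0) :
    x = x.coeff 0 • (1 : Laurent l) := by
  ext κ
  rw [← mono_zero, AddMonoidAlgebra.coeff_smul_apply, coeff_mono]
  by_cases hκ : κ = 0
  · simp [hκ]
  · rw [if_neg (Ne.symm hκ), smul_zero]
    obtain ⟨j, hj⟩ := Function.ne_iff.mp hκ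
    have := coeff_pd j x κ
    rw [h j] at this
    simp only [AddMonoidAlgebra.coeff_zero, Finsupp.coe_zero, Pi.zero_apply] at this
    refine (mul_eq_zero.mp this.symm).resolve_left ?_
    exact_mod_cast hj

end Laurent

/-! ### Loop equations for power sums -/

/-- Formal polynomials in the power sums `p_k`, `k : ℤ`. -/
abbrev PowerSums : Type := MvPolynomial ℤ ℝ

namespace PowerSums

open MvPolynomial

/-- The automorphism `p_k ↦ p_{-k}`. -/
def flip : PowerSums →ₐ[ℝ] PowerSums := aeval fun k => X (-k)

/-- The evaluation of a polynomial in the power sums as a Laurent polynomial in `l` variables. -/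
def toLaurent (l : ℕ) : PowerSums →ₐ[ℝ] Laurent l := aeval Laurent.psum

/-- The derivation `p_m ↦ m p_{m+k}`, the action of the vector field `∑ j, z_j ^ k (z_j ∂/∂z_j)` on
power sums. -/
def shiftD (k : ℤ) : Derivation ℝ PowerSums PowerSums :=
  mkDerivation ℝ fun m => (m : ℝ) • X (m + k)

/-- The divergence of the vector field `∑ j, z_j ^ k (z_j ∂/∂z_j)` with respect to the eigenvalue
density: `∑_{a=1}^{k} p_a p_{k-a}` for `k ≥ 0`, and minus the same sum in the inverse variables for
negative `k`. -/
def divg (k : ℤ) : PowerSums :=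
  (k.sign : ℝ) • ∑ a ∈ Finset.range k.natAbs,
    X (k.sign * ((a : ℤ) + 1)) * X (k - k.sign * ((a : ℤ) + 1))

/-- The functional `Φ` on polynomials in the power sums satisfies the loop equations. -/
def IsLoop {E : Type*} [AddCommGroup E] [Module ℝ E] (Φ : PowerSums →ₗ[ℝ] E) : Prop :=
  ∀ (k : ℤ) (f : PowerSums), k ≠ 0 → Φ (divg k * f + shiftD k f) = 0

lemma shiftD_X (k m : ℤ) : shiftD k (X m) = (m : ℝ) • X (m + k) := mkDerivation_X _ _ _

lemma flip_X (m : ℤ) : flip (X m) = X (-m) := aeval_X _ _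

lemma toLaurent_X (l : ℕ) (m : ℤ) : toLaurent l (X m) = Laurent.psum m := aeval_X _ _

lemma induction_X {p : PowerSums → Prop} (f : PowerSums) (one : p 1)
    (add : ∀ f g, p f → p g → p (f + g)) (smul : ∀ (r : ℝ) f, p f → p (r • f))
    (mul : ∀ m f, p f → p (X m * f)) : p f := by
  induction f using MvPolynomial.induction_on with
  | C r => rw [C_eq_smul_one]; exact smul r _ one
  | add f g hf hg => exact add f g hf hg
  | mul_X f m hf => rw [mul_comm]; exact mul m f hf

lemma flip_flip (f : PowerSums) : flip (flip f) = f := by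
  induction f using induction_X with
  | one => simp
  | add f g hf hg => simp [hf, hg]
  | smul r f hf => simp [hf]
  | mul m f hf => simp [hf, flip_X]

lemma shiftD_flip (k : ℤ) (f : PowerSums) : shiftD (-k) (flip f) = -flip (shiftD k f) := by
  induction f using induction_X with
  | one => simp
  | add f g hf hg => simp only [map_add, hf, hg]; ring
  | smul r f hf => rw [map_smul, Derivation.map_smul, Derivation.map_smul, hf, map_smul, smul_neg]
  | mul m f hf =>
    rw [map_mul, Derivation.leibniz, Derivation.leibniz, hf, flip_X, shiftD_X, shiftD_X]
    simp only [smul_eq_mul, map_add, map_mul, map_smul, flip_X, Int.cast_neg, neg_smul,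
      mul_neg, neg_add]

lemma divg_neg (k : ℤ) : divg (-k) = -flip (divg k) := by
  simp only [divg, map_smul, map_sum, map_mul, flip_X, Int.sign_neg, Int.natAbs_neg,
    Int.cast_neg, neg_smul, neg_mul, neg_sub]
  congr 2
  refine Finset.sum_congr rfl fun a _ => ?_
  congr 2; ring

lemma divg_natCast_succ (n : ℕ) : divg ((n + 1 : ℕ) : ℤ)
    = ∑ a ∈ Finset.range (n + 1), X ((a : ℤ) + 1) * X (((n + 1 : ℕ) : ℤ) - ((a : ℤ) + 1)) := by
  rw [divg, Int.natAbs_natCast, Int.sign_natCast_of_ne_zero (Nat.succ_ne_zero n)]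
  simp

/-- The loop equations for negative `k` follow from those for positive `k` by flipping. -/
lemma isLoop_of_flip {E : Type*} [AddCommGroup E] [Module ℝ E] (Φ : PowerSums →ₗ[ℝ] E)
    (h : ∀ (n : ℕ) (f : PowerSums),
      Φ (divg ((n + 1 : ℕ) : ℤ) * f + shiftD ((n + 1 : ℕ) : ℤ) f) = 0)
    (h' : ∀ f, Φ f = 0 → Φ (flip f) = 0) : IsLoop Φ := by
  intro k f hk
  rcases lt_or_gt_of_ne hk with hk | hk
  · obtain ⟨n, rfl⟩ : ∃ n : ℕ, k = -((n + 1 : ℕ) : ℤ) := ⟨(-k - 1).toNat, by omega⟩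
    have := h' _ (h n (flip f))
    rw [map_add, map_mul, flip_flip] at this
    have e : divg (-((n + 1 : ℕ) : ℤ)) * f + shiftD (-((n + 1 : ℕ) : ℤ)) f
        = -(flip (divg ((n + 1 : ℕ) : ℤ)) * f + flip (shiftD ((n + 1 : ℕ) : ℤ) (flip f))) := by
      have h2 := shiftD_flip ((n + 1 : ℕ) : ℤ) (flip f)
      rw [flip_flip] at h2
      rw [divg_neg, h2]; ring
    rw [e, map_neg, this, neg_zero]
  · obtain ⟨n, rfl⟩ : ∃ n : ℕ, k = ((n + 1 : ℕ) : ℤ) := ⟨(k - 1).toNat, by omega⟩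
    exact h n f

lemma inv_toLaurent {l : ℕ} (f : PowerSums) :
    Laurent.inv (toLaurent l f) = toLaurent l (flip f) := by
  induction f using induction_X with
  | one => simp
  | add f g hf hg => simp [hf, hg]
  | smul r f hf => simp [hf]
  | mul m f hf => simp [hf, flip_X, toLaurent_X, Laurent.inv_psum]

lemma field_toLaurent {l : ℕ} (k : ℤ) (f : PowerSums) :
    Laurent.field k (toLaurent l f) = toLaurent l (shiftD k f) := by
  induction f using induction_X with
  | one => simp
  | add f g hf hg => simp [hf, hg]
  | smul r f hf => rw [map_smul, Derivation.map_smul, Derivation.map_smul, hf, map_smul]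
  | mul m f hf =>
    rw [map_mul, Derivation.leibniz, Derivation.leibniz, hf, toLaurent_X, shiftD_X]
    simp only [smul_eq_mul, map_add, map_mul, map_smul, toLaurent_X, Laurent.psum, map_sum,
      Laurent.field_mono_single, Finset.smul_sum]

/-! ### The Laplacian on power sums -/

/-- The gradient with respect to the variables `p_k`. -/
def grad : Derivation ℝ PowerSums (ℤ →₀ PowerSums) :=
  mkDerivation ℝ fun k => Finsupp.single k 1

/-- The divergence of the vector field `∑ k, v_k k (∑ j, z_j ^ k (z_j ∂/∂z_j))`. -/
def divergence : (ℤ →₀ PowerSums) →ₗ[ℝ] PowerSums :=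
  Finsupp.lsum ℝ fun k =>
    (k : ℝ) • (LinearMap.mulLeft ℝ (divg k) + (shiftD k : PowerSums →ₗ[ℝ] PowerSums))

lemma divergence_single (k : ℤ) (h : PowerSums) :
    divergence (Finsupp.single k h) = (k : ℝ) • (divg k * h + shiftD k h) := by
  simp [divergence]

/-- The Laplacian of the eigenvalue density, as an operator on polynomials in the power sums. -/
def laplacian : PowerSums →ₗ[ℝ] PowerSums := divergence.comp (grad : PowerSums →ₗ[ℝ] _)

lemma laplacian_apply (f : PowerSums) : laplacian f = divergence (grad f) := rfl

lemma IsLoop.divergence {E : Type*} [AddCommGroup E] [Module ℝ E] {Φ : PowerSums →ₗ[ℝ] E}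
    (h : IsLoop Φ) (v : ℤ →₀ PowerSums) : Φ (divergence v) = 0 := by
  induction v using Finsupp.induction_linear with
  | zero => simp
  | add v w hv hw => rw [map_add, map_add, hv, hw, add_zero]
  | single k f =>
    rw [divergence_single, map_smul]
    by_cases hk : k = 0
    · simp [hk]
    · rw [h k f hk, smul_zero]

/-- Contraction of a vector field with a family of polynomials. -/
def contract {A : Type*} [CommRing A] [Algebra ℝ A] (ι : PowerSums →ₐ[ℝ] A) (c : ℤ → A) :
    (ℤ →₀ PowerSums) →ₗ[ℝ] A :=
  Finsupp.lsum ℝ fun k => (LinearMap.mulLeft ℝ (c k)).comp ι.toLinearMap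

lemma contract_single {A : Type*} [CommRing A] [Algebra ℝ A] (ι : PowerSums →ₐ[ℝ] A) (c : ℤ → A)
    (k : ℤ) (f : PowerSums) : contract ι c (Finsupp.single k f) = c k * ι f := by
  simp [contract]

lemma contract_smul {A : Type*} [CommRing A] [Algebra ℝ A] (ι : PowerSums →ₐ[ℝ] A) (c : ℤ → A)
    (f : PowerSums) (v : ℤ →₀ PowerSums) : contract ι c (f • v) = ι f * contract ι c v := by
  induction v using Finsupp.induction_linear with
  | zero => simp
  | add v w hv hw => rw [smul_add, map_add, map_add, hv, hw, mul_add]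
  | single k g =>
    rw [Finsupp.smul_single, contract_single, contract_single, smul_eq_mul, map_mul]; ring

lemma contract_grad_X_mul {A : Type*} [CommRing A] [Algebra ℝ A] (ι : PowerSums →ₐ[ℝ] A)
    (c : ℤ → A) (m : ℤ) (f : PowerSums) :
    contract ι c (grad (X m * f)) = ι (X m) * contract ι c (grad f) + ι f * c m := by
  rw [Derivation.leibniz, map_add, contract_smul, contract_smul, grad, mkDerivation_X,
    contract_single, map_one, mul_one]

/-- The chain rule. -/
lemma contract_grad {A : Type*} [CommRing A] [Algebra ℝ A] (ι : PowerSums →ₐ[ℝ] A)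
    (D : Derivation ℝ A A) (f : PowerSums) :
    contract ι (fun m => D (ι (X m))) (grad f) = D (ι f) := by
  induction f using induction_X with
  | one => simp
  | add f g hf hg => simp [hf, hg]
  | smul r f hf => rw [Derivation.map_smul, map_smul, hf, map_smul, Derivation.map_smul]
  | mul m f hf =>
    rw [contract_grad_X_mul, hf, map_mul, Derivation.leibniz, smul_eq_mul, smul_eq_mul]

lemma divergence_X_smul (m : ℤ) (v : ℤ →₀ PowerSums) :
    divergence ((X m : PowerSums) • v) = X m * divergence v
      + (m : ℝ) • contract (AlgHom.id ℝ PowerSums)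
          (fun k => (k : ℝ) • (X (k + m) : PowerSums)) v := by
  induction v using Finsupp.induction_linear with
  | zero => simp
  | add v w hv hw => simp only [smul_add, map_add, hv, hw]; ring
  | single k f =>
    rw [Finsupp.smul_single, divergence_single, divergence_single, contract_single, smul_eq_mul,
      Derivation.leibniz, shiftD_X, add_comm k m]
    simp only [smul_eq_mul, AlgHom.id_apply]
    simp only [Algebra.smul_def]
    ring

lemma laplacian_X_mul (m : ℤ) (f : PowerSums) :
    laplacian (X m * f) = X m * laplacian f
      + (m : ℝ) • (divg m * f + (2 : ℝ) • shiftD m f) := by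
  have h := contract_grad (AlgHom.id ℝ PowerSums) (shiftD m) f
  simp only [AlgHom.id_apply, shiftD_X] at h
  have hX : grad (X m) = Finsupp.single m 1 := mkDerivation_X _ _ _
  rw [laplacian_apply, laplacian_apply, Derivation.leibniz, map_add, divergence_X_smul, h, hX,
    Finsupp.smul_single, smul_eq_mul, mul_one, divergence_single, two_smul]
  simp only [smul_add]
  abel

/-! ### Filtration by degree -/

/-- Polynomials of weighted degree at most `d`, where `p_k` has degree `|k|`. -/
def degLE (d : ℕ) : Submodule ℝ PowerSums :=
  Submodule.span ℝ {f | ∃ M : List ℤ, (M.map Int.natAbs).sum ≤ d ∧ f = (M.map X).prod}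

lemma degLE_mono {d e : ℕ} (h : d ≤ e) : degLE d ≤ degLE e :=
  Submodule.span_mono fun _ ⟨M, hM, hf⟩ => ⟨M, hM.trans h, hf⟩

lemma mul_mem_degLE {d e : ℕ} {f g : PowerSums} (hf : f ∈ degLE d) (hg : g ∈ degLE e) :
    f * g ∈ degLE (d + e) := by
  have h : degLE d * degLE e ≤ degLE (d + e) := by
    rw [degLE, degLE, Submodule.span_mul_span]
    refine Submodule.span_mono ?_
    rintro _ ⟨_, ⟨M, hM, rfl⟩, _, ⟨M', hM', rfl⟩, rfl⟩
    exact ⟨M ++ M', by simp; omega, by simp⟩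
  exact h (Submodule.mul_mem_mul hf hg)

lemma X_mem_degLE (m : ℤ) : X m ∈ degLE m.natAbs :=
  Submodule.subset_span ⟨[m], by simp, by simp⟩

lemma one_mem_degLE : 1 ∈ degLE 0 := Submodule.subset_span ⟨[], by simp, by simp⟩

lemma exists_mem_degLE (f : PowerSums) : ∃ d, f ∈ degLE d := by
  induction f using induction_X with
  | one => exact ⟨0, one_mem_degLE⟩
  | add f g hf hg =>
    obtain ⟨d, hd⟩ := hf; obtain ⟨e, he⟩ := hg
    exact ⟨max d e, add_mem (degLE_mono (le_max_left _ _) hd) (degLE_mono (le_max_right _ _) he)⟩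
  | smul r f hf => obtain ⟨d, hd⟩ := hf; exact ⟨d, Submodule.smul_mem _ _ hd⟩
  | mul m f hf => obtain ⟨d, hd⟩ := hf; exact ⟨_, mul_mem_degLE (X_mem_degLE m) hd⟩

lemma divg_mem_degLE (k : ℤ) : divg k ∈ degLE k.natAbs := by
  refine Submodule.smul_mem _ _ (Submodule.sum_mem _ fun a ha => ?_)
  have ha := Finset.mem_range.mp ha
  refine degLE_mono ?_ (mul_mem_degLE (X_mem_degLE _) (X_mem_degLE _))
  rcases lt_trichotomy k 0 with hk | rfl | hk
  · rw [Int.sign_eq_neg_one_of_neg hk]; omega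
  · simp at ha
  · rw [Int.sign_eq_one_of_pos hk]; omega

lemma degLE_induction {p : ℕ → PowerSums → Prop} {d : ℕ} {f : PowerSums} (hf : f ∈ degLE d)
    (zero : ∀ d, p d 0) (one : ∀ d, p d 1) (add : ∀ d f g, p d f → p d g → p d (f + g))
    (smul : ∀ d (r : ℝ) f, p d f → p d (r • f))
    (mul : ∀ d m f, f ∈ degLE d → p d f → p (m.natAbs + d) (X m * f)) : p d f := by
  induction hf using Submodule.span_induction with
  | mem f hf =>
    obtain ⟨M, hM, rfl⟩ := hf
    induction M generalizing d with
    | nil => simpa using one d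
    | cons m M ih =>
      simp only [List.map_cons, List.sum_cons, List.prod_cons] at hM ⊢
      obtain ⟨e, rfl⟩ : ∃ e, d = m.natAbs + e := ⟨d - m.natAbs, by omega⟩
      exact mul e m _ (Submodule.subset_span ⟨M, by omega, rfl⟩) (ih (by omega))
  | zero => exact zero d
  | add f g _ _ hf hg => exact add d f g hf hg
  | smul r f _ hf => exact smul d r f hf

lemma shiftD_mem_degLE (k : ℤ) {d : ℕ} {f : PowerSums} (hf : f ∈ degLE d) :
    shiftD k f ∈ degLE (d + k.natAbs) := by
  refine degLE_induction (p := fun d f => shiftD k f ∈ degLE (d + k.natAbs)) hf ?_ ?_ ?_ ?_ ?_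
  · simp
  · simp
  · intro d f g hf hg; rw [map_add]; exact add_mem hf hg
  · intro d r f hf; rw [Derivation.map_smul]; exact Submodule.smul_mem _ _ hf
  · intro d m f hfd hf
    rw [Derivation.leibniz, shiftD_X, smul_eq_mul, smul_eq_mul, mul_smul_comm]
    refine add_mem ?_ (Submodule.smul_mem _ _ ?_)
    · exact degLE_mono (by omega) (mul_mem_degLE (X_mem_degLE m) hf)
    · exact degLE_mono (by omega) (mul_mem_degLE hfd (X_mem_degLE (m + k)))

lemma laplacian_mem_degLE {d : ℕ} {f : PowerSums} (hf : f ∈ degLE d) :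
    laplacian f ∈ degLE d := by
  refine degLE_induction (p := fun d f => laplacian f ∈ degLE d) hf ?_ ?_ ?_ ?_ ?_
  · simp
  · simp [laplacian_apply]
  · intro d f g hf hg; rw [map_add]; exact add_mem hf hg
  · intro d r f hf; rw [map_smul]; exact Submodule.smul_mem _ _ hf
  · intro d m f hfd hf
    rw [laplacian_X_mul]
    refine add_mem (mul_mem_degLE (X_mem_degLE m) hf) (Submodule.smul_mem _ _ (add_mem
      (mul_mem_degLE (divg_mem_degLE m) hfd) (Submodule.smul_mem _ _ ?_)))
    exact degLE_mono (by omega) (shiftD_mem_degLE m hfd)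

/-- The Laurent polynomials with exponents bounded by `d`. -/
def boxLE (l d : ℕ) : Submodule ℝ (Laurent l) :=
  Submodule.span ℝ (Laurent.mono '' {κ | ∀ j, |κ j| ≤ (d : ℤ)})

lemma mul_mem_boxLE {l d e : ℕ} {f g : Laurent l} (hf : f ∈ boxLE l d) (hg : g ∈ boxLE l e) :
    f * g ∈ boxLE l (d + e) := by
  have h : boxLE l d * boxLE l e ≤ boxLE l (d + e) := by
    rw [boxLE, boxLE, Submodule.span_mul_span]
    refine Submodule.span_mono ?_
    rintro _ ⟨_, ⟨κ, hκ, rfl⟩, _, ⟨κ', hκ', rfl⟩, rfl⟩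
    refine ⟨κ + κ', fun j => ?_, Laurent.mono_add _ _⟩
    push_cast
    exact (abs_add_le _ _).trans (add_le_add (hκ j) (hκ' j))
  exact h (Submodule.mul_mem_mul hf hg)

lemma one_mem_boxLE (l d : ℕ) : 1 ∈ boxLE l d :=
  Submodule.subset_span ⟨0, fun j => by simp, Laurent.mono_zero⟩

lemma psum_mem_boxLE (l : ℕ) (m : ℤ) : Laurent.psum m ∈ boxLE l m.natAbs := by
  refine Submodule.sum_mem _ fun i _ => Submodule.subset_span ⟨_, fun j => ?_, rfl⟩
  rw [Pi.single_apply]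
  split_ifs <;> simp

instance finiteDimensional_boxLE (l d : ℕ) : FiniteDimensional ℝ (boxLE l d) := by
  refine FiniteDimensional.span_of_finite ℝ (Set.Finite.image _ ?_)
  refine (Set.finite_Icc (fun _ : Fin l => -(d : ℤ)) (fun _ => (d : ℤ))).subset fun κ hκ => ?_
  exact ⟨fun j => (abs_le.mp (hκ j)).1, fun j => (abs_le.mp (hκ j)).2⟩

lemma toLaurent_mem_boxLE {l d : ℕ} {f : PowerSums} (hf : f ∈ degLE d) :
    toLaurent l f ∈ boxLE l d := by
  refine degLE_induction (p := fun d f => toLaurent l f ∈ boxLE l d) hf ?_ ?_ ?_ ?_ ?_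
  · simp
  · intro d; rw [map_one]; exact one_mem_boxLE l d
  · intro d f g hf hg; rw [map_add]; exact add_mem hf hg
  · intro d r f hf; rw [map_smul]; exact Submodule.smul_mem _ _ hf
  · intro d m f _ hf
    rw [map_mul, toLaurent_X]
    exact mul_mem_boxLE (psum_mem_boxLE l m) hf

/-! ### Uniqueness of the solution of the loop equations -/

lemma isLoop_weightedTerm (l : ℕ) :
    IsLoop (Laurent.weightedTerm.comp (toLaurent l).toLinearMap) := by
  refine isLoop_of_flip _ (fun n f => ?_) fun f hf => ?_
  · have h := Laurent.weightedTerm_field n (toLaurent l f)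
    rw [← h, LinearMap.comp_apply]
    congr 1
    simp only [AlgHom.toLinearMap_apply, map_add, map_mul, field_toLaurent, divg_natCast_succ,
      map_sum, toLaurent_X]
  · simp only [LinearMap.comp_apply, AlgHom.toLinearMap_apply] at hf ⊢
    rw [← inv_toLaurent, Laurent.weightedTerm_inv, hf]

/-- Green's formula: the Laplacian is the operator of the Dirichlet form. -/
lemma weightedTerm_mul_laplacian {l : ℕ} (f g : PowerSums) :
    Laurent.weightedTerm (toLaurent l g * toLaurent l (laplacian f))
      = -∑ j, Laurent.weightedTerm
          (Laurent.pd j (toLaurent l g) * Laurent.pd j (toLaurent l f)) := by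
  have key : ∀ v : ℤ →₀ PowerSums,
      Laurent.weightedTerm (toLaurent l g * toLaurent l (divergence v))
        = -∑ j, Laurent.weightedTerm (Laurent.pd j (toLaurent l g) *
          contract (toLaurent l) (fun k => Laurent.pd j (toLaurent l (X k))) v) := by
    intro v
    induction v using Finsupp.induction_linear with
    | zero => simp
    | add v w hv hw =>
      simp only [map_add, mul_add, hv, hw, Finset.sum_add_distrib]; ring
    | single k h =>
      have hpd : ∀ j : Fin l, Laurent.pd j (toLaurent l (X k))
          = (k : ℝ) • Laurent.mono (Pi.single j k) := by
        intro j
        rw [toLaurent_X, Laurent.psum, map_sum, Finset.sum_eq_single j]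
        · rw [Laurent.pd_mono, Pi.single_eq_same]
        · intro i _ hi
          rw [Laurent.pd_mono, Pi.single_eq_of_ne hi.symm]; simp
        · intro hj; exact absurd (Finset.mem_univ j) hj
      have hsum : (∑ j, Laurent.pd j (toLaurent l g) *
          contract (toLaurent l) (fun k => Laurent.pd j (toLaurent l (X k))) (Finsupp.single k h))
          = (k : ℝ) • (toLaurent l h * Laurent.field k (toLaurent l g)) := by
        simp only [contract_single, hpd, Laurent.field_apply, Finset.mul_sum, Finset.smul_sum]
        refine Finset.sum_congr rfl fun j _ => ?_
        simp only [Algebra.smul_def]; ring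
      rw [← map_sum, hsum, divergence_single]
      by_cases hk : k = 0
      · simp [hk]
      have h0 := isLoop_weightedTerm l k (g * h) hk
      rw [LinearMap.comp_apply, AlgHom.toLinearMap_apply, Derivation.leibniz] at h0
      rw [map_smul, mul_smul_comm, map_smul, map_smul, ← smul_neg]
      congr 1
      rw [eq_neg_iff_add_eq_zero, ← map_add, ← h0]
      congr 1
      simp only [map_add, map_mul, smul_eq_mul, field_toLaurent]
      ring
  rw [laplacian_apply, key]
  simp only [contract_grad]

/-- In a finite dimensional space with a definite bilinear form, a subspace with trivial orthogonal
complement is everything. -/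
lemma le_of_orthogonal_trivial {A : Type*} [AddCommGroup A] [Module ℝ A] (B : A →ₗ[ℝ] A →ₗ[ℝ] ℝ)
    {V W : Submodule ℝ A} [FiniteDimensional ℝ V] (hdef : ∀ x ∈ V, B x x = 0 → x = 0)
    (hWV : W ≤ V) (horth : ∀ x ∈ V, (∀ w ∈ W, B x w = 0) → x = 0) : V ≤ W := by
  let B' : V →ₗ[ℝ] Module.Dual ℝ V := (B.domRestrict₁₂ V V)
  have hB : ∀ x y : V, B' x y = B x y := fun _ _ => rfl
  have hinj : Function.Injective B' := by
    rw [injective_iff_map_eq_zero]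
    intro x hx
    refine Subtype.ext (hdef x x.2 ?_)
    rw [← hB, hx]; rfl
  have hsurj : Function.Surjective B' :=
    (LinearMap.injective_iff_surjective_of_finrank_eq_finrank
      Subspace.dual_finrank_eq.symm).mp hinj
  have hW : W.comap V.subtype = ⊤ := by
    by_contra hne
    obtain ⟨Φ, hΦ0, hΦ⟩ := Submodule.exists_le_ker_of_lt_top _ (lt_top_iff_ne_top.mpr hne)
    obtain ⟨x, rfl⟩ := hsurj Φ
    have hx : (x : A) = 0 := horth x x.2 fun w hw => by
      have h := @hΦ ⟨w, hWV hw⟩ hw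
      exact h
    exact hΦ0 (by rw [show x = 0 from Subtype.ext hx, map_zero])
  intro x hx
  have : (⟨x, hx⟩ : V) ∈ W.comap V.subtype := hW ▸ Submodule.mem_top
  exact this

/-- A polynomial in the power sums that is orthogonal to all Laplacians has zero gradient on the
torus, so it vanishes if it is orthogonal to the constants too. -/
lemma toLaurent_eq_zero_of_orthogonal {l : ℕ} (g : PowerSums)
    (h1 : Laurent.weightedTerm (Laurent.inv (toLaurent l g) * toLaurent l (laplacian g)) = 0)
    (h2 : Laurent.weightedTerm (Laurent.inv (toLaurent l g)) = 0) : toLaurent l g = 0 := by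
  have h3 : ∀ j, Laurent.pd j (toLaurent l g) = 0 := by
    rw [inv_toLaurent, weightedTerm_mul_laplacian] at h1
    simp only [← inv_toLaurent, Laurent.pd_inv, neg_mul, map_neg, Finset.sum_neg_distrib,
      neg_neg] at h1
    rw [Finset.sum_eq_zero_iff_of_nonneg
      fun j _ => Laurent.weightedTerm_inv_mul_self_nonneg _] at h1
    exact fun j => Laurent.eq_zero_of_weightedTerm_inv_mul_self (h1 j (Finset.mem_univ j))
  refine Laurent.eq_zero_of_weightedTerm_inv_mul_self ?_
  nth_rewrite 2 [Laurent.eq_smul_one_of_pd_eq_zero h3]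
  rw [mul_smul_comm, mul_one, map_smul, h2, smul_zero]

/-- Up to constants, every polynomial in the power sums is a Laplacian as a function on the
torus. -/
lemma exists_toLaurent_eq (l : ℕ) (f : PowerSums) :
    ∃ (c : ℝ) (g : PowerSums), toLaurent l f = toLaurent l (c • 1 + laplacian g) := by
  obtain ⟨d, hd⟩ := exists_mem_degLE f
  let V : Submodule ℝ (Laurent l) := (degLE d).map (toLaurent l).toLinearMap
  let W : Submodule ℝ (Laurent l) :=
    (Submodule.span ℝ {1} ⊔ (degLE d).map laplacian).map (toLaurent l).toLinearMap
  have hV : V ≤ boxLE l d := by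
    rintro _ ⟨g, hg, rfl⟩; exact toLaurent_mem_boxLE hg
  have : FiniteDimensional ℝ V := Submodule.finiteDimensional_of_le hV
  have hWV : W ≤ V := by
    refine Submodule.map_mono (sup_le ?_ ?_)
    · rw [Submodule.span_singleton_le_iff_mem]
      exact degLE_mono (Nat.zero_le d) one_mem_degLE
    · rintro _ ⟨g, hg, rfl⟩; exact laplacian_mem_degLE hg
  -- the inner product of the eigenvalue density
  let B : Laurent l →ₗ[ℝ] Laurent l →ₗ[ℝ] ℝ :=
    ((LinearMap.mul ℝ (Laurent l)).comp Laurent.inv.toLinearMap).compr₂ Laurent.weightedTerm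
  have hB : ∀ x y, B x y = Laurent.weightedTerm (Laurent.inv x * y) := fun _ _ => rfl
  have hVW : V ≤ W := by
    refine le_of_orthogonal_trivial B
      (fun x _ hx => Laurent.eq_zero_of_weightedTerm_inv_mul_self hx) hWV ?_
    rintro _ ⟨g, hg, rfl⟩ horth
    refine toLaurent_eq_zero_of_orthogonal g ?_ ?_
    · exact horth _ ⟨_, Submodule.mem_sup_right ⟨g, hg, rfl⟩, rfl⟩
    · have h := horth _ ⟨1, Submodule.mem_sup_left (Submodule.mem_span_singleton_self _), rfl⟩
      rw [hB, AlgHom.toLinearMap_apply, AlgHom.toLinearMap_apply, map_one, mul_one] at h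
      exact h
  obtain ⟨b, hb, hbf⟩ := hVW ⟨f, hd, rfl⟩
  obtain ⟨a, ha, _, ⟨g, _, rfl⟩, rfl⟩ := Submodule.mem_sup.mp hb
  obtain ⟨c, rfl⟩ := Submodule.mem_span_singleton.mp ha
  exact ⟨c, g, hbf.symm⟩

/-- The loop equations have only one normalized solution among the functionals that depend on the
values on the torus only. -/
theorem IsLoop.eq_weightedTerm {E : Type*} [AddCommGroup E] [Module ℝ E] {l : ℕ}
    {Φ : PowerSums →ₗ[ℝ] E} (h : IsLoop Φ) (hker : ∀ f, toLaurent l f = 0 → Φ f = 0)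
    (f : PowerSums) :
    Laurent.weightedTerm (1 : Laurent l) • Φ f = Laurent.weightedTerm (toLaurent l f) • Φ 1 := by
  obtain ⟨c, g, hg⟩ := exists_toLaurent_eq l f
  have h1 : Φ f = c • Φ 1 := by
    have := hker (f - (c • 1 + laplacian g)) (by rw [map_sub, hg, sub_self])
    rw [map_sub, map_add, map_smul, laplacian_apply, h.divergence, add_zero, sub_eq_zero] at this
    exact this
  have h2 : Laurent.weightedTerm (toLaurent l f) = c • Laurent.weightedTerm (1 : Laurent l) := by
    rw [hg, map_add, map_add, map_smul, map_smul, map_one]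
    have := (isLoop_weightedTerm l).divergence (grad g)
    rw [LinearMap.comp_apply, AlgHom.toLinearMap_apply] at this
    rw [laplacian_apply, this, add_zero]
  rw [h1, h2, smul_smul, smul_eq_mul, mul_comm]

end PowerSums

/-! ### Averages over the eigenvalue density -/

namespace Laurent

variable {l : ℕ}

/-- The value of a Laurent polynomial at the point of the torus with angles `θ`. -/
def evalAt (θ : Fin l → ℝ) : Laurent l →ₐ[ℝ] ℂ :=
  AddMonoidAlgebra.lift ℝ ℂ (Fin l → ℤ)
    { toFun := fun κ => Complex.exp (Complex.I * ∑ j, (κ.toAdd j : ℂ) * θ j)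
      map_one' := by simp
      map_mul' := fun κ κ' => by
        rw [← Complex.exp_add, ← mul_add, ← Finset.sum_add_distrib]
        simp [add_mul] }

lemma evalAt_mono (θ : Fin l → ℝ) (κ : Fin l → ℤ) :
    evalAt θ (mono κ) = Complex.exp (Complex.I * ∑ j, (κ j : ℂ) * θ j) := by
  simp [evalAt, mono]

lemma evalAt_mono_single (θ : Fin l → ℝ) (i : Fin l) (k : ℤ) :
    evalAt θ (mono (Pi.single i k)) = Complex.exp (Complex.I * (k * θ i)) := by
  rw [evalAt_mono, Finset.sum_eq_single i]
  · simp
  · intro j _ hj; rw [Pi.single_eq_of_ne hj]; simp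
  · intro h; exact absurd (Finset.mem_univ i) h

lemma evalAt_psum (θ : Fin l → ℝ) (k : ℤ) :
    evalAt θ (psum k) = ∑ j, Complex.exp (Complex.I * (k * θ j)) := by
  simp only [psum, map_sum, evalAt_mono_single]

lemma evalAt_inv (θ : Fin l → ℝ) (x : Laurent l) :
    evalAt θ (inv x) = (starRingEnd ℂ) (evalAt θ x) := by
  induction x using induction with
  | hm κ =>
    rw [inv_mono, evalAt_mono, evalAt_mono, ← Complex.exp_conj]
    congr 1
    simp [Finset.sum_neg_distrib]
  | ha x y hx hy => simp only [map_add, hx, hy]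
  | hs r x hx => simp only [map_smul, hx]; simp [Complex.real_smul]

lemma continuous_evalAt (x : Laurent l) : Continuous fun θ : Fin l → ℝ => evalAt θ x := by
  induction x using induction with
  | hm κ => simp only [evalAt_mono]; fun_prop
  | ha x y hx hy => simp only [map_add]; fun_prop
  | hs r x hx => simp only [map_smul]; fun_prop

lemma evalAt_vand (θ : Fin l → ℝ) : evalAt θ vand = ∏ j : Fin l, ∏ k ∈ Finset.Ioi j,
    (Complex.exp (Complex.I * θ k) - Complex.exp (Complex.I * θ j)) := by
  simp only [vand, map_prod, map_sub, evalAt_mono_single, Int.cast_one, one_mul]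

/-- The cube of angles. -/
def angleBox (l : ℕ) : Set (Fin l → ℝ) :=
  Set.univ.pi fun _ : Fin l => Set.Ioo (-Real.pi) Real.pi

lemma eigenvalueDensity_eq (θ : Fin l → ℝ) :
    (eigenvalueDensity l θ : ℂ)
      = ((1 / ((2 * Real.pi) ^ l * (l ! : ℝ)) : ℝ) : ℂ) * evalAt θ (vand * inv vand) := by
  rw [map_mul, evalAt_inv, Complex.mul_conj, evalAt_vand, Complex.normSq_eq_norm_sq,
    eigenvalueDensity]
  simp only [norm_prod, Finset.prod_pow, Complex.ofReal_mul]

lemma integral_exp_int (k : ℤ) :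
    ∫ t in Set.Ioo (-Real.pi) Real.pi, Complex.exp (Complex.I * (k * (t : ℂ)))
      = if k = 0 then ((2 * Real.pi : ℝ) : ℂ) else 0 := by
  rw [← integral_Ioc_eq_integral_Ioo,
    ← intervalIntegral.integral_of_le (by linarith [Real.pi_pos])]
  split_ifs with hk
  · subst hk; simp [two_mul]
  · have hc : Complex.I * k ≠ 0 := mul_ne_zero Complex.I_ne_zero (by exact_mod_cast hk)
    have h := integral_exp_mul_complex (a := -Real.pi) (b := Real.pi) hc
    simp only [mul_assoc] at h
    rw [h, div_eq_zero_iff]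
    left
    rw [sub_eq_zero, Complex.exp_eq_exp_iff_exists_int]
    exact ⟨k, by push_cast; ring⟩

lemma integral_evalAt (x : Laurent l) :
    ∫ θ in angleBox l, evalAt θ x = (((2 * Real.pi) ^ l * constTerm x : ℝ) : ℂ) := by
  have hint : ∀ x : Laurent l, IntegrableOn (fun θ => evalAt θ x) (angleBox l) volume := by
    intro x
    have hK : IsCompact (Set.univ.pi fun _ : Fin l => Set.Icc (-Real.pi) Real.pi) :=
      isCompact_univ_pi fun _ => isCompact_Icc
    exact ((continuous_evalAt x).continuousOn.integrableOn_compact hK).mono_set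
      (Set.pi_mono fun _ _ => Set.Ioo_subset_Icc_self)
  induction x using induction with
  | hm κ =>
    have h1 : ∀ θ : Fin l → ℝ, evalAt θ (mono κ)
        = ∏ j, Complex.exp (Complex.I * (κ j * (θ j : ℂ))) := by
      intro θ; rw [evalAt_mono, Finset.mul_sum, Complex.exp_sum]
    simp only [h1, angleBox]
    rw [volume_pi, Measure.restrict_pi_pi, integral_fintype_prod_eq_prod
      (f := fun j (t : ℝ) => Complex.exp (Complex.I * (κ j * (t : ℂ))))]
    simp only [integral_exp_int, constTerm_mono]
    split_ifs with h
    · subst h; simp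
    · obtain ⟨j, hj⟩ := Function.ne_iff.mp h
      rw [Finset.prod_eq_zero (Finset.mem_univ j) (if_neg hj)]; simp
  | ha x y hx hy =>
    simp only [map_add]
    rw [integral_add (hint x) (hint y), hx, hy]
    push_cast; ring
  | hs r x hx =>
    simp only [map_smul]
    rw [integral_smul, hx, Complex.real_smul, smul_eq_mul]
    push_cast; ring

/-- The average of a Laurent polynomial over the eigenvalue density. -/
lemma eigenvalueAverage_eq (F : (Fin l → ℝ) → ℝ) (x : Laurent l)
    (h : ∀ θ, (F θ : ℂ) = evalAt θ x) : eigenvalueAverage l F = weightedTerm x / (l ! : ℝ) := by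
  have h1 : ((eigenvalueAverage l F : ℝ) : ℂ) = ((weightedTerm x / (l ! : ℝ) : ℝ) : ℂ) := by
    rw [eigenvalueAverage, ← integral_complex_ofReal]
    have : ∀ θ, ((F θ * eigenvalueDensity l θ : ℝ) : ℂ)
        = ((1 / ((2 * Real.pi) ^ l * (l ! : ℝ)) : ℝ) : ℂ) * evalAt θ (x * (vand * inv vand)) := by
      intro θ
      rw [Complex.ofReal_mul, eigenvalueDensity_eq, h, map_mul _ x]; ring
    simp only [this]
    rw [integral_const_mul]
    change _ * ∫ θ in angleBox l, _ = _
    rw [integral_evalAt, ← Complex.ofReal_mul, ← weightedTerm_apply]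
    congr 1
    have hp : (2 * Real.pi) ^ l ≠ 0 := pow_ne_zero _ (by positivity)
    have hl : (l ! : ℝ) ≠ 0 := by positivity
    field_simp
  exact_mod_cast h1

end Laurent

open Laurent in
/-- The number of pairs of lattice words of the same content is a moment of the eigenvalue
density. -/
lemma eigenvalueAverage_norm_pow (l N : ℕ) :
    eigenvalueAverage l (fun θ => ‖∑ j, Complex.exp (Complex.I * θ j)‖ ^ (2 * N))
      = (latticeWordPairs l N).card := by
  rw [eigenvalueAverage_eq _ (psum 1 ^ N * psum (-1) ^ N), weightedTerm_psum_pow,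
    mul_div_cancel_left₀ _ (by positivity)]
  · rfl
  · intro θ
    rw [← inv_psum, ← map_pow, map_mul, evalAt_inv, Complex.mul_conj, Complex.normSq_eq_norm_sq,
      map_pow, evalAt_psum, norm_pow, ← pow_mul, mul_comm N 2]
    simp only [Int.cast_one, one_mul]

/-- The moments of `∑ j, 2 cos θ_j`, in terms of lattice words. -/
def traceMoment (l n : ℕ) : ℝ :=
  if Even n then ((n.choose (n / 2) : ℕ) : ℝ) * (latticeWordPairs l (n / 2)).card else 0

open Laurent in
lemma weightedTerm_psum_add_pow (l n : ℕ) :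
    weightedTerm ((psum 1 + psum (-1)) ^ n : Laurent l) = (l ! : ℝ) * traceMoment l n := by
  rw [add_pow, map_sum]
  have h : ∀ a ∈ Finset.range (n + 1),
      weightedTerm (psum 1 ^ a * psum (-1) ^ (n - a) * ((n.choose a : ℕ) : Laurent l))
        = if 2 * a = n then (l ! : ℝ) * (((n.choose a : ℕ) : ℝ) * (latticeWordPairs l a).card)
          else 0 := by
    intro a ha
    have ha := Finset.mem_range.mp ha
    rw [mul_comm, ← nsmul_eq_mul, map_nsmul, weightedTerm_psum_pow]
    split_ifs with h
    · rw [show n - a = a by omega, nsmul_eq_mul, latticeWordPairs]; ring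
    · rw [Finset.card_eq_zero.mpr]
      · simp
      · refine Finset.filter_eq_empty_iff.mpr fun p hp hc => h ?_
        obtain ⟨h1, h2⟩ := Finset.mem_product.mp hp
        have e1 := sum_content p.1
        rw [hc, sum_content, (mem_latticeWords.mp h1).1, (mem_latticeWords.mp h2).1] at e1
        omega
  rw [Finset.sum_congr rfl h, traceMoment]
  split_ifs with hn
  · obtain ⟨m, rfl⟩ := hn
    rw [Finset.sum_eq_single m]
    · rw [if_pos (by ring), show (m + m) / 2 = m by omega]
    · intro a _ ha; exact if_neg (by omega)
    · intro hm; exact absurd (Finset.mem_range.mpr (by omega)) hm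
  · rw [mul_zero]
    refine Finset.sum_eq_zero fun a _ => if_neg fun e => hn ⟨a, by omega⟩

open Laurent in
lemma evalAt_psum_add {l : ℕ} (θ : Fin l → ℝ) :
    evalAt θ (psum 1 + psum (-1)) = ((∑ j, 2 * Real.cos (θ j) : ℝ) : ℂ) := by
  rw [map_add, evalAt_psum, evalAt_psum, ← Finset.sum_add_distrib]
  push_cast
  refine Finset.sum_congr rfl fun j _ => ?_
  rw [Complex.two_cos]
  congr 2 <;> ring

open Laurent in
lemma eigenvalueAverage_cos_pow (l n : ℕ) :
    eigenvalueAverage l (fun θ => (∑ j, 2 * Real.cos (θ j)) ^ n) = traceMoment l n := by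
  rw [eigenvalueAverage_eq _ ((psum 1 + psum (-1)) ^ n), weightedTerm_psum_add_pow,
    mul_div_cancel_left₀ _ (by positivity)]
  intro θ
  rw [map_pow, evalAt_psum_add, Complex.ofReal_pow]

/-- Term by term integration of an exponential series. -/
lemma hasSum_integral_exp {α : Type*} [MeasurableSpace α] {μ : Measure α} {X g : α → ℂ} {M : ℝ}
    (hX : AEStronglyMeasurable X μ) (hM : ∀ a, ‖X a‖ ≤ M) (hg : Integrable g μ) :
    HasSum (fun n : ℕ => ((n ! : ℕ) : ℂ)⁻¹ * ∫ a, X a ^ n * g a ∂μ)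
      (∫ a, Complex.exp (X a) * g a ∂μ) := by
  have h := hasSum_integral_of_dominated_convergence (μ := μ)
    (F := fun (n : ℕ) a => ((n ! : ℕ) : ℂ)⁻¹ * (X a ^ n * g a))
    (f := fun a => Complex.exp (X a) * g a)
    (fun n a => ‖((n ! : ℕ) : ℂ)⁻¹‖ * (M ^ n * ‖g a‖)) ?_ ?_ ?_ ?_ ?_
  · simpa only [integral_const_mul] using h
  · intro n
    exact ((hX.pow n).mul hg.aestronglyMeasurable).const_mul _
  · intro n
    refine Filter.Eventually.of_forall fun a => ?_
    rw [norm_mul, norm_mul, norm_pow]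
    gcongr
    exact hM a
  · refine Filter.Eventually.of_forall fun a => ?_
    have := (Real.summable_pow_div_factorial M).mul_right ‖g a‖
    refine this.congr fun n => ?_
    simp; ring
  · have : ∀ a, ∑' n : ℕ, ‖((n ! : ℕ) : ℂ)⁻¹‖ * (M ^ n * ‖g a‖) = Real.exp M * ‖g a‖ := by
      intro a
      rw [Real.exp_eq_exp_ℝ, NormedSpace.exp_eq_tsum_div, ← tsum_mul_right]
      refine tsum_congr fun n => ?_
      simp; ring
    simp only [this]
    exact hg.norm.const_mul _
  · refine Filter.Eventually.of_forall fun a => ?_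
    have := (NormedSpace.expSeries_div_hasSum_exp (X a)).mul_right (g a)
    rw [← Complex.exp_eq_exp_ℂ] at this
    convert! this using 2 with n
    ring

/-! ### Derivatives along one-parameter subgroups of the unitary group -/

section UnitaryCurve

-- The choice of the norm is immaterial: it serves to speak of derivatives only.
open scoped Matrix.Norms.Operator

variable {l : ℕ}

/-- The one-parameter subgroup of the unitary group generated by a skew-Hermitian matrix. -/
def unitaryExp (X : Matrix (Fin l) (Fin l) ℂ) (hX : star X = -X) (t : ℝ) :
    Matrix.unitaryGroup (Fin l) ℂ :=
  ⟨NormedSpace.exp (t • X), by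
    have h : star (NormedSpace.exp (t • X)) = NormedSpace.exp (-(t • X)) := by
      rw [Matrix.star_eq_conjTranspose, ← Matrix.exp_conjTranspose, ← Matrix.star_eq_conjTranspose,
        star_smul, hX]
      simp
    have hc : Commute (-(t • X)) (t • X) := (Commute.refl (t • X)).neg_left
    rw [Matrix.mem_unitaryGroup_iff', h, ← Matrix.exp_add_of_commute _ _ hc]
    simp⟩

lemma hasDerivAt_unitaryExp_mul (X : Matrix (Fin l) (Fin l) ℂ) (hX : star X = -X)
    (U : Matrix.unitaryGroup (Fin l) ℂ) (t : ℝ) :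
    HasDerivAt (fun s => (unitaryExp X hX s * U).1) (X * (unitaryExp X hX t * U).1) t := by
  have h := (hasDerivAt_exp_smul_const' (𝕂 := ℝ) X t).mul_const U.1
  rw [mul_assoc] at h
  exact h

/-- The derivative of `U ^ n` in the direction `X U`. -/
def powDeriv (X : Matrix (Fin l) (Fin l) ℂ) (U : Matrix (Fin l) (Fin l) ℂ) (n : ℕ) :
    Matrix (Fin l) (Fin l) ℂ :=
  ∑ a ∈ Finset.range n, U ^ a * X * U ^ (n - a)

lemma powDeriv_succ (X U : Matrix (Fin l) (Fin l) ℂ) (n : ℕ) :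
    powDeriv X U (n + 1) = powDeriv X U n * U + U ^ n * (X * U) := by
  rw [powDeriv, Finset.sum_range_succ, powDeriv, Finset.sum_mul]
  congr 1
  · refine Finset.sum_congr rfl fun a ha => ?_
    have := Finset.mem_range.mp ha
    rw [show n + 1 - a = (n - a) + 1 by omega, pow_succ, mul_assoc, mul_assoc, mul_assoc]
  · simp [mul_assoc]

lemma trace_powDeriv (X U : Matrix (Fin l) (Fin l) ℂ) (n : ℕ) :
    (powDeriv X U n).trace = n * (X * U ^ n).trace := by
  rw [powDeriv, Matrix.trace_sum, Finset.sum_congr rfl (g := fun _ => (X * U ^ n).trace)]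
  · simp
  · intro a ha
    have := Finset.mem_range.mp ha
    rw [Matrix.trace_mul_comm, ← mul_assoc, ← pow_add, Matrix.trace_mul_comm]
    congr 3; omega

lemma hasDerivAt_pow_unitaryExp_mul (X : Matrix (Fin l) (Fin l) ℂ) (hX : star X = -X)
    (U : Matrix.unitaryGroup (Fin l) ℂ) (n : ℕ) (t : ℝ) :
    HasDerivAt (fun s => (unitaryExp X hX s * U).1 ^ n)
      (powDeriv X (unitaryExp X hX t * U).1 n) t := by
  induction n with
  | zero =>
    simp only [pow_zero, powDeriv, Finset.range_zero, Finset.sum_empty]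
    exact hasDerivAt_const t (1 : Matrix (Fin l) (Fin l) ℂ)
  | succ n ih =>
    have h := ih.mul (hasDerivAt_unitaryExp_mul X hX U t)
    rw [powDeriv_succ]
    simp only [pow_succ]
    exact h

lemma hasDerivAt_entry_pow (X : Matrix (Fin l) (Fin l) ℂ) (hX : star X = -X)
    (U : Matrix.unitaryGroup (Fin l) ℂ) (n : ℕ) (i j : Fin l) (t : ℝ) :
    HasDerivAt (fun s => ((unitaryExp X hX s * U).1 ^ n) i j)
      (powDeriv X (unitaryExp X hX t * U).1 n i j) t :=
  ((Matrix.entryLinearMap ℝ ℂ i j).toContinuousLinearMap.hasFDerivAt).comp_hasDerivAt t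
    (hasDerivAt_pow_unitaryExp_mul X hX U n t)

lemma hasDerivAt_trace_pow (X : Matrix (Fin l) (Fin l) ℂ) (hX : star X = -X)
    (U : Matrix.unitaryGroup (Fin l) ℂ) (n : ℕ) (t : ℝ) :
    HasDerivAt (fun s => ((unitaryExp X hX s * U).1 ^ n).trace)
      (n * (X * (unitaryExp X hX t * U).1 ^ n).trace) t := by
  rw [← trace_powDeriv]
  exact ((Matrix.traceLinearMap (Fin l) ℝ ℂ).toContinuousLinearMap.hasFDerivAt).comp_hasDerivAt t
    (hasDerivAt_pow_unitaryExp_mul X hX U n t)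

end UnitaryCurve

section HaarAverage

variable {l : ℕ}

/-- The power sum `Tr (U ^ k)` of the eigenvalues of a unitary matrix. -/
def traceZPow (U : Matrix.unitaryGroup (Fin l) ℂ) (k : ℤ) : ℂ := ((U ^ k).1).trace

lemma coe_zpow_natCast (U : Matrix.unitaryGroup (Fin l) ℂ) (n : ℕ) :
    ((U ^ (n : ℤ)).1 : Matrix (Fin l) (Fin l) ℂ) = U.1 ^ n := by
  rw [zpow_natCast]; rfl

lemma coe_zpow_neg (U : Matrix.unitaryGroup (Fin l) ℂ) (k : ℤ) :
    ((U ^ (-k)).1 : Matrix (Fin l) (Fin l) ℂ) = star (U ^ k).1 := by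
  rw [zpow_neg]; rfl

lemma traceZPow_neg (U : Matrix.unitaryGroup (Fin l) ℂ) (k : ℤ) :
    traceZPow U (-k) = (starRingEnd ℂ) (traceZPow U k) := by
  rw [traceZPow, coe_zpow_neg, Matrix.star_eq_conjTranspose, Matrix.trace_conjTranspose]; rfl

lemma hasDerivAt_traceZPow (X : Matrix (Fin l) (Fin l) ℂ) (hX : star X = -X)
    (U : Matrix.unitaryGroup (Fin l) ℂ) (k : ℤ) (t : ℝ) :
    HasDerivAt (fun s => traceZPow (unitaryExp X hX s * U) k)
      (k * (X * ((unitaryExp X hX t * U) ^ k).1).trace) t := by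
  obtain ⟨n, rfl | rfl⟩ := Int.eq_nat_or_neg k
  · have h := hasDerivAt_trace_pow X hX U n t
    simpa only [traceZPow, coe_zpow_natCast, Int.cast_natCast] using h
  · have h := (hasDerivAt_trace_pow X hX U n t).star
    have e : star ((n : ℂ) * (X * (unitaryExp X hX t * U).1 ^ n).trace)
        = ((-(n : ℤ) : ℤ) : ℂ) * (X * ((unitaryExp X hX t * U) ^ (-(n : ℤ))).1).trace := by
      rw [coe_zpow_neg, coe_zpow_natCast, star_mul', star_natCast, ← Matrix.trace_conjTranspose,
        Matrix.conjTranspose_mul, ← Matrix.star_eq_conjTranspose, ← Matrix.star_eq_conjTranspose,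
        hX, Matrix.trace_mul_comm, neg_mul, Matrix.trace_neg]
      push_cast; ring
    rw [e] at h
    simp only [traceZPow_neg]
    simp only [traceZPow, coe_zpow_natCast]
    exact h

/-- The value of a polynomial in the power sums at the eigenvalues of a unitary matrix. -/
def evalU (U : Matrix.unitaryGroup (Fin l) ℂ) : PowerSums →ₐ[ℝ] ℂ :=
  MvPolynomial.aeval (traceZPow U)

namespace PowerSums

open MvPolynomial

lemma evalU_X (U : Matrix.unitaryGroup (Fin l) ℂ) (k : ℤ) : evalU U (X k) = traceZPow U k :=
  aeval_X _ _

lemma evalU_flip (U : Matrix.unitaryGroup (Fin l) ℂ) (f : PowerSums) :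
    evalU U (flip f) = (starRingEnd ℂ) (evalU U f) := by
  induction f using induction_X with
  | one => simp
  | add f g hf hg => simp only [map_add, hf, hg]
  | smul r f hf => simp only [map_smul, hf]; simp [Complex.real_smul]
  | mul m f hf => simp only [map_mul, hf, flip_X, evalU_X, traceZPow_neg]

lemma contract_apply {A : Type*} [CommRing A] [Algebra ℝ A] (ι : PowerSums →ₐ[ℝ] A) (c : ℤ → A)
    (v : ℤ →₀ PowerSums) : contract ι c v = ∑ k ∈ v.support, c k * ι (v k) := by
  simp [contract, Finsupp.lsum_apply, Finsupp.sum]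

lemma hasDerivAt_evalU (Y : Matrix (Fin l) (Fin l) ℂ) (hY : star Y = -Y)
    (U : Matrix.unitaryGroup (Fin l) ℂ) (f : PowerSums) (t : ℝ) :
    HasDerivAt (fun s => evalU (unitaryExp Y hY s * U) f)
      (contract (evalU (unitaryExp Y hY t * U))
        (fun k => k * (Y * ((unitaryExp Y hY t * U) ^ k).1).trace) (grad f)) t := by
  induction f using induction_X with
  | one => simpa using hasDerivAt_const t (1 : ℂ)
  | add f g hf hg =>
    simp only [map_add]
    exact hf.add hg
  | smul r f hf =>
    rw [Derivation.map_smul, map_smul]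
    simp only [map_smul]
    exact hf.const_smul r
  | mul m f hf =>
    rw [contract_grad_X_mul]
    have h := (hasDerivAt_traceZPow Y hY U m t).mul hf
    simp only [map_mul, evalU_X]
    convert! h using 1
    ring

lemma continuous_traceZPow (k : ℤ) :
    Continuous fun U : Matrix.unitaryGroup (Fin l) ℂ => traceZPow U k := by
  have h : Continuous fun U : Matrix.unitaryGroup (Fin l) ℂ => (U ^ k).1 :=
    continuous_subtype_val.comp (continuous_zpow k)
  exact h.matrix_trace

lemma continuous_evalU (f : PowerSums) :
    Continuous fun U : Matrix.unitaryGroup (Fin l) ℂ => evalU U f := by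
  induction f using induction_X with
  | one => simpa using continuous_const
  | add f g hf hg => simp only [map_add]; fun_prop
  | smul r f hf => simp only [map_smul]; fun_prop
  | mul m f hf =>
    simp only [map_mul, evalU_X]
    exact (continuous_traceZPow m).mul hf

lemma integrable_haarU {F : Matrix.unitaryGroup (Fin l) ℂ → ℂ} (hF : Continuous F) :
    Integrable F (haarU l) :=
  hF.integrable_of_hasCompactSupport (HasCompactSupport.of_compactSpace _)

/-- The integral of a derivative along a one-parameter subgroup vanishes. -/
lemma integral_haarU_deriv_eq_zero (Y : Matrix (Fin l) (Fin l) ℂ) (hY : star Y = -Y)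
    {F F' : Matrix.unitaryGroup (Fin l) ℂ → ℂ} (hF : Continuous F) (hF' : Continuous F')
    (h : ∀ U t, HasDerivAt (fun s => F (unitaryExp Y hY s * U)) (F' (unitaryExp Y hY t * U)) t) :
    ∫ U, F' U ∂haarU l = 0 := by
  obtain ⟨C, hC⟩ : ∃ C, ∀ U, ‖F' U‖ ≤ C := by
    obtain ⟨C, hC⟩ := isCompact_univ.exists_bound_of_continuousOn hF'.continuousOn
    exact ⟨C, fun U => hC U (Set.mem_univ U)⟩
  have h1 := (hasDerivAt_integral_of_dominated_loc_of_deriv_le (μ := haarU l)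
    (F := fun (s : ℝ) U => F (unitaryExp Y hY s * U))
    (F' := fun s U => F' (unitaryExp Y hY s * U)) (x₀ := (0 : ℝ)) (bound := fun _ => C)
    Filter.univ_mem
    (Filter.Eventually.of_forall fun s =>
      (integrable_haarU (hF.comp (continuous_const_mul _))).aestronglyMeasurable)
    (integrable_haarU (hF.comp (continuous_const_mul _)))
    (integrable_haarU (hF'.comp (continuous_const_mul _))).aestronglyMeasurable
    (Filter.Eventually.of_forall fun U s _ => hC _) (integrable_const C)
    (Filter.Eventually.of_forall fun U s _ => h U s)).2
  simp only [integral_mul_left_eq_self] at h1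
  exact h1.unique (hasDerivAt_const _ _)

/-- The derivative of `(U ^ n) i j * f (U)` in the direction `Y U`. -/
def entryDeriv (n : ℕ) (f : PowerSums) (i j : Fin l) (Y : Matrix (Fin l) (Fin l) ℂ)
    (U : Matrix.unitaryGroup (Fin l) ℂ) : ℂ :=
  powDeriv Y U.1 n i j * evalU U f
    + (U.1 ^ n) i j * contract (evalU U) (fun k => k * (Y * (U ^ k).1).trace) (grad f)

lemma continuous_entryDeriv (n : ℕ) (f : PowerSums) (i j : Fin l)
    (Y : Matrix (Fin l) (Fin l) ℂ) : Continuous (entryDeriv n f i j Y) := by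
  have hU : Continuous fun U : Matrix.unitaryGroup (Fin l) ℂ => U.1 := continuous_subtype_val
  have hz : ∀ k : ℤ, Continuous fun U : Matrix.unitaryGroup (Fin l) ℂ => (U ^ k).1 :=
    fun k => continuous_subtype_val.comp (continuous_zpow k)
  have h1 : Continuous fun U : Matrix.unitaryGroup (Fin l) ℂ => powDeriv Y U.1 n := by
    unfold powDeriv
    exact continuous_finsetSum _ fun a _ => ((hU.pow a).mul continuous_const).mul (hU.pow (n - a))
  unfold entryDeriv
  simp only [contract_apply]
  refine ((h1.matrix_elem i j).mul (continuous_evalU f)).add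
    (((hU.pow n).matrix_elem i j).mul (continuous_finsetSum _ fun k _ =>
      (continuous_const.mul ?_).mul (continuous_evalU _)))
  exact (continuous_const.matrix_mul (hz k)).matrix_trace

lemma integral_entryDeriv_of_skew (n : ℕ) (f : PowerSums) (i j : Fin l)
    (Y : Matrix (Fin l) (Fin l) ℂ) (hY : star Y = -Y) :
    ∫ U, entryDeriv n f i j Y U ∂haarU l = 0 := by
  refine integral_haarU_deriv_eq_zero Y hY (F := fun U => (U.1 ^ n) i j * evalU U f) ?_
    (continuous_entryDeriv n f i j Y) fun U t =>
      (hasDerivAt_entry_pow Y hY U n i j t).mul (hasDerivAt_evalU Y hY U f t)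
  exact ((continuous_subtype_val.pow n).matrix_elem i j).mul (continuous_evalU f)

lemma entryDeriv_add_smul (n : ℕ) (f : PowerSums) (i j : Fin l)
    (Y Z : Matrix (Fin l) (Fin l) ℂ) (c : ℂ) (U : Matrix.unitaryGroup (Fin l) ℂ) :
    entryDeriv n f i j (Y + c • Z) U = entryDeriv n f i j Y U + c * entryDeriv n f i j Z U := by
  have h1 : powDeriv (Y + c • Z) U.1 n = powDeriv Y U.1 n + c • powDeriv Z U.1 n := by
    simp only [powDeriv, Finset.smul_sum, ← Finset.sum_add_distrib]
    refine Finset.sum_congr rfl fun a _ => ?_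
    rw [mul_add, add_mul, mul_smul_comm, smul_mul_assoc]
  have h2 : contract (evalU U) (fun k => k * ((Y + c • Z) * (U ^ k).1).trace) (grad f)
      = contract (evalU U) (fun k => k * (Y * (U ^ k).1).trace) (grad f)
        + c * contract (evalU U) (fun k => k * (Z * (U ^ k).1).trace) (grad f) := by
    simp only [contract_apply, Finset.mul_sum, ← Finset.sum_add_distrib]
    refine Finset.sum_congr rfl fun k _ => ?_
    rw [add_mul, smul_mul_assoc, Matrix.trace_add, Matrix.trace_smul, smul_eq_mul]
    ring
  rw [entryDeriv, h1, h2, entryDeriv, entryDeriv, Matrix.add_apply, Matrix.smul_apply, smul_eq_mul]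
  ring

/-- Every matrix is a complex combination of two skew-Hermitian ones. -/
lemma integral_entryDeriv (n : ℕ) (f : PowerSums) (i j : Fin l)
    (Y : Matrix (Fin l) (Fin l) ℂ) : ∫ U, entryDeriv n f i j Y U ∂haarU l = 0 := by
  have hA : star ((2⁻¹ : ℂ) • (Y - star Y)) = -((2⁻¹ : ℂ) • (Y - star Y)) := by
    rw [star_smul, star_sub, star_star, ← smul_neg, neg_sub]; simp
  have hB : star ((-Complex.I * 2⁻¹) • (Y + star Y)) = -((-Complex.I * 2⁻¹) • (Y + star Y)) := by
    rw [star_smul, star_add, star_star, ← neg_smul, add_comm (star Y)]; simp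
  have e : Y = (2⁻¹ : ℂ) • (Y - star Y) + Complex.I • ((-Complex.I * 2⁻¹) • (Y + star Y)) := by
    rw [smul_smul]
    have : Complex.I * (-Complex.I * 2⁻¹) = 2⁻¹ := by
      linear_combination (-2⁻¹ : ℂ) * Complex.I_mul_I
    rw [this, ← smul_add, sub_add_add_cancel, ← two_smul ℂ Y, smul_smul]; simp
  rw [e]
  simp only [entryDeriv_add_smul]
  rw [integral_add (integrable_haarU (continuous_entryDeriv _ _ _ _ _))
    ((integrable_haarU (continuous_entryDeriv _ _ _ _ _)).const_mul _), integral_const_mul,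
    integral_entryDeriv_of_skew n f i j _ hA, integral_entryDeriv_of_skew n f i j _ hB]
  simp

/-- Contracting the derivatives in the directions of the matrix units gives the loop equation. -/
lemma sum_entryDeriv (n : ℕ) (f : PowerSums) (U : Matrix.unitaryGroup (Fin l) ℂ) :
    ∑ i, ∑ j, entryDeriv (n + 1) f i j (Matrix.single i j 1) U
      = evalU U (divg ((n + 1 : ℕ) : ℤ) * f + shiftD ((n + 1 : ℕ) : ℤ) f) := by
  have hz : ∀ m : ℕ, (U.1 ^ m).trace = traceZPow U m := fun m => by
    rw [traceZPow, coe_zpow_natCast]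
  have h1 : ∑ i, ∑ j, powDeriv (Matrix.single i j 1) U.1 (n + 1) i j
      = evalU U (divg ((n + 1 : ℕ) : ℤ)) := by
    have e : ∀ i j : Fin l, ∀ A B : Matrix (Fin l) (Fin l) ℂ,
        (A * Matrix.single i j (1 : ℂ) * B : Matrix (Fin l) (Fin l) ℂ) i j = A i i * B j j := by
      intro i j A B
      rw [mul_assoc, Matrix.mul_apply, Finset.sum_eq_single i]
      · simp
      · intro k _ hk; rw [Matrix.single_mul_apply_of_ne _ _ _ _ _ hk, mul_zero]
      · intro h; exact absurd (Finset.mem_univ i) h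
    simp only [powDeriv, Matrix.sum_apply, e]
    rw [divg_natCast_succ, map_sum, ← Finset.sum_range_reflect,
      Finset.sum_congr rfl fun i _ => Finset.sum_comm, Finset.sum_comm]
    refine Finset.sum_congr rfl fun a ha => ?_
    have := Finset.mem_range.mp ha
    rw [map_mul, evalU_X, evalU_X, mul_comm, ← Finset.sum_mul_sum]
    have t : ∀ A : Matrix (Fin l) (Fin l) ℂ, ∑ i, A i i = A.trace := fun A => rfl
    rw [t, t, hz, hz]
    congr 2 <;> omega
  have h2 : ∑ i, ∑ j, (U.1 ^ (n + 1)) i j *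
        contract (evalU U) (fun k => k * (Matrix.single i j 1 * (U ^ k).1).trace) (grad f)
      = evalU U (shiftD ((n + 1 : ℕ) : ℤ) f) := by
    have h := contract_grad (AlgHom.id ℝ PowerSums) (shiftD ((n + 1 : ℕ) : ℤ)) f
    rw [AlgHom.id_apply] at h
    rw [← h]
    simp only [contract_apply, map_sum, map_mul, AlgHom.id_apply, shiftD_X, map_smul, evalU_X,
      Finset.mul_sum]
    rw [Finset.sum_congr rfl fun i _ => Finset.sum_comm, Finset.sum_comm]
    refine Finset.sum_congr rfl fun k _ => ?_
    have e : traceZPow U (k + ((n + 1 : ℕ) : ℤ))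
        = ∑ i, ∑ j, (U.1 ^ (n + 1)) i j * ((U ^ k).1) j i := by
      rw [traceZPow, add_comm, zpow_add, Submonoid.coe_mul, coe_zpow_natCast, Matrix.trace]
      simp only [Matrix.diag_apply, Matrix.mul_apply]
    rw [e, Complex.real_smul, Finset.mul_sum, Finset.sum_mul]
    refine Finset.sum_congr rfl fun i _ => ?_
    rw [Finset.mul_sum, Finset.sum_mul]
    refine Finset.sum_congr rfl fun j _ => ?_
    rw [Matrix.trace_single_mul]
    push_cast; ring
  simp only [entryDeriv, Finset.sum_add_distrib, ← Finset.sum_mul]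
  rw [h1, h2, map_add, map_mul]

/-- The Haar average of a polynomial in the power sums of the eigenvalues. -/
def haarAverage (l : ℕ) : PowerSums →ₗ[ℝ] ℂ where
  toFun f := ∫ U, evalU U f ∂haarU l
  map_add' f g := by
    simp only [map_add]
    exact integral_add (integrable_haarU (continuous_evalU f))
      (integrable_haarU (continuous_evalU g))
  map_smul' r f := by
    simp only [map_smul]
    exact integral_smul _ _

lemma haarAverage_apply (f : PowerSums) : haarAverage l f = ∫ U, evalU U f ∂haarU l := rfl

/-- Invariance of Haar measure under translations yields the loop equations. -/
lemma isLoop_haarAverage (l : ℕ) : IsLoop (haarAverage l) := by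
  refine isLoop_of_flip _ (fun n f => ?_) fun f hf => ?_
  · simp only [haarAverage_apply, ← sum_entryDeriv]
    rw [integral_finsetSum _ fun i _ => integrable_finsetSum _ fun j _ =>
      integrable_haarU (continuous_entryDeriv _ _ _ _ _)]
    refine Finset.sum_eq_zero fun i _ => ?_
    rw [integral_finsetSum _ fun j _ => integrable_haarU (continuous_entryDeriv _ _ _ _ _)]
    exact Finset.sum_eq_zero fun j _ => integral_entryDeriv _ _ _ _ _
  · rw [haarAverage_apply] at hf ⊢
    simp only [evalU_flip]
    rw [integral_conj, hf, map_zero]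

end PowerSums

end HaarAverage

/-! ### Traces of unitary matrices and Haar moments -/

section Diagonalization

-- In the operator norm matrices form a C⋆-algebra, where spectra of unitaries lie on the circle.
open scoped Matrix.Norms.L2Operator

variable {l : ℕ}

/-- The Hermitian and skew-Hermitian parts of a unitary matrix commute, so it has a basis of
eigenvectors. -/
lemma exists_eigenbasis_unitary (U : Matrix.unitaryGroup (Fin l) ℂ) :
    ∃ (b : Module.Basis (Fin l) ℂ (EuclideanSpace ℂ (Fin l))) (c : Fin l → ℂ),
      ∀ i, Matrix.toEuclideanLin U.1 (b i) = c i • b i := by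
  set T := Matrix.toEuclideanLin U.1 with hT
  have hU : star U.1 * U.1 = 1 := Matrix.mem_unitaryGroup_iff'.mp U.2
  have hU' : U.1 * star U.1 = 1 := Matrix.mem_unitaryGroup_iff.mp U.2
  have hA : (Matrix.toEuclideanLin (U.1 + star U.1)).IsSymmetric := by
    rw [Matrix.isSymmetric_toEuclideanLin_iff]
    change star (U.1 + star U.1) = _
    rw [star_add, star_star, add_comm]
  have hB : (Matrix.toEuclideanLin (Complex.I • (U.1 - star U.1))).IsSymmetric := by
    rw [Matrix.isSymmetric_toEuclideanLin_iff]
    change star (Complex.I • (U.1 - star U.1)) = _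
    rw [star_smul, star_sub, star_star, ← neg_sub U.1, smul_neg, ← neg_smul]
    simp
  have hAB : Commute (Matrix.toEuclideanLin (U.1 + star U.1))
      (Matrix.toEuclideanLin (Complex.I • (U.1 - star U.1))) := by
    have h : Commute (U.1 + star U.1) (Complex.I • (U.1 - star U.1)) := by
      refine Commute.smul_right ?_ _
      have hc : Commute U.1 (star U.1) := hU'.trans hU.symm
      exact ((Commute.refl U.1).add_left hc.symm).sub_right
        (hc.add_left (Commute.refl (star U.1)))
    exact h.map (Matrix.toLpLinAlgEquiv 2)
  have hspan := hA.iSup_iSup_eigenspace_inf_eigenspace_eq_top_of_commute hB hAB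
  have hs : ⊤ ≤ Submodule.span ℂ {v | ∃ c : ℂ, T v = c • v} := by
    rw [← hspan]
    refine iSup_le fun α => iSup_le fun β => fun v hv => Submodule.subset_span ?_
    obtain ⟨h1, h2⟩ := hv
    rw [SetLike.mem_coe, Module.End.mem_eigenspace_iff] at h1 h2
    refine ⟨2⁻¹ * (α - Complex.I * β), ?_⟩
    have e : U.1 = (2⁻¹ : ℂ) • ((U.1 + star U.1)
        - Complex.I • (Complex.I • (U.1 - star U.1))) := by
      rw [smul_smul, Complex.I_mul_I, neg_one_smul, sub_neg_eq_add, add_add_sub_cancel,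
        ← two_smul ℂ U.1, smul_smul]
      simp
    rw [hT, e, map_smul, map_sub, map_smul, LinearMap.smul_apply, LinearMap.sub_apply,
      LinearMap.smul_apply, h1, h2, smul_smul, ← sub_smul, smul_smul]
  let b := Module.Basis.ofSpan hs
  have hfin : Module.finrank ℂ (EuclideanSpace ℂ (Fin l)) = l := by simp
  have := FiniteDimensional.fintypeBasisIndex b
  let e := Fintype.equivFinOfCardEq ((Module.finrank_eq_card_basis b).symm.trans hfin)
  have hb : ∀ i, ∃ c : ℂ, T (b.reindex e i) = c • b.reindex e i := fun i => by
    rw [Module.Basis.reindex_apply]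
    exact Module.Basis.ofSpan_subset hs ⟨_, rfl⟩
  choose c hc using hb
  exact ⟨b.reindex e, c, hc⟩

/-- The traces of the powers of a unitary matrix are the power sums of points on the unit circle. -/
lemma exists_angles (U : Matrix.unitaryGroup (Fin l) ℂ) :
    ∃ θ : Fin l → ℝ, ∀ k : ℤ, traceZPow U k = ∑ j, Complex.exp (Complex.I * (k * θ j)) := by
  obtain ⟨b, c, hc⟩ := exists_eigenbasis_unitary U
  have hnorm : ∀ i, ‖c i‖ = 1 := fun i => by
    refine spectrum.norm_eq_one_of_unitary U.2 ?_
    rw [← Matrix.spectrum_toLpLin 2]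
    refine Module.End.HasEigenvalue.mem_spectrum
      (Module.End.hasEigenvalue_of_hasEigenvector (x := b i) ?_)
    exact ⟨Module.End.mem_eigenspace_iff.mpr (hc i), b.ne_zero i⟩
  have hexp : ∀ i, Complex.exp (Complex.I * Complex.arg (c i)) = c i := fun i => by
    have := Complex.norm_mul_exp_arg_mul_I (c i)
    rwa [hnorm, Complex.ofReal_one, one_mul, mul_comm] at this
  have hpow : ∀ (n : ℕ) i, Matrix.toEuclideanLin (U.1 ^ n) (b i) = c i ^ n • b i := fun n i => by
    rw [Matrix.toLpLin_pow]
    induction n with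
    | zero => simp
    | succ n ih => rw [pow_succ, Module.End.mul_apply, hc, map_smul, ih, smul_smul, pow_succ']
  have hnat : ∀ n : ℕ, traceZPow U n
      = ∑ j, Complex.exp (Complex.I * (n * Complex.arg (c j))) := fun n => by
    have h1 : (U.1 ^ n).trace = ∑ j, c j ^ n := by
      have h2 := LinearMap.trace_eq_matrix_trace ℂ b (Matrix.toEuclideanLin (U.1 ^ n))
      have h3 : LinearMap.trace ℂ (EuclideanSpace ℂ (Fin l)) (Matrix.toEuclideanLin (U.1 ^ n))
          = (U.1 ^ n).trace := by
        rw [show Matrix.toEuclideanLin (U.1 ^ n) = Matrix.toLin _ _ (U.1 ^ n) from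
          congrArg (fun f => f (U.1 ^ n)) (Matrix.toLpLin_eq_toLin 2 2), Matrix.trace_toLin_eq]
      rw [← h3, h2, Matrix.trace]
      refine Finset.sum_congr rfl fun i _ => ?_
      rw [Matrix.diag_apply, LinearMap.toMatrix_apply, hpow]
      simp
    rw [traceZPow, coe_zpow_natCast, h1]
    refine Finset.sum_congr rfl fun j _ => ?_
    rw [mul_left_comm, Complex.exp_nat_mul, hexp]
  refine ⟨fun j => Complex.arg (c j), fun k => ?_⟩
  obtain ⟨n, rfl | rfl⟩ := Int.eq_nat_or_neg k
  · simpa using hnat n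
  · rw [traceZPow_neg, hnat, map_sum]
    refine Finset.sum_congr rfl fun j _ => ?_
    rw [← Complex.exp_conj]
    simp

end Diagonalization

namespace PowerSums

open MvPolynomial

variable {l : ℕ}

lemma haarAverage_of_toLaurent_eq_zero {f : PowerSums} (hf : toLaurent l f = 0) :
    haarAverage l f = 0 := by
  rw [haarAverage_apply]
  refine integral_eq_zero_of_ae (Filter.Eventually.of_forall fun U => ?_)
  obtain ⟨θ, hθ⟩ := exists_angles U
  have e : evalU U = (Laurent.evalAt θ).comp (toLaurent l) := by
    refine MvPolynomial.algHom_ext fun k => ?_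
    rw [evalU_X, hθ, AlgHom.comp_apply, toLaurent_X, Laurent.evalAt_psum]
  change evalU U f = 0
  rw [e, AlgHom.comp_apply, hf, map_zero]

/-- The loop equations identify Haar averages with averages over the eigenvalue density. -/
lemma haarAverage_eq (f : PowerSums) :
    haarAverage l f = ((Laurent.weightedTerm (toLaurent l f) / (l ! : ℝ) : ℝ) : ℂ) := by
  have h := (isLoop_haarAverage l).eq_weightedTerm (fun _ => haarAverage_of_toLaurent_eq_zero) f
  have h1 : haarAverage l 1 = 1 := by simp [haarAverage_apply]
  have h2 : Laurent.weightedTerm (1 : Laurent l) = (l ! : ℝ) := by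
    have := weightedTerm_psum_add_pow (l := l) 0
    have h0 : (latticeWordPairs l 0).card = 1 := by
      classical
      rw [← card_lisLE, Finset.filter_true_of_mem]
      · simp
      · intro σ _ s _
        simp [Finset.eq_empty_of_isEmpty s]
    simpa [traceMoment, h0] using this
  have h3 : (l ! : ℂ) ≠ 0 := by exact_mod_cast (Nat.factorial_pos l).ne'
  rw [h1, h2, Complex.real_smul, Complex.real_smul, mul_one] at h
  push_cast at h ⊢
  rw [eq_div_iff h3, mul_comm, h]

end PowerSums

/-- The moments of `Tr (U + U†)` under Haar measure. -/
lemma integral_trace_pow (l n : ℕ) :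
    ∫ U : Matrix.unitaryGroup (Fin l) ℂ, Matrix.trace (U.1 + U.1.conjTranspose) ^ n ∂haarU l
      = traceMoment l n := by
  have h := PowerSums.haarAverage_eq (l := l)
    ((MvPolynomial.X 1 + MvPolynomial.X (-1)) ^ n)
  rw [map_pow (PowerSums.toLaurent l), map_add (PowerSums.toLaurent l), PowerSums.toLaurent_X,
    PowerSums.toLaurent_X,
    weightedTerm_psum_add_pow, mul_div_cancel_left₀ _ (by positivity),
    PowerSums.haarAverage_apply] at h
  rw [← h]
  refine integral_congr_ae (Filter.Eventually.of_forall fun U => ?_)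
  simp only [map_pow, map_add, PowerSums.evalU_X]
  rw [traceZPow_neg, traceZPow, zpow_one, Matrix.trace_add, Matrix.trace_conjTranspose]
  rfl

/-- The exponential generating function of the numbers `traceMoment l n`. -/
lemma hasSum_unitaryAverage_exp (l : ℕ) (lam : ℝ) :
    HasSum (fun n : ℕ => ((lam ^ n / (n ! : ℝ) * traceMoment l n : ℝ) : ℂ))
      (unitaryAverage l fun U => Complex.exp ((lam : ℂ) * Matrix.trace (U + U.conjTranspose))) := by
  have hc : Continuous fun U : Matrix.unitaryGroup (Fin l) ℂ =>
      (lam : ℂ) * Matrix.trace (U.1 + U.1.conjTranspose) := by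
    have hU : Continuous fun U : Matrix.unitaryGroup (Fin l) ℂ => U.1 := continuous_subtype_val
    exact continuous_const.mul (hU.add hU.matrix_conjTranspose).matrix_trace
  obtain ⟨C, hC⟩ := isCompact_univ.exists_bound_of_continuousOn hc.continuousOn
  have h := hasSum_integral_exp (μ := haarU l) hc.aestronglyMeasurable
    (fun U => hC U (Set.mem_univ U)) (integrable_const (1 : ℂ))
  simp only [mul_one, mul_pow, integral_const_mul, integral_trace_pow] at h
  convert! h using 2 with n
  push_cast; ring

lemma hasSum_eigenvalueAverage_exp (l : ℕ) (lam : ℝ) :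
    HasSum (fun n : ℕ => lam ^ n / (n ! : ℝ) * traceMoment l n)
      (eigenvalueAverage l fun θ => Real.exp (lam * ∑ j, 2 * Real.cos (θ j))) := by
  have hX : Continuous fun θ : Fin l → ℝ => ((lam * ∑ j, 2 * Real.cos (θ j) : ℝ) : ℂ) := by
    fun_prop
  have hg : Continuous fun θ : Fin l → ℝ => ((eigenvalueDensity l θ : ℝ) : ℂ) := by
    unfold eigenvalueDensity
    fun_prop
  have hM : ∀ θ : Fin l → ℝ, ‖((lam * ∑ j, 2 * Real.cos (θ j) : ℝ) : ℂ)‖ ≤ |lam| * (l * 2) := by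
    intro θ
    rw [Complex.norm_real, Real.norm_eq_abs, abs_mul]
    gcongr
    refine (Finset.abs_sum_le_sum_abs _ _).trans ?_
    have : ∀ j ∈ Finset.univ, |2 * Real.cos (θ j)| ≤ 2 := fun j _ => by
      rw [abs_mul, abs_two]
      linarith [Real.abs_cos_le_one (θ j)]
    simpa using Finset.sum_le_card_nsmul _ _ _ this
  have h := hasSum_integral_exp
    (μ := volume.restrict (Set.univ.pi fun _ : Fin l => Set.Ioo (-Real.pi) Real.pi))
    hX.aestronglyMeasurable hM
    ((hg.continuousOn.integrableOn_compact
      (K := Set.univ.pi fun _ : Fin l => Set.Icc (-Real.pi) Real.pi)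
      (isCompact_univ_pi fun _ => isCompact_Icc)).mono_set
      (Set.pi_mono fun _ _ => Set.Ioo_subset_Icc_self))
  simp only [← Complex.ofReal_exp, ← Complex.ofReal_pow, ← Complex.ofReal_mul,
    integral_complex_ofReal] at h
  rw [← Complex.hasSum_ofReal]
  convert! h using 2 with n
  have hm := eigenvalueAverage_cos_pow l n
  unfold eigenvalueAverage at hm
  rw [← hm]
  simp only [mul_pow, mul_assoc, integral_const_mul]
  push_cast; ring

/-! ### Up/right paths through grid configurations -/

lemma UpRight.trans {p q r : ℝ × ℝ} (h : UpRight p q) (h' : UpRight q r) : UpRight p r :=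
  ⟨h.1.trans h'.1, h.2.trans h'.2⟩

instance : IsTrans (ℝ × ℝ) UpRight := ⟨fun _ _ _ => UpRight.trans⟩

/-- For points whose relative position is that of the graph of a permutation, the up/right paths
are the increasing subsequences. -/
lemma maxPathLength_range_le_iff {N l : ℕ} {q : Fin N → ℝ × ℝ} {σ : Equiv.Perm (Fin N)}
    (h0 : ∀ i, UpRight (0, 0) (q i)) (h1 : ∀ i, UpRight (q i) (1, 1))
    (h : ∀ i j, UpRight (q i) (q j) ↔ i < j ∧ σ i < σ j) :
    maxPathLength (Set.range q) ≤ l ↔ LisLE σ l := by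
  simp only [maxPathLength, iSup_le_iff, Nat.cast_le]
  constructor
  · intro H s hs
    have hlen := H ((s.sort (· ≤ ·)).map q) ⟨?_, ?_⟩
    · simpa using hlen
    · intro p hp
      obtain ⟨i, -, rfl⟩ := List.mem_map.mp hp
      exact ⟨i, rfl⟩
    · refine List.Pairwise.isChain ?_
      rw [List.pairwise_cons, List.pairwise_append]
      refine ⟨?_, ?_, List.pairwise_singleton _ _, ?_⟩
      · intro p hp
        rcases List.mem_append.mp hp with hp | hp
        · obtain ⟨i, -, rfl⟩ := List.mem_map.mp hp
          exact h0 i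
        · rw [List.mem_singleton.mp hp]; exact ⟨one_pos, one_pos⟩
      · rw [List.pairwise_map]
        refine List.Pairwise.imp_of_mem ?_ (s.sortedLT_sort).pairwise
        intro i j hi hj hij
        exact (h i j).mpr ⟨hij, hs (by simpa using hi) (by simpa using hj) hij⟩
      · intro p hp r hr
        obtain ⟨i, -, rfl⟩ := List.mem_map.mp hp
        rw [List.mem_singleton.mp hr]; exact h1 i
  · rintro H L ⟨hL, hchain⟩
    obtain ⟨K, rfl⟩ : L ∈ Set.range (List.map q) := by
      rw [Set.range_list_map]; exact hL
    have hp := List.isChain_iff_pairwise.mp hchain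
    rw [List.pairwise_cons, List.pairwise_append, List.pairwise_map] at hp
    have hK : K.Pairwise fun i j => i < j ∧ σ i < σ j := hp.2.1.imp fun hij => (h _ _).mp hij
    have hnd : K.Nodup := hK.imp fun hij => hij.1.ne
    have hs : StrictMonoOn σ (K.toFinset : Set (Fin N)) := by
      intro i hi j hj hij
      have hK' : K.Pairwise fun i j => (i < j → σ i < σ j) ∧ (j < i → σ j < σ i) :=
        hK.imp fun hij => ⟨fun _ => hij.2, fun h' => absurd h' hij.1.asymm⟩
      have : Std.Symm fun i j => (i < j → σ i < σ j) ∧ (j < i → σ j < σ i) :=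
        ⟨fun _ _ h => ⟨h.2, h.1⟩⟩
      exact (hK'.forall (by simpa using hi) (by simpa using hj) hij.ne).1 hij
    have := H K.toFinset hs
    rwa [List.toFinset_card_of_nodup hnd, ← List.length_map q] at this

/-- An open cell of the grid of mesh `1 / n` in the unit square. -/
def gridCell {n : ℕ} (a b : Fin n) : Set (ℝ × ℝ) :=
  Set.Ioo ((a : ℝ) / n) ((a + 1 : ℝ) / n) ×ˢ Set.Ioo ((b : ℝ) / n) ((b + 1 : ℝ) / n)

lemma measurableSet_gridCell {n : ℕ} (a b : Fin n) : MeasurableSet (gridCell a b) :=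
  measurableSet_Ioo.prod measurableSet_Ioo

lemma lt_of_mem_grid {n : ℕ} {a b : Fin n} (hab : a < b) {x y : ℝ}
    (hx : x ∈ Set.Ioo ((a : ℝ) / n) ((a + 1 : ℝ) / n))
    (hy : y ∈ Set.Ioo ((b : ℝ) / n) ((b + 1 : ℝ) / n)) : x < y := by
  refine hx.2.trans_le (le_trans ?_ hy.1.le)
  have : (a : ℝ) + 1 ≤ b := by exact_mod_cast Fin.lt_def.mp hab
  gcongr

lemma eq_of_mem_grid {n : ℕ} {a b : Fin n} {x : ℝ}
    (hx : x ∈ Set.Ioo ((a : ℝ) / n) ((a + 1 : ℝ) / n))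
    (hy : x ∈ Set.Ioo ((b : ℝ) / n) ((b + 1 : ℝ) / n)) : a = b := by
  rcases lt_trichotomy a b with h | h | h
  · exact absurd (lt_of_mem_grid h hx hy) (lt_irrefl x)
  · exact h
  · exact absurd (lt_of_mem_grid h hy hx) (lt_irrefl x)

lemma pos_lt_one_of_mem_grid {n : ℕ} {a : Fin n} {x : ℝ}
    (hx : x ∈ Set.Ioo ((a : ℝ) / n) ((a + 1 : ℝ) / n)) : 0 < x ∧ x < 1 := by
  refine ⟨lt_of_le_of_lt (by positivity) hx.1, hx.2.trans_le ?_⟩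
  have hn : (0 : ℝ) < n := by exact_mod_cast a.pos
  rw [div_le_one hn]
  exact_mod_cast a.2

/-- A choice of `N` columns and `N` rows of the grid, and of a permutation matching them. -/
abbrev Placement (n N : ℕ) : Type :=
  {s : Finset (Fin n) // s.card = N} × {s : Finset (Fin n) // s.card = N} × Equiv.Perm (Fin N)

namespace Placement

variable {n N : ℕ}

/-- The `i`-th chosen column. -/
def col (p : Placement n N) : Fin N ↪o Fin n := p.1.1.orderEmbOfFin p.1.2

/-- The `i`-th chosen row. -/
def row (p : Placement n N) : Fin N ↪o Fin n := p.2.1.1.orderEmbOfFin p.2.1.2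

/-- The permutation matching columns with rows. -/
def perm (p : Placement n N) : Equiv.Perm (Fin N) := p.2.2

/-- The cell in the `i`-th chosen column. -/
def cell (p : Placement n N) (i : Fin N) : Set (ℝ × ℝ) := gridCell (p.col i) (p.row (p.perm i))

/-- The configuration has exactly one point in each of the chosen cells, and no other points. -/
def Occupied (p : Placement n N) (S : Set (ℝ × ℝ)) : Prop :=
  (∀ i, (S ∩ p.cell i).encard = 1) ∧ (S ∩ (⋃ i, p.cell i)ᶜ).encard = 0

lemma Occupied.exists_eq_range {p : Placement n N} {S : Set (ℝ × ℝ)} (h : p.Occupied S) :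
    ∃ q : Fin N → ℝ × ℝ, S = Set.range q ∧ ∀ i, q i ∈ p.cell i := by
  have h1 : ∀ i, ∃ x, S ∩ p.cell i = {x} := fun i => Set.encard_eq_one.mp (h.1 i)
  choose q hq using h1
  have hmem : ∀ i, q i ∈ S ∩ p.cell i := fun i => by rw [hq i]; rfl
  refine ⟨q, Set.Subset.antisymm (fun x hx => ?_) ?_, fun i => (hmem i).2⟩
  · have h2 := Set.encard_eq_zero.mp h.2
    have hx' : x ∈ ⋃ i, p.cell i := by
      by_contra hc
      exact (Set.mem_empty_iff_false x).mp (h2 ▸ ⟨hx, hc⟩)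
    obtain ⟨i, hi⟩ := Set.mem_iUnion.mp hx'
    have : x ∈ S ∩ p.cell i := ⟨hx, hi⟩
    rw [hq i] at this
    exact ⟨i, this.symm⟩
  · rintro _ ⟨i, rfl⟩
    exact (hmem i).1

lemma upRight_iff {p : Placement n N} {q : Fin N → ℝ × ℝ} (hq : ∀ i, q i ∈ p.cell i)
    (i j : Fin N) : UpRight (q i) (q j) ↔ i < j ∧ p.perm i < p.perm j := by
  constructor
  · rintro ⟨h1, h2⟩
    constructor
    · by_contra hc
      rcases (not_lt.mp hc).eq_or_lt with rfl | hc
      · exact lt_irrefl _ h1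
      · exact lt_asymm h1 (lt_of_mem_grid (p.col.strictMono hc) (hq j).1 (hq i).1)
    · by_contra hc
      rcases (not_lt.mp hc).eq_or_lt with hc | hc
      · rw [p.perm.injective hc] at h2
        exact lt_irrefl _ h2
      · exact lt_asymm h2 (lt_of_mem_grid (p.row.strictMono hc) (hq j).2 (hq i).2)
  · rintro ⟨h1, h2⟩
    exact ⟨lt_of_mem_grid (p.col.strictMono h1) (hq i).1 (hq j).1,
      lt_of_mem_grid (p.row.strictMono h2) (hq i).2 (hq j).2⟩

lemma Occupied.maxPathLength_le_iff {p : Placement n N} {S : Set (ℝ × ℝ)} (h : p.Occupied S)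
    (l : ℕ) : maxPathLength S ≤ l ↔ LisLE p.perm l := by
  obtain ⟨q, rfl, hq⟩ := h.exists_eq_range
  exact maxPathLength_range_le_iff
    (fun i => ⟨(pos_lt_one_of_mem_grid (hq i).1).1, (pos_lt_one_of_mem_grid (hq i).2).1⟩)
    (fun i => ⟨(pos_lt_one_of_mem_grid (hq i).1).2, (pos_lt_one_of_mem_grid (hq i).2).2⟩)
    (upRight_iff hq)

lemma cell_disjoint (p : Placement n N) : Pairwise fun i j => Disjoint (p.cell i) (p.cell j) := by
  intro i j hij
  rw [Set.disjoint_left]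
  intro x hi hj
  exact hij (p.col.injective (eq_of_mem_grid hi.1 hj.1))

lemma Occupied.encard_eq {p : Placement n N} {S : Set (ℝ × ℝ)} (h : p.Occupied S) :
    S.encard = N := by
  obtain ⟨q, rfl, hq⟩ := h.exists_eq_range
  have hinj : Function.Injective q := fun i j hij => by
    by_contra hne
    exact Set.disjoint_left.mp (p.cell_disjoint hne) (hq i) (hij ▸ hq j)
  rw [← Set.image_univ, hinj.encard_image]
  simp

/-- The occupied cells determine the columns, the rows and the permutation. -/
lemma Occupied.unique {p p' : Placement n N} {S : Set (ℝ × ℝ)} (h : p.Occupied S)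
    (h' : p'.Occupied S) : p = p' := by
  have key : ∀ {p p' : Placement n N}, p.Occupied S → p'.Occupied S → ∀ i, ∃ j,
      p'.col j = p.col i ∧ p'.row (p'.perm j) = p.row (p.perm i) := by
    intro p p' h h' i
    obtain ⟨q, hS, hq⟩ := h.exists_eq_range
    obtain ⟨q', hS', hq'⟩ := h'.exists_eq_range
    obtain ⟨j, hj⟩ : q i ∈ Set.range q' := by rw [← hS', hS]; exact ⟨i, rfl⟩
    have := hq' j
    rw [hj] at this
    exact ⟨j, eq_of_mem_grid this.1 (hq i).1, eq_of_mem_grid this.2 (hq i).2⟩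
  have hcol : ∀ {p p' : Placement n N}, p.Occupied S → p'.Occupied S → p.1.1 ⊆ p'.1.1 := by
    intro p p' h h' a ha
    obtain ⟨i, rfl⟩ : a ∈ Set.range p.col := by
      rw [col, Finset.range_orderEmbOfFin]; exact ha
    obtain ⟨j, hj, -⟩ := key h h' i
    rw [← hj]
    exact Finset.orderEmbOfFin_mem _ _ _
  have hrow : ∀ {p p' : Placement n N}, p.Occupied S → p'.Occupied S → p.2.1.1 ⊆ p'.2.1.1 := by
    intro p p' h h' a ha
    obtain ⟨i, rfl⟩ : a ∈ Set.range p.row := by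
      rw [row, Finset.range_orderEmbOfFin]; exact ha
    obtain ⟨j, -, hj⟩ := key h h' (p.perm.symm i)
    rw [Equiv.apply_symm_apply] at hj
    rw [← hj]
    exact Finset.orderEmbOfFin_mem _ _ _
  obtain ⟨C, R, σ⟩ := p
  obtain ⟨C', R', σ'⟩ := p'
  obtain rfl : C = C' := Subtype.ext ((hcol h h').antisymm (hcol h' h))
  obtain rfl : R = R' := Subtype.ext ((hrow h h').antisymm (hrow h' h))
  obtain rfl : σ = σ' := by
    refine Equiv.ext fun i => ?_
    obtain ⟨j, hj1, hj2⟩ := key h h' i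
    obtain rfl : j = i := (Finset.orderEmbOfFin _ _).injective hj1
    exact ((Finset.orderEmbOfFin _ _).injective hj2).symm
  rfl

lemma card_filter_perm (n N : ℕ) (Q : Equiv.Perm (Fin N) → Prop) [DecidablePred Q]
    [DecidablePred fun p : Placement n N => Q p.perm] :
    (Finset.univ.filter fun p : Placement n N => Q p.perm).card
      = n.choose N ^ 2 * (Finset.univ.filter Q).card := by
  have e : (Finset.univ.filter fun p : Placement n N => Q p.perm)
      = Finset.univ ×ˢ (Finset.univ ×ˢ Finset.univ.filter Q) := by
    ext p
    simp only [Finset.mem_filter, Finset.mem_product, Finset.mem_univ, true_and]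
    rfl
  rw [e, Finset.card_product, Finset.card_product, Finset.card_univ, Fintype.card_finset_len,
    Fintype.card_fin]
  ring

end Placement

/-! ### Discretizing the Poisson process -/

namespace IsPoissonProcess

variable {Ω E : Type*} [MeasurableSpace Ω] [MeasurableSpace E] {Pts : Ω → Set E} {ρ : Measure E}
  {P : Measure Ω}

lemma measure_count_eq (h : IsPoissonProcess Pts ρ P) [IsFiniteMeasure ρ] {B : Set E}
    (hB : MeasurableSet B) (k : ℕ) :
    P {ω | (Pts ω ∩ B).encard = k}
      = ENNReal.ofReal (Real.exp (-ρ.real B) * ρ.real B ^ k / (k ! : ℝ)) := by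
  rw [h.law_count B hB (measure_ne_top ρ B), poissonMeasure_singleton]
  rfl

lemma measurableSet_count_eq (h : IsPoissonProcess Pts ρ P) {B : Set E}
    (hB : MeasurableSet B) (k : ℕ∞) : MeasurableSet {ω | (Pts ω ∩ B).encard = k} :=
  h.measurable_count B hB (measurableSet_singleton k)

lemma measurableSet_one_each (h : IsPoissonProcess Pts ρ P) {N : ℕ} {D : Fin N → Set E}
    (hD : ∀ i, MeasurableSet (D i)) :
    MeasurableSet {ω | (∀ i, (Pts ω ∩ D i).encard = 1) ∧ (Pts ω ∩ (⋃ i, D i)ᶜ).encard = 0} := by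
  refine MeasurableSet.inter ?_
    (h.measurableSet_count_eq (MeasurableSet.iUnion hD).compl 0)
  have e : {ω | ∀ i, (Pts ω ∩ D i).encard = 1} = ⋂ i, {ω | (Pts ω ∩ D i).encard = 1} := by
    ext ω; simp
  change MeasurableSet {ω | ∀ i, (Pts ω ∩ D i).encard = 1}
  rw [e]
  exact MeasurableSet.iInter fun i => h.measurableSet_count_eq (hD i) 1

/-- The probability that each of finitely many disjoint sets contains exactly one point and that
there are no other points. -/
lemma measure_one_each (h : IsPoissonProcess Pts ρ P) [IsFiniteMeasure ρ] {N : ℕ}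
    {D : Fin N → Set E} (hD : ∀ i, MeasurableSet (D i))
    (hdisj : Pairwise fun i j => Disjoint (D i) (D j)) :
    P {ω | (∀ i, (Pts ω ∩ D i).encard = 1) ∧ (Pts ω ∩ (⋃ i, D i)ᶜ).encard = 0}
      = ENNReal.ofReal (Real.exp (-ρ.real Set.univ) * ∏ i, ρ.real (D i)) := by
  have hU : MeasurableSet (⋃ i, D i) := MeasurableSet.iUnion hD
  let B : Fin (N + 1) → Set E := Fin.cons (⋃ i, D i)ᶜ D
  let k : Fin (N + 1) → ℕ := Fin.cons 0 fun _ => 1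
  have hB : ∀ j, MeasurableSet (B j) := Fin.cases hU.compl hD
  have hBd : Pairwise fun i j => Disjoint (B i) (B j) := by
    have h0 : ∀ j, Disjoint (⋃ i, D i)ᶜ (D j) := fun j =>
      disjoint_compl_left.mono_right (Set.subset_iUnion D j)
    intro i j
    refine Fin.cases ?_ (fun i => ?_) i <;> refine Fin.cases ?_ (fun j => ?_) j
    · exact fun h => absurd rfl h
    · exact fun _ => h0 j
    · exact fun _ => (h0 i).symm
    · exact fun hij => hdisj fun e => hij (congrArg Fin.succ e)
  have hind := (h.indep_count (N + 1) B hB hBd).measure_inter_preimage_eq_mul Finset.univ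
    (sets := fun j => {(k j : ℕ∞)}) fun _ _ => measurableSet_singleton _
  have e : {ω | (∀ i, (Pts ω ∩ D i).encard = 1) ∧ (Pts ω ∩ (⋃ i, D i)ᶜ).encard = 0}
      = ⋂ j ∈ Finset.univ, (fun ω => (Pts ω ∩ B j).encard) ⁻¹' {(k j : ℕ∞)} := by
    ext ω
    simp [Fin.forall_fin_succ, B, k, and_comm]
  have hcount : ∀ j, P ((fun ω => (Pts ω ∩ B j).encard) ⁻¹' {(k j : ℕ∞)})
      = ENNReal.ofReal (Real.exp (-ρ.real (B j)) * ρ.real (B j) ^ k j / ((k j)! : ℝ)) :=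
    fun j => h.measure_count_eq (hB j) (k j)
  rw [e, hind, Finset.prod_congr rfl fun j _ => hcount j,
    ← ENNReal.ofReal_prod_of_nonneg fun j _ => by positivity, Fin.prod_univ_succ]
  congr 1
  have hρ : ρ.real Set.univ = ρ.real (⋃ i, D i)ᶜ + ∑ i, ρ.real (D i) := by
    rw [measureReal_compl hU, measureReal_iUnion_fintype hdisj hD]
    ring
  rw [hρ]
  simp [B, k, Finset.prod_mul_distrib, Real.exp_add, ← Real.exp_sum, mul_assoc]
  ring

end IsPoissonProcess

instance isFiniteMeasure_intensity (lam : ℝ) : IsFiniteMeasure (intensity lam) := by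
  have : IsFiniteMeasure ((volume : Measure (ℝ × ℝ)).restrict unitSquare) := by
    refine isFiniteMeasure_restrict.mpr ?_
    exact ((isCompact_Icc (a := (0 : ℝ)) (b := 1)).prod isCompact_Icc).measure_ne_top
  exact Measure.smul_finite _ ENNReal.ofReal_ne_top

lemma intensity_univ (lam : ℝ) : (intensity lam).real Set.univ = lam ^ 2 := by
  rw [intensity, measureReal_ennreal_smul_apply, measureReal_restrict_apply_univ, unitSquare,
    Measure.volume_eq_prod, measureReal_prod_prod]
  simp [ENNReal.toReal_ofReal (sq_nonneg lam)]

lemma intensity_gridCell (lam : ℝ) {n : ℕ} (a b : Fin n) :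
    (intensity lam).real (gridCell a b) = lam ^ 2 / (n : ℝ) ^ 2 := by
  have hsub : gridCell a b ⊆ unitSquare := fun x hx =>
    ⟨⟨(pos_lt_one_of_mem_grid hx.1).1.le, (pos_lt_one_of_mem_grid hx.1).2.le⟩,
      ⟨(pos_lt_one_of_mem_grid hx.2).1.le, (pos_lt_one_of_mem_grid hx.2).2.le⟩⟩
  have hn : (0 : ℝ) < n := by exact_mod_cast a.pos
  have hlen : ∀ c : Fin n, (volume : Measure ℝ).real (Set.Ioo ((c : ℝ) / n) ((c + 1 : ℝ) / n))
      = 1 / n := fun c => by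
    rw [Real.volume_real_Ioo_of_le (by gcongr; linarith)]
    field_simp
    ring
  rw [intensity, measureReal_ennreal_smul_apply,
    measureReal_restrict_apply (measurableSet_gridCell a b), Set.inter_eq_left.mpr hsub, gridCell,
    Measure.volume_eq_prod, measureReal_prod_prod, hlen, hlen,
    ENNReal.toReal_ofReal (sq_nonneg lam)]
  field_simp

/-- Some placement whose permutation satisfies `Q` is occupied. -/
def occupiedEvent {Ω : Type*} (Pts : Ω → Set (ℝ × ℝ)) (n N : ℕ)
    (Q : Equiv.Perm (Fin N) → Prop) : Set Ω :=
  {ω | ∃ p : Placement n N, Q p.perm ∧ p.Occupied (Pts ω)}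

open Classical in
lemma occupiedEvent_eq {Ω : Type*} {Pts : Ω → Set (ℝ × ℝ)} (n N : ℕ)
    (Q : Equiv.Perm (Fin N) → Prop) :
    occupiedEvent Pts n N Q = ⋃ p ∈ Finset.univ.filter fun p : Placement n N => Q p.perm,
      {ω | p.Occupied (Pts ω)} := by
  ext ω
  simp only [occupiedEvent, Set.mem_ofPred_eq, Set.mem_iUnion, Finset.mem_filter, Finset.mem_univ,
    true_and, exists_prop]

section Limit

open Filter Topology

variable {Ω : Type*} [MeasurableSpace Ω] {P : Measure Ω} {lam : ℝ}
  {Pts : Ω → Set (ℝ × ℝ)}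

lemma measureReal_occupied (hPts : IsPoissonProcess Pts (intensity lam) P) {n N : ℕ}
    (p : Placement n N) :
    P.real {ω | p.Occupied (Pts ω)} = Real.exp (-lam ^ 2) * (lam ^ 2 / (n : ℝ) ^ 2) ^ N := by
  have h := hPts.measure_one_each (D := p.cell) (fun i => measurableSet_gridCell _ _)
    p.cell_disjoint
  have e : ∏ i, (intensity lam).real (p.cell i) = (lam ^ 2 / (n : ℝ) ^ 2) ^ N := by
    simp only [Placement.cell, intensity_gridCell, Finset.prod_const, Finset.card_univ,
      Fintype.card_fin]
  rw [e, intensity_univ] at h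
  rw [measureReal_def]
  refine (congrArg ENNReal.toReal h).trans (ENNReal.toReal_ofReal (by positivity))

lemma measurableSet_occupied (hPts : IsPoissonProcess Pts (intensity lam) P) {n N : ℕ}
    (p : Placement n N) : MeasurableSet {ω | p.Occupied (Pts ω)} :=
  hPts.measurableSet_one_each fun _ => measurableSet_gridCell _ _

lemma measurableSet_occupiedEvent (hPts : IsPoissonProcess Pts (intensity lam) P) (n N : ℕ)
    (Q : Equiv.Perm (Fin N) → Prop) : MeasurableSet (occupiedEvent Pts n N Q) := by
  rw [occupiedEvent_eq]
  exact Finset.measurableSet_biUnion _ fun p _ => measurableSet_occupied hPts p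

/-- In the limit of a fine grid, the permutation of the points is uniformly distributed. -/
lemma tendsto_measureReal_occupiedEvent [IsProbabilityMeasure P]
    (hPts : IsPoissonProcess Pts (intensity lam) P) (N : ℕ)
    (Q : Equiv.Perm (Fin N) → Prop) [DecidablePred Q] :
    Tendsto (fun n => P.real (occupiedEvent Pts n N Q)) atTop
      (𝓝 (Real.exp (-lam ^ 2) * lam ^ (2 * N) / (N ! : ℝ) ^ 2 * (Finset.univ.filter Q).card)) := by
  have h1 : ∀ n : ℕ, P.real (occupiedEvent Pts n N Q)
      = Real.exp (-lam ^ 2) * lam ^ (2 * N) * (Finset.univ.filter Q).card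
        * ((n.choose N : ℝ) / (n : ℝ) ^ N) ^ 2 := by
    intro n
    classical
    rw [occupiedEvent_eq, measureReal_biUnion_finset]
    · rw [Finset.sum_congr rfl fun p _ => measureReal_occupied hPts p, Finset.sum_const,
        Placement.card_filter_perm, nsmul_eq_mul]
      push_cast
      rw [div_pow, div_pow, ← pow_mul, ← pow_mul, ← pow_mul, mul_comm N 2]
      ring
    · intro p _ p' _ hne
      exact Set.disjoint_left.mpr fun ω hω hω' => hne (hω.unique hω')
    · exact fun p _ => measurableSet_occupied hPts p
  have h2 : Tendsto (fun n : ℕ => (n.choose N : ℝ) / (n : ℝ) ^ N) atTop (𝓝 (1 / (N ! : ℝ))) := by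
    have h3 := (isEquivalent_choose N).div
      (Asymptotics.IsEquivalent.refl (u := fun n : ℕ => (n : ℝ) ^ N))
    refine h3.symm.tendsto_nhds (tendsto_const_nhds.congr' ?_)
    filter_upwards [eventually_gt_atTop 0] with n hn
    have : (n : ℝ) ≠ 0 := by positivity
    simp only [Pi.div_apply]
    field_simp
  simp only [h1]
  convert (h2.pow 2).const_mul
    (Real.exp (-lam ^ 2) * lam ^ (2 * N) * (Finset.univ.filter Q).card) using 2
  field_simp

lemma measureReal_encard_eq (hPts : IsPoissonProcess Pts (intensity lam) P) (N : ℕ) :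
    P.real {ω | (Pts ω).encard = N} = Real.exp (-lam ^ 2) * lam ^ (2 * N) / (N ! : ℝ) := by
  have h := hPts.measure_count_eq MeasurableSet.univ N
  simp only [Set.inter_univ] at h
  rw [measureReal_def, h, ENNReal.toReal_ofReal (by positivity), intensity_univ, pow_mul]

lemma measurableSet_encard_eq (hPts : IsPoissonProcess Pts (intensity lam) P) (N : ℕ∞) :
    MeasurableSet {ω | (Pts ω).encard = N} := by
  simpa only [Set.inter_univ] using hPts.measurableSet_count_eq MeasurableSet.univ N

/-- The joint law of the number of points and of the event that the up/right paths have length at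
most `l`; the latter event is not assumed to be measurable. -/
lemma measureReal_encard_eq_inter [IsProbabilityMeasure P]
    (hPts : IsPoissonProcess Pts (intensity lam) P) (N l : ℕ) :
    P.real ({ω | (Pts ω).encard = N} ∩ {ω | maxPathLength (Pts ω) ≤ l})
      = Real.exp (-lam ^ 2) * lam ^ (2 * N) / (N ! : ℝ) ^ 2 * (latticeWordPairs l N).card := by
  classical
  have hgood := tendsto_measureReal_occupiedEvent hPts N fun σ => LisLE σ l
  have hbad := tendsto_measureReal_occupiedEvent hPts N fun σ => ¬ LisLE σ l
  have hcard : ((Finset.univ.filter fun σ : Equiv.Perm (Fin N) => ¬ LisLE σ l).card : ℝ)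
      = (N ! : ℝ) - (latticeWordPairs l N).card := by
    have := Finset.card_filter_add_card_filter_not (s := Finset.univ)
      (fun σ : Equiv.Perm (Fin N) => LisLE σ l)
    rw [Finset.card_univ, Fintype.card_perm, Fintype.card_fin] at this
    rw [← card_lisLE, eq_sub_iff_add_eq, add_comm]
    convert! congrArg (Nat.cast : ℕ → ℝ) this
    push_cast
    rfl
  -- the good placements bound the probability from below, the bad ones from above
  refine le_antisymm ?_ ?_
  · have h1 := (tendsto_const_nhds (x := P.real {ω | (Pts ω).encard = N})).sub hbad
    rw [hcard, measureReal_encard_eq hPts] at h1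
    convert ge_of_tendsto' h1 fun n => ?_ using 1
    · field_simp
      ring
    have hsub : occupiedEvent Pts n N (fun σ => ¬ LisLE σ l) ⊆ {ω | (Pts ω).encard = N} :=
      fun ω ⟨p, _, hω⟩ => hω.encard_eq
    rw [← measureReal_encard_eq hPts, ← measureReal_sdiff hsub
      (measurableSet_occupiedEvent hPts _ _ _)]
    refine measureReal_mono ?_
    rintro ω ⟨h1, h2⟩
    exact ⟨h1, fun ⟨p, hp, hω⟩ => hp ((hω.maxPathLength_le_iff l).mp h2)⟩
  · rw [← card_lisLE]
    convert le_of_tendsto' hgood fun n => ?_ using 1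
    refine measureReal_mono ?_
    rintro ω ⟨p, hp, hω⟩
    exact ⟨hω.encard_eq, (hω.maxPathLength_le_iff l).mpr hp⟩

lemma cond_maxPathLength_le [IsProbabilityMeasure P] (hlam : 0 < lam)
    (hPts : IsPoissonProcess Pts (intensity lam) P)
    (N l : ℕ) :
    (P[|{ω | (Pts ω).encard = N}]).real {ω | maxPathLength (Pts ω) ≤ l}
      = (latticeWordPairs l N).card / (N ! : ℝ) := by
  rw [measureReal_def, cond_apply (measurableSet_encard_eq hPts N), ENNReal.toReal_mul,
    ENNReal.toReal_inv, ← measureReal_def, ← measureReal_def, measureReal_encard_eq hPts,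
    measureReal_encard_eq_inter hPts]
  field_simp

/-- Decomposition according to the number of points. -/
lemma hasSum_measureReal_maxPathLength_le [IsProbabilityMeasure P]
    (hPts : IsPoissonProcess Pts (intensity lam) P)
    (l : ℕ) :
    HasSum (fun N : ℕ => Real.exp (-lam ^ 2) * lam ^ (2 * N) / (N ! : ℝ) ^ 2
        * (latticeWordPairs l N).card)
      (P.real {ω | maxPathLength (Pts ω) ≤ l}) := by
  let A : ℕ → Set Ω := fun N => {ω | (Pts ω).encard = N}
  have hA : ∀ N, MeasurableSet (A N) := fun N => measurableSet_encard_eq hPts N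
  have hd : Pairwise (Function.onFun Disjoint A) := by
    intro M N hne
    refine Set.disjoint_left.mpr fun ω (h1 : _ = _) (h2 : _ = _) => hne ?_
    exact_mod_cast h1.symm.trans h2
  have hU : P (⋃ N, A N) = 1 := by
    have h1 : ∀ N, P (A N) = poissonMeasure ((intensity lam) Set.univ).toNNReal {N} := by
      intro N
      have := hPts.law_count Set.univ MeasurableSet.univ (measure_ne_top _ _) N
      simpa only [Set.inter_univ] using this
    rw [measure_iUnion hd hA, tsum_congr h1, ← measure_iUnion (by
      intro M N hne; exact Set.disjoint_singleton.mpr hne) fun _ => measurableSet_singleton _,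
      Set.iUnion_of_singleton, measure_univ]
  have hres : P.restrict (⋃ N, A N) = P :=
    Measure.restrict_eq_self_of_ae_mem ((prob_compl_eq_zero_iff (MeasurableSet.iUnion hA)).mpr hU)
  have hsum : P {ω | maxPathLength (Pts ω) ≤ l}
      = ∑' N, P (A N ∩ {ω | maxPathLength (Pts ω) ≤ l}) := by
    conv_lhs => rw [← hres, Measure.restrict_iUnion hd hA, Measure.sum_apply_of_countable]
    refine tsum_congr fun N => ?_
    rw [Measure.restrict_apply' (hA N), Set.inter_comm]
  have h2 := ENNReal.hasSum_toReal (f := fun N => P (A N ∩ {ω | maxPathLength (Pts ω) ≤ l}))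
    (by rw [← hsum]; exact measure_ne_top _ _)
  rw [← ENNReal.tsum_toReal_eq fun N => measure_ne_top _ _, ← hsum] at h2
  convert! h2 using 2 with N
  exact (measureReal_encard_eq_inter hPts N l).symm

end Limit

/-! ### Comparison of the two sides -/

lemma traceMoment_two_mul (l N : ℕ) :
    traceMoment l (2 * N) = ((2 * N)! : ℝ) / (N ! : ℝ) ^ 2 * (latticeWordPairs l N).card := by
  have h : ((2 * N).choose N : ℝ) = ((2 * N)! : ℝ) / (N ! : ℝ) ^ 2 := by
    rw [Nat.cast_choose ℝ (by omega : N ≤ 2 * N), two_mul, Nat.add_sub_cancel, sq]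
  rw [traceMoment, if_pos (even_two_mul N), Nat.mul_div_cancel_left N two_pos, h]

/-- Only the even terms of the exponential series contribute. -/
lemma hasSum_traceMoment_iff (l : ℕ) (lam s : ℝ) :
    HasSum (fun N : ℕ => lam ^ (2 * N) / (N ! : ℝ) ^ 2 * (latticeWordPairs l N).card) s
      ↔ HasSum (fun n : ℕ => lam ^ n / (n ! : ℝ) * traceMoment l n) s := by
  have hinj : Function.Injective fun N : ℕ => 2 * N := fun a b h => by
    simpa using h
  rw [← hinj.hasSum_iff (f := fun n : ℕ => lam ^ n / (n ! : ℝ) * traceMoment l n)]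
  · refine Eq.to_iff (congrArg (HasSum · s) (funext fun N => ?_))
    have : ((2 * N)! : ℝ) ≠ 0 := by positivity
    simp only [Function.comp_apply, traceMoment_two_mul]
    field_simp
  · intro n hn
    rw [traceMoment, if_neg, mul_zero]
    rintro ⟨m, rfl⟩
    exact hn ⟨m, two_mul m⟩

/-- The distribution function of the maximal path length is determined by the moments. -/
lemma measureReal_maxPathLength_le {Ω : Type*} [MeasurableSpace Ω] {P : Measure Ω}
    [IsProbabilityMeasure P] {lam : ℝ} {Pts : Ω → Set (ℝ × ℝ)}
    (hPts : IsPoissonProcess Pts (intensity lam) P) {l : ℕ} {s : ℝ}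
    (hs : HasSum (fun n : ℕ => lam ^ n / (n ! : ℝ) * traceMoment l n) s) :
    P.real {ω | maxPathLength (Pts ω) ≤ l} = Real.exp (-lam ^ 2) * s := by
  refine (hasSum_measureReal_maxPathLength_le hPts l).unique ?_
  convert! ((hasSum_traceMoment_iff l lam s).mpr hs).mul_left (Real.exp (-lam ^ 2)) using 2 with N
  ring

end Hammersley

end

theorem mainTheorem3 {Ω : Type*} [MeasurableSpace Ω] (P : Measure Ω) [IsProbabilityMeasure P]
    (lam : ℝ) (hlam : 0 < lam) (Pts : Ω → Set (ℝ × ℝ))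
    (hPts : Hammersley.IsPoissonProcess Pts (Hammersley.intensity lam) P) (l : ℕ) :
    (∀ N : ℕ,
      (P[|{ω | (Pts ω).encard = N}]).real {ω | Hammersley.maxPathLength (Pts ω) ≤ l}
          = 1 / (N ! : ℝ) * Hammersley.eigenvalueAverage l
              (fun θ => ‖∑ j, Complex.exp (Complex.I * θ j)‖ ^ (2 * N)) ∧
      (P[|{ω | (Pts ω).encard = N}]).real {ω | Hammersley.maxPathLength (Pts ω) ≤ l}
          = (N ! : ℝ) / ((2 * N)! : ℝ) * Hammersley.eigenvalueAverage l
              (fun θ => (∑ j, 2 * Real.cos (θ j)) ^ (2 * N))) ∧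
    ((P.real {ω | Hammersley.maxPathLength (Pts ω) ≤ l} : ℝ) : ℂ)
        = Complex.exp (-(lam : ℂ) ^ 2) * Hammersley.unitaryAverage l
            (fun U => Complex.exp ((lam : ℂ) * Matrix.trace (U + U.conjTranspose))) ∧
    P.real {ω | Hammersley.maxPathLength (Pts ω) ≤ l}
        = Real.exp (-lam ^ 2) * Hammersley.eigenvalueAverage l
            (fun θ => Real.exp (lam * ∑ j, 2 * Real.cos (θ j))) := by
  have hs := Hammersley.hasSum_eigenvalueAverage_exp l lam
  have hP := Hammersley.measureReal_maxPathLength_le hPts hs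
  refine ⟨fun N => ⟨?_, ?_⟩, ?_, hP⟩
  · rw [Hammersley.cond_maxPathLength_le hlam hPts, Hammersley.eigenvalueAverage_norm_pow]
    ring
  · have h1 : ((2 * N)! : ℝ) ≠ 0 := by positivity
    rw [Hammersley.cond_maxPathLength_le hlam hPts, Hammersley.eigenvalueAverage_cos_pow,
      Hammersley.traceMoment_two_mul]
    field_simp
  · rw [hP, (Hammersley.hasSum_unitaryAverage_exp l lam).unique (Complex.hasSum_ofReal.mpr hs)]
    push_cast
    rfl
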